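/- Conventions. A point process on $\mathbb{R}^d$ is a random locally finite integer-valued measure; its mean measure is $\alpha(B)=E\,\Phi(B)$, and a measure is called Radon if it is finite on bounded Borel sets. For distributions $\mu,\nu$ on $\mathbb{Z}^+=\{0,1,2,\dots\}$, $\mu\le_{cx}\nu$ means $\sum_n f(n)\mu(\{n\})\le\sum_n f(n)\nu(\{n\})$ for every convex $f:\mathbb{R}\to\mathbb{R}$ for which both expectations are finite. A Lebesgue measurable $f:\mathbb{R}^k\to\mathbb{R}$ is directionally convex (dcx) if $\Delta^i_\varepsilon\Delta^j_\delta f(x)\ge0$ for all $x$, all $\varepsilon,\delta>0$ and all $i,j\in\{1,\dots,k\}$, where $\Delta^i_\varepsilon f(x)=f(x+\varepsilon e_i)-f(x)$. For point processes, $\Phi_1\le_{dcx}\Phi_2$ means that for all bounded Borel sets $B_1,\dots,B_k$ and every dcx function $f$ on $\mathbb{R}^k$, $E f(\Phi_1(B_1),\dots,\Phi_1(B_k))\le E f(\Phi_2(B_1),\dots,\Phi_2(B_k))$ whenever both expectations are finite. Let $\mathcal N$ and $\mathcal X$ be probability kernels from $\mathbb{R}^d$ to $\mathbb{Z}^+$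 and to $\mathbb{R}^d$. The perturbation of a point process $\Phi$ with replication kernel $\mathcal N$ and translation kernel $\mathcal X$ is $\Phi^{pert}=\sum_{X\in\Phi}\sum_{i=1}^{N_X}\delta_{X+Y_{iX}}$ (points counted with multiplicity), where, given $\Phi$, all the $N_X$ and $Y_{iX}$ ($X\in\Phi$, $i\ge1$) are independent, $N_X$ has distribution $\mathcal N(X,\cdot)$ and $Y_{iX}$ has distribution $\mathcal X(X,\cdot)$. Its mean measure is Radon if $$\int_{\mathbb{R}^d} n(x)\,\mathcal X(x,B-x)\,\alpha(dx)<\infty\quad\text{for all bounded Borel } B,\qquad n(x)=\sum_{k\ge1}k\,\mathcal N(x,\{k\}).\qquad(*)$$ Proposition. (1) Let $\Phi$ be a point process on $\mathbb{R}^d$ with Radon mean measure $\alpha$, and let $\Phi^{pert}_1,\Phi^{pert}_2$ be two perturbations of $\Phi$ with the same translation kernel $\mathcal X$ and replication kernels $\mathcal N_1,\mathcal N_2$, both satisfying $(*)$. If $\mathcal N_1(x,\cdot)\le_{cx}\mathcal N_2(x,\cdot)$ for $\alpha$-almost every $x$, then $\Phi_1^{pert}\le_{dcx}\Phi_2^{pert}$.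 (2) Consequently, let $\lambda\ge0$ and let $\Psi$ be a perturbation of the deterministic lattice $\mathbb{Z}^d$ with $\mathcal X(x,\cdot)$ uniform on $[0,1)^d$ and replication kernel $\mathcal N$, satisfying $(*)$. If $\mathcal N(z,\cdot)\le_{cx}Poi(\lambda)$ for all $z\in\mathbb{Z}^d$, then $\Psi$ is sub-Poisson: it is dcx smaller than the homogeneous Poisson point process of intensity $\lambda$. If $Poi(\lambda)\le_{cx}\mathcal N(z,\cdot)$ for all $z\in\mathbb{Z}^d$, then $\Psi$ is super-Poisson: it is dcx larger than that Poisson process. In particular $\Psi$ is sub-Poisson if every $\mathcal N(x,\cdot)$ is binomial $Bin(r,p)$ with $rp=\lambda$, and super-Poisson if every $\mathcal N(x,\cdot)$ is geometric, $\mathcal N(x,\{i\})=p(1-p)^i$ for $i\ge0$, with $p=1/(1+\lambda)$. -/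

import Mathlib

open MeasureTheory ProbabilityTheory Set
open scoped ENNReal NNReal

noncomputable section

/-! ### Convex order and directionally convex order -/

/-- Convex order `μ ≤cx ν` of two distributions on the non-negative integers: expectations of
convex functions on the real line are ordered whenever both of them are finite. -/
def ConvexLE (μ ν : Measure ℕ) : Prop :=
  ∀ f : ℝ → ℝ, ConvexOn ℝ univ f →
    Integrable (fun n : ℕ => f n) μ → Integrable (fun n : ℕ => f n) ν →
      ∫ n : ℕ, f n ∂μ ≤ ∫ n : ℕ, f n ∂ν

/-- The discrete differential operator `Δ_ε^i f (x) = f (x + ε e_i) - f x`. -/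
def discreteDiff {k : ℕ} (i : Fin k) (ε : ℝ) (f : (Fin k → ℝ) → ℝ) : (Fin k → ℝ) → ℝ :=
  fun x => f (x + Pi.single i ε) - f x

/-- Directionally convex functions on `ℝ^k`: Lebesgue measurable functions all of whose
second order discrete differences (with `i = j` allowed) are non-negative. -/
def DirectionallyConvex {k : ℕ} (f : (Fin k → ℝ) → ℝ) : Prop :=
  AEMeasurable f (volume : Measure (Fin k → ℝ)) ∧
    ∀ (x : Fin k → ℝ) (ε δ : ℝ), 0 < ε → 0 < δ → ∀ i j : Fin k,
      0 ≤ discreteDiff i ε (discreteDiff j δ f) x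

/-- `X ≤dcx Y` for random vectors `X` and `Y`, possibly on different probability spaces. -/
def DcxLE {Ω₁ Ω₂ : Type*} [MeasurableSpace Ω₁] [MeasurableSpace Ω₂] {k : ℕ}
    (P₁ : Measure Ω₁) (X : Ω₁ → Fin k → ℝ) (P₂ : Measure Ω₂) (Y : Ω₂ → Fin k → ℝ) : Prop :=
  ∀ f : (Fin k → ℝ) → ℝ, DirectionallyConvex f →
    Integrable (fun ω => f (X ω)) P₁ → Integrable (fun ω => f (Y ω)) P₂ →
      ∫ ω, f (X ω) ∂P₁ ≤ ∫ ω, f (Y ω) ∂P₂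

/-! ### Point processes on `ℝ^d` -/

/-- A point process on `ℝ^d`: a random measure which is almost surely locally finite and
integer valued (on bounded Borel sets). -/
def IsPointProcess {Ω : Type*} [MeasurableSpace Ω] {d : ℕ} (P : Measure Ω)
    (Φ : Ω → Measure (EuclideanSpace ℝ (Fin d))) : Prop :=
  Measurable Φ ∧ ∀ᵐ ω ∂P, ∀ B : Set (EuclideanSpace ℝ (Fin d)),
    MeasurableSet B → Bornology.IsBounded B → ∃ n : ℕ, Φ ω B = n

/-- The mean measure `B ↦ E (Φ B)`. -/
def meanMeasure {Ω : Type*} [MeasurableSpace Ω] {d : ℕ} (P : Measure Ω)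
    (Φ : Ω → Measure (EuclideanSpace ℝ (Fin d))) : Measure (EuclideanSpace ℝ (Fin d)) :=
  P.bind Φ

/-- A measure on `ℝ^d` which is finite on bounded Borel sets. -/
def IsRadon {d : ℕ} (α : Measure (EuclideanSpace ℝ (Fin d))) : Prop :=
  ∀ B : Set (EuclideanSpace ℝ (Fin d)), MeasurableSet B → Bornology.IsBounded B → α B < ∞

/-- `Φ₁ ≤dcx Φ₂` for point processes: the vectors of numbers of points in any finitely many
bounded Borel sets are `dcx` ordered. -/
def ProcessDcxLE {Ω₁ Ω₂ : Type*} [MeasurableSpace Ω₁] [MeasurableSpace Ω₂] {d : ℕ}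
    (P₁ : Measure Ω₁) (Φ₁ : Ω₁ → Measure (EuclideanSpace ℝ (Fin d)))
    (P₂ : Measure Ω₂) (Φ₂ : Ω₂ → Measure (EuclideanSpace ℝ (Fin d))) : Prop :=
  ∀ (k : ℕ) (B : Fin k → Set (EuclideanSpace ℝ (Fin d))),
    (∀ i, MeasurableSet (B i)) → (∀ i, Bornology.IsBounded (B i)) →
      DcxLE P₁ (fun ω i => (Φ₁ ω).real (B i)) P₂ (fun ω i => (Φ₂ ω).real (B i))

/-- `Φ` is a Poisson point process with (locally finite) mean measure `Λ`. -/
def IsPoissonProcess {Ω : Type*} [MeasurableSpace Ω] {d : ℕ} (P : Measure Ω)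
    (Φ : Ω → Measure (EuclideanSpace ℝ (Fin d)))
    (Λ : Measure (EuclideanSpace ℝ (Fin d))) : Prop :=
  IsPointProcess P Φ ∧ IsRadon Λ ∧
  (∀ B : Set (EuclideanSpace ℝ (Fin d)), MeasurableSet B → Bornology.IsBounded B →
    P.map (fun ω => Φ ω B) =
      (poissonMeasure (Λ B).toNNReal).map (fun n : ℕ => (n : ℝ≥0∞))) ∧
  (∀ (k : ℕ) (B : Fin k → Set (EuclideanSpace ℝ (Fin d))),
    (∀ i, MeasurableSet (B i)) → (∀ i, Bornology.IsBounded (B i)) →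
    (Pairwise fun i j => Disjoint (B i) (B j)) →
      iIndepFun (fun i ω => Φ ω (B i)) P)

/-- `Ψ` is `dcx` smaller than the Poisson point process with mean measure `Λ` (whose law is `Q`,
a distribution on the space of measures). -/
def IsSubPoisson {Ω : Type*} [MeasurableSpace Ω] {d : ℕ} (P : Measure Ω)
    (Ψ : Ω → Measure (EuclideanSpace ℝ (Fin d)))
    (Λ : Measure (EuclideanSpace ℝ (Fin d))) : Prop :=
  ∃ Q : Measure (Measure (EuclideanSpace ℝ (Fin d))), IsProbabilityMeasure Q ∧
    IsPoissonProcess Q id Λ ∧ ProcessDcxLE P Ψ Q id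

/-- `Ψ` is `dcx` larger than the Poisson point process with mean measure `Λ`. -/
def IsSuperPoisson {Ω : Type*} [MeasurableSpace Ω] {d : ℕ} (P : Measure Ω)
    (Ψ : Ω → Measure (EuclideanSpace ℝ (Fin d)))
    (Λ : Measure (EuclideanSpace ℝ (Fin d))) : Prop :=
  ∃ Q : Measure (Measure (EuclideanSpace ℝ (Fin d))), IsProbabilityMeasure Q ∧
    IsPoissonProcess Q id Λ ∧ ProcessDcxLE Q id P Ψ

/-! ### Perturbation of a point process -/

/-- The point measure `∑_{m < κ} δ_{x m}`. -/
def pointMeasure {d : ℕ} (κ : ℕ∞) (x : ℕ → EuclideanSpace ℝ (Fin d)) :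
    Measure (EuclideanSpace ℝ (Fin d)) :=
  Measure.sum fun m : ℕ => if (m : ℕ∞) < κ then Measure.dirac (x m) else 0

/-- The point measure `∑_{m < κ} ∑_{i < n m} δ_{x m + y m i}`: the `m`-th point is replaced by
`n m` replicas, the `i`-th of them translated by `y m i`. -/
def perturbedMeasure {d : ℕ} (κ : ℕ∞) (x : ℕ → EuclideanSpace ℝ (Fin d)) (n : ℕ → ℕ)
    (y : ℕ → ℕ → EuclideanSpace ℝ (Fin d)) : Measure (EuclideanSpace ℝ (Fin d)) :=
  Measure.sum fun m : ℕ =>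
    if (m : ℕ∞) < κ then ∑ i ∈ Finset.range (n m), Measure.dirac (x m + y m i) else 0

/-- `Ψ`, on the probability space `(Ω', P')`, is a perturbation of the point process `Φ` driven by
the replication kernel `N` and the translation kernel `X`. That is, the space `Ω'` carries a copy
`∑_{m < κ} δ_{x m}` of `Φ`, together with marks `n m` and `y m i`, such that, given the points
`(κ, x)`, all the marks are independent, `n m` with the distribution `N (x m)` and `y m i` with the
distribution `X (x m)`; and `Ψ` is the measure of replicated and translated points. -/
def IsPerturbation {Ω Ω' : Type*} [MeasurableSpace Ω] [MeasurableSpace Ω'] {d : ℕ}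
    (P : Measure Ω) (Φ : Ω → Measure (EuclideanSpace ℝ (Fin d)))
    (N : Kernel (EuclideanSpace ℝ (Fin d)) ℕ)
    (X : Kernel (EuclideanSpace ℝ (Fin d)) (EuclideanSpace ℝ (Fin d)))
    (P' : Measure Ω') (Ψ : Ω' → Measure (EuclideanSpace ℝ (Fin d))) : Prop :=
  ∃ (κ : Ω' → ℕ∞) (x : ℕ → Ω' → EuclideanSpace ℝ (Fin d)) (n : ℕ → Ω' → ℕ)
    (y : ℕ → ℕ → Ω' → EuclideanSpace ℝ (Fin d)),
    Measurable κ ∧ (∀ m, Measurable (x m)) ∧ (∀ m, Measurable (n m)) ∧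
    (∀ m i, Measurable (y m i)) ∧
    IdentDistrib Φ (fun ω => pointMeasure (κ ω) (fun m => x m ω)) P P' ∧
    (∀ (r : ℕ) (A : ℕ → Set ℕ) (C : ℕ → ℕ → Set (EuclideanSpace ℝ (Fin d))),
      (∀ m i, MeasurableSet (C m i)) →
      P'⟦{ω | ∀ m < r, n m ω ∈ A m ∧ ∀ i < r, y m i ω ∈ C m i} |
          MeasurableSpace.comap (fun ω => (κ ω, fun m => x m ω)) inferInstance⟧
        =ᵐ[P'] fun ω => ∏ m ∈ Finset.range r,
          ((N (x m ω)).real (A m) * ∏ i ∈ Finset.range r, (X (x m ω)).real (C m i))) ∧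
    (∀ᵐ ω ∂P', Ψ ω =
      perturbedMeasure (κ ω) (fun m => x m ω) (fun m => n m ω) (fun m i => y m i ω))

/-- The mean measure of the perturbation of a point process with mean measure `α` is finite on
bounded Borel sets: `∫ n(x) X(x, B - x) α(dx) < ∞` with `n(x)` the mean of `N(x, ·)`. -/
def PerturbationRadon {d : ℕ} (α : Measure (EuclideanSpace ℝ (Fin d)))
    (N : Kernel (EuclideanSpace ℝ (Fin d)) ℕ)
    (X : Kernel (EuclideanSpace ℝ (Fin d)) (EuclideanSpace ℝ (Fin d))) : Prop :=
  ∀ B : Set (EuclideanSpace ℝ (Fin d)), MeasurableSet B → Bornology.IsBounded B →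
    ∫⁻ x, (∫⁻ k : ℕ, (k : ℝ≥0∞) ∂(N x)) * X x {y | x + y ∈ B} ∂α < ∞

/-! ### The integer lattice -/

/-- The point of `ℝ^d` with the integer coordinates `z`. -/
def latticePoint {d : ℕ} (z : Fin d → ℤ) : EuclideanSpace ℝ (Fin d) :=
  WithLp.toLp 2 fun i => (z i : ℝ)

/-- The lattice `ℤ^d` as a (deterministic) point configuration `∑_z δ_z`. -/
def latticeMeasure (d : ℕ) : Measure (EuclideanSpace ℝ (Fin d)) :=
  Measure.sum fun z : Fin d → ℤ => Measure.dirac (latticePoint z)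

/-- The translation kernel `X(x, ·)` uniform on the unit cube `[0, 1)^d`, for every `x`. -/
def cubeKernel (d : ℕ) : Kernel (EuclideanSpace ℝ (Fin d)) (EuclideanSpace ℝ (Fin d)) :=
  Kernel.const _ (volume.restrict {y | ∀ i, 0 ≤ y i ∧ y i < 1})

/-- `Ψ` is the perturbation of the deterministic lattice `ℤ^d` with replication kernel `N` and
translations uniform on the unit cube, with Radon mean measure. -/
def IsPerturbedLattice {Ω : Type*} [MeasurableSpace Ω] {d : ℕ}
    (N : Kernel (EuclideanSpace ℝ (Fin d)) ℕ)
    (P : Measure Ω) (Ψ : Ω → Measure (EuclideanSpace ℝ (Fin d))) : Prop :=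
  PerturbationRadon (latticeMeasure d) N (cubeKernel d) ∧
    IsPerturbation (Measure.dirac ()) (fun _ => latticeMeasure d) N (cubeKernel d) P Ψ

end

/-! Fix bounded Borel sets B_1, ..., B_k. Given the points of the process, each point x contributes
an independent vector in ℕ^k: a sum of N_x independent 0-1 vectors with law `hitLaw X B x`. Let g be
increasing and directionally convex on ℕ^k and let S_n be a sum of n such independent vectors. Then
n ↦ E g(S_n) is increasing and convex, by directional convexity at S_n with the next two summands as
increments (`IncDcx.lintegral_convPow_convex`). An increasing convex sequence is a constant plus a
non-negative combination of hinges (n - i)⁺, so the convex order of the replication numbers passes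
to the compound laws (`IncDcx.lintegral_compound_le`). The resulting order survives independent sums
(`CountDcxLE.conv`) and the monotone limit over the first M points (`countDcxLE_countLaw`).

On ℕ^k a general dcx function is a non-negative increasing one plus an affine function
(`DirectionallyConvex.exists_incDcx`). The affine part has the same expectation on both sides,
because the convex order forces equal means.

Two perturbations may enumerate their points differently; only the law of the point measure is
common. Conditionally independent marks are realised by independent uniform seeds
(`markedLaw_eq_seedLaw`), and the Laplace transform of the counts is then E exp(-∫ ℓ dΦ), with ℓ(x)
minus the logarithm of the transform of the contribution of x. Hence the law of the counts depends
on the law of Φ alone (`countLaw_eq_of_map_eq`).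

For the lattice with Poisson replication and disjoint B_j, ℓ(x) is linear in the hitting
probabilities. Since the cubes tile the space, ℓ sums over the lattice to λ ∑ (1 - exp(-t_j))
vol(B_j): the counts are independent Poisson variables (`countLaw_poisson`) and the perturbed
lattice is a Poisson process. Other replication kernels are compared with this one.

For the binomial-Poisson and Poisson-geometric pairs the ratio of weights is unimodal with turning
point λ, so the first law is the heavier one exactly on an interval (`convexLE_of_unimodal_ratio`).
Subtracting from a convex function a suitable chord gives integrands whose signs match the
difference of the laws (`convexLE_of_interval`). -/

/-! ### Integrals of convex sequences -/

/-- A finite convex increasing sequence is a non-negative combination of the hinge functions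
`n ↦ (n - i)⁺`. -/
lemma exists_hinge_expansion {h : ℕ → ℝ≥0∞} (hfin : ∀ n, h n ≠ ∞) (hmono : Monotone h)
    (hconv : ∀ n, h (n + 1) + h (n + 1) ≤ h (n + 2) + h n) :
    ∃ c : ℕ → ℝ≥0∞, ∀ n, h n = h 0 + ∑' i, c i * ((n - i : ℕ) : ℝ≥0∞) := by
  set D : ℕ → ℝ≥0∞ := fun n => h (n + 1) - h n with hD
  have hDadd (n : ℕ) : h (n + 1) = h n + D n :=
    (add_tsub_cancel_of_le (hmono (Nat.le_succ n))).symm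
  have hDmono (n : ℕ) : D n ≤ D (n + 1) := by
    have h1 := hconv n
    rw [hDadd (n + 1)] at h1
    have h2 : h (n + 1) ≤ D (n + 1) + h n := by
      rw [add_assoc] at h1
      exact (ENNReal.add_le_add_iff_left (hfin (n + 1))).1 h1
    rw [hDadd n, add_comm] at h2
    exact (ENNReal.add_le_add_iff_right (hfin n)).1 h2
  -- Second differences, with the first slope `D 0` as `c 0`, so that `D n` is the sum of `c i` over
  -- i ≤ n. Monotonicity and convexity make the truncated subtractions exact.
  set c : ℕ → ℝ≥0∞ := fun i => Nat.casesOn i (D 0) fun j => D (j + 1) - D j with hc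
  have hcD (n : ℕ) : D n = ∑ i ∈ Finset.range (n + 1), c i := by
    induction n with
    | zero => simp [hc]
    | succ n ih =>
      rw [Finset.sum_range_succ, ← ih]
      exact (add_tsub_cancel_of_le (hDmono n)).symm
  refine ⟨c, fun n => ?_⟩
  rw [tsum_eq_sum (s := Finset.range n) (fun i hi => by
    rw [Finset.mem_range, not_lt] at hi
    simp [Nat.sub_eq_zero_of_le hi])]
  induction n with
  | zero => simp
  | succ n ih =>
    rw [hDadd n, ih, add_assoc]
    congr 1
    have h1 : ∑ i ∈ Finset.range (n + 1), c i * ((n + 1 - i : ℕ) : ℝ≥0∞) =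
        ∑ i ∈ Finset.range (n + 1), (c i * ((n - i : ℕ) : ℝ≥0∞) + c i) := by
      refine Finset.sum_congr rfl fun i hi => ?_
      rw [Finset.mem_range] at hi
      rw [show n + 1 - i = (n - i) + 1 by omega]
      push_cast
      ring
    rw [h1, Finset.sum_add_distrib, ← hcD, Finset.sum_range_succ]
    simp

lemma integrable_natCast_of_lintegral_lt_top {μ : Measure ℕ} {φ : ℕ → ℕ} (hφ : ∀ n, φ n ≤ n)
    (hμ : ∫⁻ n : ℕ, (n : ℝ≥0∞) ∂μ < ∞) : Integrable (fun n => (φ n : ℝ)) μ := by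
  refine ⟨Measurable.of_discrete.aestronglyMeasurable, ?_⟩
  refine lt_of_le_of_lt (lintegral_mono fun n => ?_) hμ
  simpa [Real.enorm_natCast] using hφ n

lemma lintegral_natCast_eq_ofReal {μ : Measure ℕ} {φ : ℕ → ℕ}
    (hφ : Integrable (fun n => (φ n : ℝ)) μ) :
    ∫⁻ n, (φ n : ℝ≥0∞) ∂μ = ENNReal.ofReal (∫ n, (φ n : ℝ) ∂μ) := by
  rw [ofReal_integral_eq_lintegral_ofReal hφ (ae_of_all _ fun n => Nat.cast_nonneg _)]
  simp

/-- Truncated subtraction of i is the convex function `max (t - i) 0` at the integers. The finite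
means supply the integrability without which `ConvexLE` gives nothing. -/
lemma ConvexLE.lintegral_hinge_le {μ ν : Measure ℕ} (h : ConvexLE μ ν)
    (hμ : ∫⁻ n : ℕ, (n : ℝ≥0∞) ∂μ < ∞) (hν : ∫⁻ n : ℕ, (n : ℝ≥0∞) ∂ν < ∞) (i : ℕ) :
    ∫⁻ n : ℕ, ((n - i : ℕ) : ℝ≥0∞) ∂μ ≤ ∫⁻ n : ℕ, ((n - i : ℕ) : ℝ≥0∞) ∂ν := by
  have key (n : ℕ) : max ((n : ℝ) - i) 0 = ((n - i : ℕ) : ℝ) := by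
    rcases le_total i n with hin | hin
    · rw [Nat.cast_sub hin, max_eq_left]
      exact sub_nonneg.2 (by exact_mod_cast hin)
    · rw [Nat.sub_eq_zero_of_le hin, max_eq_right]
      · simp
      · exact sub_nonpos.2 (by exact_mod_cast hin)
  have hconv : ConvexOn ℝ univ fun t : ℝ => max (t - i) 0 :=
    ((convexOn_id convex_univ).sub (concaveOn_const _ convex_univ)).sup
      (convexOn_const _ convex_univ)
  have iμ := integrable_natCast_of_lintegral_lt_top (φ := fun n => n - i) (by simp) hμ
  have iν := integrable_natCast_of_lintegral_lt_top (φ := fun n => n - i) (by simp) hν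
  have := h _ hconv (by simpa only [key] using iμ) (by simpa only [key] using iν)
  simp only [key] at this
  rw [lintegral_natCast_eq_ofReal iμ, lintegral_natCast_eq_ofReal iν]
  exact ENNReal.ofReal_le_ofReal this

/-- Both t and -t are convex. -/
lemma ConvexLE.lintegral_id_eq {μ ν : Measure ℕ} (h : ConvexLE μ ν)
    (hμ : ∫⁻ n : ℕ, (n : ℝ≥0∞) ∂μ < ∞) (hν : ∫⁻ n : ℕ, (n : ℝ≥0∞) ∂ν < ∞) :
    ∫⁻ n : ℕ, (n : ℝ≥0∞) ∂μ = ∫⁻ n : ℕ, (n : ℝ≥0∞) ∂ν := by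
  have iμ := integrable_natCast_of_lintegral_lt_top (φ := id) (fun _ => le_rfl) hμ
  have iν := integrable_natCast_of_lintegral_lt_top (φ := id) (fun _ => le_rfl) hν
  have h1 := h _ (convexOn_id convex_univ) iμ iν
  have h2 := h _ (concaveOn_id convex_univ).neg iμ.neg iν.neg
  have e1 := lintegral_natCast_eq_ofReal iμ
  have e2 := lintegral_natCast_eq_ofReal iν
  simp only [id] at e1 e2 h1
  simp only [Pi.neg_apply, id, integral_neg] at h2
  rw [e1, e2, le_antisymm h1 (by linarith)]

lemma ConvexLE.lintegral_le {μ ν : Measure ℕ} [IsProbabilityMeasure μ] [IsProbabilityMeasure ν]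
    (hle : ConvexLE μ ν) (hμ : ∫⁻ n : ℕ, (n : ℝ≥0∞) ∂μ < ∞)
    (hν : ∫⁻ n : ℕ, (n : ℝ≥0∞) ∂ν < ∞) {h : ℕ → ℝ≥0∞} (hfin : ∀ n, h n ≠ ∞)
    (hmono : Monotone h) (hconv : ∀ n, h (n + 1) + h (n + 1) ≤ h (n + 2) + h n) :
    ∫⁻ n, h n ∂μ ≤ ∫⁻ n, h n ∂ν := by
  obtain ⟨c, hc⟩ := exists_hinge_expansion hfin hmono hconv
  have expand (m : Measure ℕ) [IsProbabilityMeasure m] : ∫⁻ n, h n ∂m =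
      h 0 + ∑' i, c i * ∫⁻ n : ℕ, ((n - i : ℕ) : ℝ≥0∞) ∂m := by
    rw [lintegral_congr hc, lintegral_add_left .of_discrete,
      lintegral_tsum fun i => Measurable.of_discrete.aemeasurable]
    simp [lintegral_const_mul _ Measurable.of_discrete]
  rw [expand μ, expand ν]
  refine add_le_add le_rfl (ENNReal.tsum_le_tsum fun i => mul_le_mul' le_rfl ?_)
  exact hle.lintegral_hinge_le hμ hν i

/-! ### Increasing directionally convex order of count vectors -/

/-- Increasing directionally convex functions on `ℕ^k`, with values in `[0, ∞)`. -/
structure IncDcx {k : ℕ} (g : (Fin k → ℕ) → ℝ≥0∞) : Prop where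
  mono : Monotone g
  ne_top : ∀ a, g a ≠ ∞
  dcx : ∀ s a b, g (s + a) + g (s + b) ≤ g (s + a + b) + g s

lemma IncDcx.shift {k : ℕ} {g : (Fin k → ℕ) → ℝ≥0∞} (hg : IncDcx g) (c : Fin k → ℕ) :
    IncDcx fun a => g (c + a) where
  mono a b hab := hg.mono (add_le_add_right hab c)
  ne_top a := hg.ne_top _
  dcx s a b := by simpa only [add_assoc] using hg.dcx (c + s) a b

/-- Increasing directionally convex order of distributions on `ℕ^k`. -/
def CountDcxLE {k : ℕ} (μ ν : Measure (Fin k → ℕ)) : Prop :=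
  ∀ g : (Fin k → ℕ) → ℝ≥0∞, IncDcx g → ∫⁻ a, g a ∂μ ≤ ∫⁻ a, g a ∂ν

/-- The two summands are replaced one at a time: a translate of an `IncDcx` function is again
`IncDcx`, and Tonelli exchanges the order of integration in between. -/
lemma CountDcxLE.conv {k : ℕ} {μ₁ μ₂ ν₁ ν₂ : Measure (Fin k → ℕ)} [SFinite μ₁] [SFinite μ₂]
    [SFinite ν₁] [SFinite ν₂] (hμ : CountDcxLE μ₁ μ₂) (hν : CountDcxLE ν₁ ν₂) :
    CountDcxLE (μ₁ ∗ ν₁) (μ₂ ∗ ν₂) := by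
  intro g hg
  rw [Measure.lintegral_conv .of_discrete, Measure.lintegral_conv .of_discrete]
  calc ∫⁻ a, ∫⁻ b, g (a + b) ∂ν₁ ∂μ₁ ≤ ∫⁻ a, ∫⁻ b, g (a + b) ∂ν₂ ∂μ₁ :=
        lintegral_mono fun a => hν _ (hg.shift a)
    _ = ∫⁻ b, ∫⁻ a, g (a + b) ∂μ₁ ∂ν₂ :=
        lintegral_lintegral_swap Measurable.of_discrete.aemeasurable
    _ ≤ ∫⁻ b, ∫⁻ a, g (a + b) ∂μ₂ ∂ν₂ :=
        lintegral_mono fun b => by simpa only [add_comm] using hμ _ (hg.shift b)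
    _ = ∫⁻ a, ∫⁻ b, g (a + b) ∂ν₂ ∂μ₂ :=
        (lintegral_lintegral_swap Measurable.of_discrete.aemeasurable).symm

/-- Convolution powers. -/
noncomputable def convPow {k : ℕ} (π : Measure (Fin k → ℕ)) : ℕ → Measure (Fin k → ℕ)
  | 0 => Measure.dirac 0
  | n + 1 => convPow π n ∗ π

instance {k : ℕ} (π : Measure (Fin k → ℕ)) [IsProbabilityMeasure π] (n : ℕ) :
    IsProbabilityMeasure (convPow π n) := by
  induction n with
  | zero => exact inferInstanceAs (IsProbabilityMeasure (Measure.dirac 0))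
  | succ n ih => exact inferInstanceAs (IsProbabilityMeasure (convPow π n ∗ π))

lemma lintegral_convPow_succ {k : ℕ} (π : Measure (Fin k → ℕ)) [IsProbabilityMeasure π] (n : ℕ)
    (g : (Fin k → ℕ) → ℝ≥0∞) :
    ∫⁻ a, g a ∂convPow π (n + 1) = ∫⁻ s, ∫⁻ a, g (s + a) ∂π ∂convPow π n :=
  Measure.lintegral_conv .of_discrete

/-- Bounded support makes the expectations of an increasing g finite, as the hinge expansion
requires. -/
lemma ae_convPow_le {k : ℕ} {π : Measure (Fin k → ℕ)} [IsProbabilityMeasure π]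
    (hπ : ∀ᵐ a ∂π, a ≤ 1) (n : ℕ) : ∀ᵐ a ∂convPow π n, a ≤ fun _ => n := by
  induction n with
  | zero =>
    rw [convPow, ae_dirac_iff .of_discrete]
    exact fun _ => le_rfl
  | succ n ih =>
    rw [convPow, Measure.conv, ae_map_iff (by fun_prop) .of_discrete]
    have h1 := Measure.quasiMeasurePreserving_fst (μ := convPow π n) (ν := π) |>.ae ih
    have h2 := Measure.quasiMeasurePreserving_snd (μ := convPow π n) (ν := π) |>.ae hπ
    filter_upwards [h1, h2] with p hp1 hp2
    intro j
    have := add_le_add (hp1 j) (hp2 j)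
    simpa using this

lemma IncDcx.lintegral_convPow_ne_top {k : ℕ} {g : (Fin k → ℕ) → ℝ≥0∞} (hg : IncDcx g)
    {π : Measure (Fin k → ℕ)} [IsProbabilityMeasure π] (hπ : ∀ᵐ a ∂π, a ≤ 1) (n : ℕ) :
    ∫⁻ a, g a ∂convPow π n ≠ ∞ := by
  refine ne_top_of_le_ne_top (hg.ne_top fun _ => n) ?_
  calc ∫⁻ a, g a ∂convPow π n ≤ ∫⁻ _, g (fun _ => n) ∂convPow π n :=
        lintegral_mono_ae <| (ae_convPow_le hπ n).mono fun a ha => hg.mono ha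
    _ = _ := by simp

lemma IncDcx.lintegral_convPow_mono {k : ℕ} {g : (Fin k → ℕ) → ℝ≥0∞} (hg : IncDcx g)
    {π : Measure (Fin k → ℕ)} [IsProbabilityMeasure π] :
    Monotone fun n => ∫⁻ a, g a ∂convPow π n := by
  refine monotone_nat_of_le_succ fun n => ?_
  rw [lintegral_convPow_succ]
  refine lintegral_mono fun s => ?_
  calc g s = ∫⁻ _, g s ∂π := by simp
    _ ≤ _ := lintegral_mono fun a => hg.mono (le_add_of_nonneg_right (zero_le (a := a)))

/-- With s the sum of n terms and a, b two further independent terms, both s + a and s + b have the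
law of n + 1 terms and s + a + b that of n + 2. The claim is the integrated form of `hg.dcx s a b`.
-/
lemma IncDcx.lintegral_convPow_convex {k : ℕ} {g : (Fin k → ℕ) → ℝ≥0∞} (hg : IncDcx g)
    {π : Measure (Fin k → ℕ)} [IsProbabilityMeasure π] (n : ℕ) :
    ∫⁻ a, g a ∂convPow π (n + 1) + ∫⁻ a, g a ∂convPow π (n + 1) ≤
      ∫⁻ a, g a ∂convPow π (n + 2) + ∫⁻ a, g a ∂convPow π n := by
  rw [lintegral_convPow_succ π (n + 1), lintegral_convPow_succ, lintegral_convPow_succ,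
    ← lintegral_add_left .of_discrete, ← lintegral_add_left .of_discrete]
  refine lintegral_mono fun s => ?_
  calc ∫⁻ a, g (s + a) ∂π + ∫⁻ b, g (s + b) ∂π
      = ∫⁻ a, ∫⁻ b, (g (s + a) + g (s + b)) ∂π ∂π := by
        simp only [lintegral_add_left Measurable.of_discrete, lintegral_const, measure_univ,
          mul_one]
    _ ≤ ∫⁻ a, ∫⁻ b, (g (s + a + b) + g s) ∂π ∂π :=
        lintegral_mono fun a => lintegral_mono fun b => hg.dcx s a b
    _ = _ := by
        simp only [lintegral_add_left Measurable.of_discrete, lintegral_const, measure_univ,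
          mul_one]

/-- Compound distributions are monotone with respect to the convex order of the number of
summands. -/
lemma IncDcx.lintegral_compound_le {k : ℕ} {g : (Fin k → ℕ) → ℝ≥0∞} (hg : IncDcx g)
    {π : Measure (Fin k → ℕ)} [IsProbabilityMeasure π] (hπ : ∀ᵐ a ∂π, a ≤ 1)
    {μ ν : Measure ℕ} [IsProbabilityMeasure μ] [IsProbabilityMeasure ν]
    (hle : ConvexLE μ ν) (hμ : ∫⁻ n : ℕ, (n : ℝ≥0∞) ∂μ < ∞)
    (hν : ∫⁻ n : ℕ, (n : ℝ≥0∞) ∂ν < ∞) :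
    ∫⁻ n, ∫⁻ a, g a ∂convPow π n ∂μ ≤ ∫⁻ n, ∫⁻ a, g a ∂convPow π n ∂ν :=
  hle.lintegral_le hμ hν (hg.lintegral_convPow_ne_top hπ) hg.lintegral_convPow_mono
    hg.lintegral_convPow_convex

/-! ### Directionally convex functions on count vectors -/

/-- The embedding of `ℕ^k` in `ℝ^k`. -/
def realCounts {k : ℕ} (a : Fin k → ℕ) : Fin k → ℝ := fun j => a j

lemma realCounts_add {k : ℕ} (a b : Fin k → ℕ) :
    realCounts (a + b) = realCounts a + realCounts b := by
  ext j; simp [realCounts]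

lemma realCounts_single {k : ℕ} (i : Fin k) (n : ℕ) :
    realCounts (Pi.single i n) = Pi.single i (n : ℝ) := by
  ext j
  rcases eq_or_ne i j with rfl | h
  · simp [realCounts]
  · simp [realCounts, Pi.single_eq_of_ne' h]

lemma nonneg_add_induction {k : ℕ} {p : (Fin k → ℕ) → Prop} (h0 : p 0)
    (hadd : ∀ a b, p a → p b → p (a + b)) (h1 : ∀ i, p (Pi.single i 1)) (a : Fin k → ℕ) : p a := by
  have hs (i : Fin k) (n : ℕ) : p (Pi.single i n) := by
    induction n with
    | zero => simpa using h0
    | succ n ih => rw [Pi.single_add]; exact hadd _ _ ih (h1 i)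
  rw [← Finset.univ_sum_single a]
  exact Finset.sum_induction _ p hadd h0 fun i _ => hs i _

/-- The definition controls increments along single coordinates. Second differences are additive in
each increment, up to a shift of the base point, so it suffices to build a and b from unit vectors.
-/
lemma DirectionallyConvex.second_difference_nonneg {k : ℕ} {f : (Fin k → ℝ) → ℝ}
    (hf : DirectionallyConvex f) (x : Fin k → ℝ) (a b : Fin k → ℕ) :
    f (x + realCounts a) + f (x + realCounts b) ≤ f (x + realCounts a + realCounts b) + f x := by
  have zero : realCounts (0 : Fin k → ℕ) = 0 := by ext; simp [realCounts]
  -- The base point must vary: the second piece `a'` of an increment `a + a'` starts at x + a.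
  induction a using nonneg_add_induction generalizing x with
  | h0 => simp [zero, add_comm]
  | hadd a a' ha ha' =>
    have h1 := ha x
    have h2 := ha' (x + realCounts a)
    rw [realCounts_add, ← add_assoc]
    rw [add_right_comm x (realCounts a) (realCounts b)] at h1
    rw [add_right_comm x (realCounts a) (realCounts b)] at h2
    rw [show x + realCounts a + realCounts a' + realCounts b =
      x + realCounts b + realCounts a + realCounts a' by abel]
    rw [show x + realCounts a + realCounts a' + realCounts b =
      x + realCounts b + realCounts a + realCounts a' by abel] at h2
    linarith
  | h1 i =>
    induction b using nonneg_add_induction generalizing x with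
    | h0 => simp [zero]
    | hadd b b' hb hb' =>
      have h1 := hb x
      have h2 := hb' (x + realCounts b)
      rw [realCounts_add, ← add_assoc, ← add_assoc]
      rw [add_right_comm x (realCounts b)] at h2
      linarith
    | h1 j =>
      have := hf.2 x 1 1 one_pos one_pos j i
      simp only [discreteDiff] at this
      simp only [realCounts_single, Nat.cast_one]
      rw [add_right_comm]
      linarith

/-- Up to an affine function, a directionally convex function is increasing and non-negative on
count vectors. -/
lemma DirectionallyConvex.exists_incDcx {k : ℕ} {f : (Fin k → ℝ) → ℝ}
    (hf : DirectionallyConvex f) :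
    ∃ (g : (Fin k → ℕ) → ℝ) (c : ℝ) (b : Fin k → ℝ),
      (∀ a, 0 ≤ g a) ∧ IncDcx (fun a => ENNReal.ofReal (g a)) ∧
      ∀ a, f (realCounts a) = g a + (c + ∑ j, b j * (a j : ℝ)) := by
  set c := f 0 with hc
  -- The affine function agrees with f at the origin and at the unit vectors. Then g vanishes there,
  -- so directional convexity at 0 makes g superadditive, hence non-negative and increasing.
  set b : Fin k → ℝ := fun j => f (Pi.single j 1) - f 0 with hb
  set g : (Fin k → ℕ) → ℝ := fun a => f (realCounts a) - (c + ∑ j, b j * (a j : ℝ)) with hgdef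
  have zero : realCounts (0 : Fin k → ℕ) = 0 := by ext; simp [realCounts]
  have g0 : g 0 = 0 := by simp [hgdef, zero, hc]
  have gdcx (s a a' : Fin k → ℕ) : g (s + a) + g (s + a') ≤ g (s + a + a') + g s := by
    have := hf.second_difference_nonneg (realCounts s) a a'
    simp only [hgdef, realCounts_add, Pi.add_apply, Nat.cast_add, mul_add, Finset.sum_add_distrib]
    linarith
  have gsingle (i : Fin k) : g (Pi.single i 1) = 0 := by
    simp only [hgdef, realCounts_single]
    rw [Finset.sum_eq_single i (fun j _ hj => by simp [Pi.single_eq_of_ne hj]) (by simp)]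
    simp [hb, hc]
  have gnonneg (a : Fin k → ℕ) : 0 ≤ g a := by
    induction a using nonneg_add_induction with
    | h0 => exact g0.ge
    | hadd a a' ha ha' =>
      have := gdcx 0 a a'
      simp only [zero_add, g0, add_zero] at this
      linarith
    | h1 i => exact (gsingle i).ge
  have gmono : Monotone g := by
    intro a a' h
    obtain ⟨e, rfl⟩ := exists_add_of_le h
    have := gdcx 0 a e
    simp only [zero_add, g0, add_zero] at this
    linarith [gnonneg e]
  refine ⟨g, c, b, gnonneg, ⟨fun a a' h => ENNReal.ofReal_le_ofReal (gmono h), by simp, ?_⟩, ?_⟩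
  · intro s a a'
    rw [← ENNReal.ofReal_add (gnonneg _) (gnonneg _), ← ENNReal.ofReal_add (gnonneg _) (gnonneg _)]
    exact ENNReal.ofReal_le_ofReal (gdcx s a a')
  · intro a
    simp [hgdef]

/-- In the decomposition of f the increasing part is ordered by `hle`, while the affine part depends
only on the coordinate means. Their finiteness makes both parts integrable. -/
lemma CountDcxLE.integral_le {k : ℕ} {μ ν : Measure (Fin k → ℕ)} [IsProbabilityMeasure μ]
    [IsProbabilityMeasure ν] (hle : CountDcxLE μ ν)
    (hfin : ∀ j, ∫⁻ a, (a j : ℝ≥0∞) ∂μ < ∞)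
    (heq : ∀ j, ∫⁻ a, (a j : ℝ≥0∞) ∂μ = ∫⁻ a, (a j : ℝ≥0∞) ∂ν)
    {f : (Fin k → ℝ) → ℝ} (hf : DirectionallyConvex f)
    (hμ : Integrable (fun a => f (realCounts a)) μ)
    (hν : Integrable (fun a => f (realCounts a)) ν) :
    ∫ a, f (realCounts a) ∂μ ≤ ∫ a, f (realCounts a) ∂ν := by
  obtain ⟨g, c, b, hg0, hg, hfg⟩ := hf.exists_incDcx
  have icoord (m : Measure (Fin k → ℕ)) (hm : ∀ j, ∫⁻ a, (a j : ℝ≥0∞) ∂m < ∞) (j : Fin k) :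
      Integrable (fun a : Fin k → ℕ => (a j : ℝ)) m := by
    refine ⟨Measurable.of_discrete.aestronglyMeasurable, ?_⟩
    simpa [HasFiniteIntegral] using hm j
  have mean (m : Measure (Fin k → ℕ)) (j : Fin k) :
      ∫ a : Fin k → ℕ, (a j : ℝ) ∂m = (∫⁻ a, (a j : ℝ≥0∞) ∂m).toReal := by
    rw [integral_eq_lintegral_of_nonneg_ae (ae_of_all _ fun a => Nat.cast_nonneg _)
      Measurable.of_discrete.aestronglyMeasurable]
    simp
  have iaff (m : Measure (Fin k → ℕ)) [IsProbabilityMeasure m]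
      (hm : ∀ j, ∫⁻ a, (a j : ℝ≥0∞) ∂m < ∞) :
      Integrable (fun a : Fin k → ℕ => c + ∑ j, b j * (a j : ℝ)) m :=
    (integrable_const c).add (integrable_finsetSum _ fun j _ => (icoord m hm j).const_mul _)
  have split (m : Measure (Fin k → ℕ)) [IsProbabilityMeasure m]
      (hm : ∀ j, ∫⁻ a, (a j : ℝ≥0∞) ∂m < ∞) (hi : Integrable (fun a => f (realCounts a)) m) :
      Integrable g m ∧ ∫ a, f (realCounts a) ∂m =
        ∫ a, g a ∂m + (c + ∑ j, b j * (∫⁻ a, (a j : ℝ≥0∞) ∂m).toReal) := by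
    have ig : Integrable g m := by
      refine (hi.sub (iaff m hm)).congr (ae_of_all _ fun a => ?_)
      simp [hfg]
    refine ⟨ig, ?_⟩
    simp_rw [hfg]
    rw [integral_add ig (iaff m hm), integral_add (integrable_const c)
      (integrable_finsetSum _ fun j _ => (icoord m hm j).const_mul _),
      integral_finsetSum _ fun j _ => (icoord m hm j).const_mul _]
    simp [integral_const_mul, mean]
  obtain ⟨igμ, eμ⟩ := split μ hfin hμ
  obtain ⟨igν, eν⟩ := split ν (fun j => heq j ▸ hfin j) hν
  rw [eμ, eν]
  simp_rw [heq]
  refine add_le_add ?_ le_rfl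
  have h1 := hle _ hg
  rw [← ofReal_integral_eq_lintegral_ofReal igμ (ae_of_all _ hg0),
    ← ofReal_integral_eq_lintegral_ofReal igν (ae_of_all _ hg0)] at h1
  exact (ENNReal.ofReal_le_ofReal_iff (integral_nonneg hg0)).1 h1

/-! ### Laplace transforms of distributions on count vectors -/

/-- The weight `exp (-⟨t, a⟩)`. -/
noncomputable def expWeight {k : ℕ} (t a : Fin k → ℕ) : ℝ≥0∞ :=
  ENNReal.ofReal (Real.exp (-∑ j, (t j : ℝ) * a j))

lemma expWeight_add_right {k : ℕ} (t a b : Fin k → ℕ) :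
    expWeight t (a + b) = expWeight t a * expWeight t b := by
  rw [expWeight, expWeight, expWeight, ← ENNReal.ofReal_mul (Real.exp_nonneg _), ← Real.exp_add]
  congr 2
  simp only [Pi.add_apply, Nat.cast_add, mul_add, Finset.sum_add_distrib]
  ring

lemma measurable_expWeight {k : ℕ} (t : Fin k → ℕ) : Measurable (expWeight t) := .of_discrete

lemma expWeight_zero_right {k : ℕ} (t : Fin k → ℕ) : expWeight t 0 = 1 := by
  simp [expWeight]

lemma expWeight_le_one {k : ℕ} (t a : Fin k → ℕ) : expWeight t a ≤ 1 := by
  rw [expWeight, ENNReal.ofReal_le_one, Real.exp_le_one_iff, neg_nonpos]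
  positivity

lemma expWeight_pos {k : ℕ} (t a : Fin k → ℕ) : 0 < expWeight t a :=
  ENNReal.ofReal_pos.2 (Real.exp_pos _)

open BoundedContinuousFunction in
/-- A finite measure on `ℕ^k` is determined by its Laplace transform. -/
lemma measure_eq_of_lintegral_expWeight_eq {k : ℕ} {μ ν : Measure (Fin k → ℕ)} [IsFiniteMeasure μ]
    [IsFiniteMeasure ν]
    (h : ∀ t, ∫⁻ a, expWeight t a ∂μ = ∫⁻ a, expWeight t a ∂ν) : μ = ν := by
  let e (t : Fin k → ℕ) : (Fin k → ℕ) →ᵇ ℝ :=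
    BoundedContinuousFunction.ofNormedAddCommGroup
      (fun a => Real.exp (-∑ j, (t j : ℝ) * a j)) continuous_of_discreteTopology 1 fun a => by
        rw [Real.norm_eq_abs, Real.abs_exp, Real.exp_le_one_iff, neg_nonpos]
        positivity
  have e_apply (t a) : e t a = Real.exp (-∑ j, (t j : ℝ) * a j) := rfl
  -- The exponentials are closed under products and those of unit vectors separate points, so the
  -- algebra they generate determines a finite measure.
  let S : Submonoid ((Fin k → ℕ) →ᵇ ℝ) :=
    { carrier := range e
      one_mem' := ⟨0, by ext a; simp [e_apply]⟩
      mul_mem' := by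
        rintro _ _ ⟨t, rfl⟩ ⟨t', rfl⟩
        refine ⟨t + t', ?_⟩
        ext a
        simp only [BoundedContinuousFunction.coe_mul, Pi.mul_apply, e_apply, ← Real.exp_add,
          Pi.add_apply, Nat.cast_add, add_mul, Finset.sum_add_distrib, neg_add] }
  let A : StarSubalgebra ℝ ((Fin k → ℕ) →ᵇ ℝ) :=
    { Algebra.adjoin ℝ (S : Set ((Fin k → ℕ) →ᵇ ℝ)) with
      star_mem' := fun {a} ha => by
        have : star a = a := by ext; simp
        rw [this]; exact ha }
  refine ext_of_forall_mem_subalgebra_integral_eq_of_polish (A := A) ?_ ?_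
  · intro a b hab
    obtain ⟨j, hj⟩ := Function.ne_iff.1 hab
    refine ⟨e (Pi.single j 1), ⟨toContinuousMapStarₐ ℝ (e (Pi.single j 1)),
      ⟨e (Pi.single j 1), Algebra.subset_adjoin ⟨_, rfl⟩, rfl⟩, rfl⟩, ?_⟩
    simp only [e_apply]
    rw [Ne, Real.exp_eq_exp, neg_inj,
      Finset.sum_eq_single j (fun i _ hi => by simp [Pi.single_eq_of_ne hi]) (by simp),
      Finset.sum_eq_single j (fun i _ hi => by simp [Pi.single_eq_of_ne hi]) (by simp)]
    simpa using hj
  · intro g hg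
    -- The algebra generated by a submonoid is its linear span, so by linearity only the
    -- exponentials themselves need checking.
    have hg' : g ∈ Submodule.span ℝ (S : Set ((Fin k → ℕ) →ᵇ ℝ)) := by
      have : g ∈ Subalgebra.toSubmodule (Algebra.adjoin ℝ (S : Set ((Fin k → ℕ) →ᵇ ℝ))) := hg
      rwa [Algebra.adjoin_eq_span, Submonoid.closure_eq] at this
    clear hg
    induction hg' using Submodule.span_induction with
    | mem g hg =>
      obtain ⟨t, rfl⟩ := hg
      have key (m : Measure (Fin k → ℕ)) : ∫ a, e t a ∂m = (∫⁻ a, expWeight t a ∂m).toReal :=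
        integral_eq_lintegral_of_nonneg_ae (ae_of_all _ fun a => (Real.exp_pos _).le)
          Measurable.of_discrete.aestronglyMeasurable
      rw [key, key, h]
    | zero => simp
    | add f g _ _ hf hg =>
      simp only [BoundedContinuousFunction.coe_add, Pi.add_apply]
      rw [integral_add (f.integrable _) (g.integrable _),
        integral_add (f.integrable _) (g.integrable _)]
      rw [hf, hg]
    | smul c f _ hf =>
      simp only [BoundedContinuousFunction.coe_smul, integral_smul]
      rw [hf]

/-! ### Exponential and logarithm on the extended half-line. -/

/-- The function `a ↦ exp (-a)` on `[0, ∞]`. -/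
noncomputable def expNeg (a : ℝ≥0∞) : ℝ≥0∞ := EReal.exp (-(a : EReal))

lemma expNeg_zero : expNeg 0 = 1 := by simp [expNeg]

lemma expNeg_ofReal {r : ℝ} (hr : 0 ≤ r) :
    expNeg (ENNReal.ofReal r) = ENNReal.ofReal (Real.exp (-r)) := by
  rw [expNeg, EReal.coe_ennreal_ofReal, max_eq_left hr, ← EReal.coe_neg, EReal.exp_coe]

lemma expNeg_add (a b : ℝ≥0∞) : expNeg (a + b) = expNeg a * expNeg b := by
  rw [expNeg, EReal.coe_ennreal_add, EReal.neg_add (by simp) (by simp), sub_eq_add_neg,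
    EReal.exp_add, expNeg, expNeg]

lemma continuous_expNeg : Continuous expNeg :=
  ENNReal.continuous_exp.comp (continuous_neg.comp continuous_coe_ennreal_ereal)

lemma expNeg_sum {ι : Type*} (s : Finset ι) (f : ι → ℝ≥0∞) :
    expNeg (∑ m ∈ s, f m) = ∏ m ∈ s, expNeg (f m) := by
  classical
  induction s using Finset.induction_on with
  | empty => simp [expNeg_zero]
  | insert m s hm ih => rw [Finset.sum_insert hm, Finset.prod_insert hm, expNeg_add, ih]

/-- The function `a ↦ -log a` on `(0, 1]`. -/
noncomputable def negLog (a : ℝ≥0∞) : ℝ≥0∞ := ENNReal.ofReal (-Real.log a.toReal)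

lemma measurable_negLog : Measurable negLog :=
  (Real.measurable_log.comp ENNReal.measurable_toReal).neg.ennreal_ofReal

lemma expNeg_negLog {a : ℝ≥0∞} (h0 : 0 < a) (h1 : a ≤ 1) : expNeg (negLog a) = a := by
  have htop : a ≠ ∞ := ne_top_of_le_ne_top ENNReal.one_ne_top h1
  have hpos : 0 < a.toReal := ENNReal.toReal_pos h0.ne' htop
  have hle : a.toReal ≤ 1 := by simpa using ENNReal.toReal_mono ENNReal.one_ne_top h1
  rw [negLog, expNeg_ofReal (neg_nonneg.2 (Real.log_nonpos hpos.le hle)), neg_neg,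
    Real.exp_log hpos, ENNReal.ofReal_toReal htop]

/-! ### Point measures of enumerated points -/

/-- The space of enumerations `(κ, x)` of points of `ℝ^d`. -/
abbrev Enumeration (d : ℕ) := ℕ∞ × (ℕ → EuclideanSpace ℝ (Fin d))

/-- The point measure of an enumeration. -/
noncomputable def enumMeasure {d : ℕ} (z : Enumeration d) : Measure (EuclideanSpace ℝ (Fin d)) :=
  pointMeasure z.1 z.2

lemma lintegral_enumMeasure {d : ℕ} (z : Enumeration d) (φ : EuclideanSpace ℝ (Fin d) → ℝ≥0∞) :
    ∫⁻ x, φ x ∂enumMeasure z = ∑' m : ℕ, if (m : ℕ∞) < z.1 then φ (z.2 m) else 0 := by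
  rw [enumMeasure, pointMeasure, lintegral_sum_measure]
  congr with m
  split_ifs <;> simp

lemma ae_enumMeasure_iff {d : ℕ} (z : Enumeration d) (p : EuclideanSpace ℝ (Fin d) → Prop) :
    (∀ᵐ x ∂enumMeasure z, p x) ↔ ∀ m : ℕ, (m : ℕ∞) < z.1 → p (z.2 m) := by
  rw [enumMeasure, pointMeasure, Measure.ae_sum_iff]
  refine forall_congr' fun m => ?_
  split_ifs with h <;> simp [h, ae_dirac_eq]

lemma measurableSet_lt_fst {d : ℕ} (m : ℕ) :
    MeasurableSet {z : Enumeration d | (m : ℕ∞) < z.1} :=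
  measurable_fst (MeasurableSet.of_discrete (s := {n : ℕ∞ | (m : ℕ∞) < n}))

lemma measurable_enumMeasure {d : ℕ} : Measurable (enumMeasure (d := d)) := by
  refine Measure.measurable_of_measurable_coe _ fun s hs => ?_
  have (z : Enumeration d) : enumMeasure z s =
      ∑' m : ℕ, if (m : ℕ∞) < z.1 then s.indicator 1 (z.2 m) else 0 := by
    rw [← lintegral_indicator_one hs, lintegral_enumMeasure]
  simp_rw [this]
  refine Measurable.tsum fun m => Measurable.ite (measurableSet_lt_fst m) ?_ measurable_const
  exact (measurable_one.indicator hs).comp (by fun_prop)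

/-! ### Sums of independent marks -/

/-- The terms of a convergent series tend to zero, and a natural number below 1 is 0. -/
lemma exists_tsum_natCast_eq {a : ℕ → ℕ} (h : ∑' m, (a m : ℝ≥0∞) ≠ ∞) :
    ∃ M₀, ∀ M, M₀ ≤ M → ∑' m, (a m : ℝ≥0∞) = (∑ m ∈ Finset.range M, a m : ℕ) := by
  have h1 := ENNReal.tendsto_cofinite_zero_of_tsum_ne_top h
  rw [Nat.cofinite_eq_atTop] at h1
  obtain ⟨M₀, hM₀⟩ := Filter.eventually_atTop.1 (h1.eventually_lt_const zero_lt_one)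
  refine ⟨M₀, fun M hM => ?_⟩
  rw [tsum_eq_sum (s := Finset.range M), Nat.cast_sum]
  intro m hm
  rw [Finset.mem_range, not_lt] at hm
  have h0 : a m < 1 := by exact_mod_cast hM₀ m (hM.trans hm)
  rw [Nat.lt_one_iff.1 h0, Nat.cast_zero]

section Marks

variable {d k : ℕ} {V : Type*}

/-- The vector mark of the `m`-th point of an enumeration. -/
noncomputable def markTerm (W : EuclideanSpace ℝ (Fin d) → V → Fin k → ℕ) (z : Enumeration d)
    (m : ℕ) (v : V) : Fin k → ℕ :=
  if (m : ℕ∞) < z.1 then W (z.2 m) v else 0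

/-- The sum of the marks of the first `M` points. -/
noncomputable def partialCount (W : EuclideanSpace ℝ (Fin d) → V → Fin k → ℕ) (M : ℕ)
    (z : Enumeration d) (u : ℕ → V) : Fin k → ℕ :=
  ∑ m ∈ Finset.range M, markTerm W z m (u m)

/-- The sum of the marks of all points, possibly infinite. -/
noncomputable def totalCount (W : EuclideanSpace ℝ (Fin d) → V → Fin k → ℕ)
    (z : Enumeration d) (u : ℕ → V) (j : Fin k) : ℝ≥0∞ :=
  ∑' m : ℕ, (markTerm W z m (u m) j : ℝ≥0∞)

/-- The sum of the marks of all points, where infinity is replaced by `0`. -/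
noncomputable def natCount (W : EuclideanSpace ℝ (Fin d) → V → Fin k → ℕ)
    (z : Enumeration d) (u : ℕ → V) : Fin k → ℕ :=
  fun j => ⌊(totalCount W z u j).toReal⌋₊

variable {W : EuclideanSpace ℝ (Fin d) → V → Fin k → ℕ}

lemma partialCount_mono (W : EuclideanSpace ℝ (Fin d) → V → Fin k → ℕ) (z : Enumeration d)
    (u : ℕ → V) : Monotone fun M => partialCount W M z u := fun _ _ h =>
  Finset.sum_le_sum_of_subset (Finset.range_subset_range.2 h)

/-- Finite total counts are attained after finitely many points, so every limit in M below is the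
limit of an eventually constant sequence. -/
lemma exists_partialCount_eq {z : Enumeration d} {u : ℕ → V}
    (h : ∀ j, totalCount W z u j ≠ ∞) :
    ∃ M₀, ∀ M, M₀ ≤ M → partialCount W M z u = natCount W z u := by
  have key (j : Fin k) : ∃ M₀, ∀ M, M₀ ≤ M → partialCount W M z u j = natCount W z u j := by
    obtain ⟨M₀, hM₀⟩ := exists_tsum_natCast_eq (h j)
    refine ⟨M₀, fun M hM => ?_⟩
    simp only [natCount, totalCount, hM₀ M hM, ENNReal.toReal_natCast, Nat.floor_natCast,
      partialCount, Finset.sum_apply]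
  choose M₀ hM₀ using key
  exact ⟨Finset.univ.sup M₀, fun M hM => funext fun j =>
    hM₀ j M ((Finset.le_sup (Finset.mem_univ j)).trans hM)⟩

lemma totalCount_eq_natCount {z : Enumeration d} {u : ℕ → V} (h : ∀ j, totalCount W z u j ≠ ∞)
    (j : Fin k) : totalCount W z u j = natCount W z u j := by
  obtain ⟨M₀, hM₀⟩ := exists_partialCount_eq h
  have h1 := ENNReal.tendsto_nat_tsum fun m => (markTerm W z m (u m) j : ℝ≥0∞)
  refine tendsto_nhds_unique h1 (tendsto_const_nhds.congr' ?_)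
  filter_upwards [Filter.eventually_ge_atTop M₀] with M hM
  rw [← hM₀ M hM, partialCount, Finset.sum_apply, Nat.cast_sum]

variable [MeasurableSpace V]

/-- The law of `natCount`, for a random enumeration with independent marks. -/
noncomputable def countLaw (ρ : Measure (Enumeration d)) (η : Measure V) [IsProbabilityMeasure η]
    (W : EuclideanSpace ℝ (Fin d) → V → Fin k → ℕ) : Measure (Fin k → ℕ) :=
  (ρ.prod (Measure.infinitePi fun _ : ℕ => η)).map fun p => natCount W p.1 p.2

lemma measurable_markTerm (hW : Measurable (Function.uncurry W)) (m : ℕ) :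
    Measurable fun p : Enumeration d × (ℕ → V) => markTerm W p.1 m (p.2 m) := by
  refine Measurable.ite (measurable_fst (measurableSet_lt_fst m)) ?_ measurable_const
  exact hW.comp (f := fun p : Enumeration d × (ℕ → V) => (p.1.2 m, p.2 m)) (by fun_prop)

lemma measurable_markTerm_right (hW : Measurable (Function.uncurry W)) (z : Enumeration d)
    (m : ℕ) : Measurable (markTerm W z m) := by
  unfold markTerm
  split_ifs
  · exact hW.comp (f := fun v => (z.2 m, v)) (by fun_prop)
  · exact measurable_const

lemma measurable_partialCount (hW : Measurable (Function.uncurry W)) (M : ℕ) :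
    Measurable fun p : Enumeration d × (ℕ → V) => partialCount W M p.1 p.2 :=
  Finset.measurable_fun_sum _ fun m _ => measurable_markTerm hW m

lemma measurable_partialCount_right (hW : Measurable (Function.uncurry W)) (M : ℕ)
    (z : Enumeration d) : Measurable (partialCount W M z) :=
  (measurable_partialCount hW M).comp (f := fun u => (z, u)) (by fun_prop)

lemma measurable_totalCount (hW : Measurable (Function.uncurry W)) (j : Fin k) :
    Measurable fun p : Enumeration d × (ℕ → V) => totalCount W p.1 p.2 j :=
  Measurable.tsum fun m =>
    Measurable.of_discrete.comp ((measurable_pi_apply j).comp (measurable_markTerm hW m))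

lemma measurable_natCount (hW : Measurable (Function.uncurry W)) :
    Measurable fun p : Enumeration d × (ℕ → V) => natCount W p.1 p.2 :=
  measurable_pi_lambda _ fun j => (measurable_totalCount hW j).ennreal_toReal.nat_floor

variable {η : Measure V} [IsProbabilityMeasure η]

/-- The coordinates of the product measure are independent. The function `v m` may depend on m: this
serves the marks of different points as well as the identically distributed replicas of one point.
-/
lemma map_sum_range_succ {v : ℕ → V → Fin k → ℕ} (hv : ∀ m, Measurable (v m)) (M : ℕ) :
    (Measure.infinitePi fun _ : ℕ => η).map (fun u => ∑ m ∈ Finset.range (M + 1), v m (u m)) =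
      (Measure.infinitePi fun _ : ℕ => η).map (fun u => ∑ m ∈ Finset.range M, v m (u m)) ∗
        η.map (v M) := by
  have hind : iIndepFun (fun (m : ℕ) (u : ℕ → V) => v m (u m))
      (Measure.infinitePi fun _ : ℕ => η) := iIndepFun_infinitePi hv
  have hmeas (m : ℕ) : Measurable fun u : ℕ → V => v m (u m) :=
    (hv m).comp (measurable_pi_apply m)
  have e (M : ℕ) : (fun u : ℕ → V => ∑ m ∈ Finset.range M, v m (u m)) =
      ∑ m ∈ Finset.range M, fun u : ℕ → V => v m (u m) := by
    ext u j
    simp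
  have hsum : Measurable (∑ m ∈ Finset.range M, fun u : ℕ → V => v m (u m)) := by
    rw [← e]
    exact Finset.measurable_fun_sum (Finset.range M) fun m _ => hmeas m
  have h1 := hind.indepFun_sum_range_succ hmeas M
  have h2 := h1.map_add_eq_map_conv_map hsum (hmeas M)
  rw [e, e, Finset.sum_range_succ, h2]
  congr 1
  conv_rhs => rw [← Measure.infinitePi_map_eval (fun _ : ℕ => η) M]
  rw [Measure.map_map (hv M) (measurable_pi_apply M)]
  rfl

lemma map_partialCount_succ (hW : Measurable (Function.uncurry W)) (M : ℕ) (z : Enumeration d) :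
    (Measure.infinitePi fun _ : ℕ => η).map (partialCount W (M + 1) z) =
      (Measure.infinitePi fun _ : ℕ => η).map (partialCount W M z) ∗ η.map (markTerm W z M) :=
  map_sum_range_succ (measurable_markTerm_right hW z) M

lemma map_sum_range_eq_convPow {v : V → Fin k → ℕ} (hv : Measurable v) (n : ℕ) :
    (Measure.infinitePi fun _ : ℕ => η).map (fun u => ∑ i ∈ Finset.range n, v (u i)) =
      convPow (η.map v) n := by
  induction n with
  | zero => simp [convPow]
  | succ n ih => rw [map_sum_range_succ fun _ => hv, ih, convPow]

lemma map_partialCount_zero (z : Enumeration d) :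
    (Measure.infinitePi fun _ : ℕ => η).map (partialCount W 0 z) = Measure.dirac 0 := by
  have : partialCount W 0 z = fun _ : ℕ → V => 0 := by ext; simp [partialCount]
  rw [this, Measure.map_const, measure_univ, one_smul]

/-- Monotonicity of the sum of the first marks. -/
lemma countDcxLE_partialCount {W₁ W₂ : EuclideanSpace ℝ (Fin d) → V → Fin k → ℕ}
    (hW₁ : Measurable (Function.uncurry W₁)) (hW₂ : Measurable (Function.uncurry W₂))
    {z : Enumeration d}
    (h : ∀ m : ℕ, (m : ℕ∞) < z.1 → CountDcxLE (η.map (W₁ (z.2 m))) (η.map (W₂ (z.2 m))))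
    (M : ℕ) :
    CountDcxLE ((Measure.infinitePi fun _ : ℕ => η).map (partialCount W₁ M z))
      ((Measure.infinitePi fun _ : ℕ => η).map (partialCount W₂ M z)) := by
  induction M with
  | zero =>
    rw [map_partialCount_zero, map_partialCount_zero]
    exact fun _ _ => le_rfl
  | succ M ih =>
    rw [map_partialCount_succ hW₁, map_partialCount_succ hW₂]
    refine ih.conv ?_
    by_cases hM : (M : ℕ∞) < z.1
    · have e (W : EuclideanSpace ℝ (Fin d) → V → Fin k → ℕ) : markTerm W z M = W (z.2 M) := by
        ext v; simp [markTerm, hM]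
      rw [e, e]
      exact h M hM
    · have e (W : EuclideanSpace ℝ (Fin d) → V → Fin k → ℕ) : markTerm W z M = fun _ => 0 := by
        ext v; simp [markTerm, hM]
      rw [e, e]
      exact fun _ _ => le_rfl

/-- Campbell's formula. -/
lemma lintegral_totalCount (hW : Measurable (Function.uncurry W)) (z : Enumeration d) (j : Fin k) :
    ∫⁻ u, totalCount W z u j ∂(Measure.infinitePi fun _ : ℕ => η) =
      ∫⁻ x, ∫⁻ v, (W x v j : ℝ≥0∞) ∂η ∂enumMeasure z := by
  have hm (m : ℕ) : Measurable fun v : V => (markTerm W z m v j : ℝ≥0∞) :=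
    Measurable.of_discrete.comp ((measurable_pi_apply j).comp (measurable_markTerm_right hW z m))
  rw [lintegral_enumMeasure]
  simp only [totalCount]
  have hm' (m : ℕ) : Measurable fun u : ℕ → V => (markTerm W z m (u m) j : ℝ≥0∞) :=
    (hm m).comp (measurable_pi_apply m)
  rw [lintegral_tsum fun m => (hm' m).aemeasurable]
  congr with m
  have h1 := lintegral_map (μ := Measure.infinitePi fun _ : ℕ => η) (hm m) (measurable_pi_apply m)
  rw [← h1, Measure.infinitePi_map_eval]
  split_ifs with h <;> simp [markTerm, h]

lemma measurable_lintegral_mark (hW : Measurable (Function.uncurry W)) {f : (Fin k → ℕ) → ℝ≥0∞} :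
    Measurable fun x => ∫⁻ v, f (W x v) ∂η :=
  (Measurable.of_discrete.comp hW).lintegral_prod_right'

lemma lintegral_totalCount_prod {ρ : Measure (Enumeration d)} [SFinite ρ]
    (hW : Measurable (Function.uncurry W)) (j : Fin k) :
    ∫⁻ p, totalCount W p.1 p.2 j ∂(ρ.prod (Measure.infinitePi fun _ : ℕ => η)) =
      ∫⁻ x, ∫⁻ v, (W x v j : ℝ≥0∞) ∂η ∂(ρ.bind enumMeasure) := by
  rw [lintegral_prod _ (measurable_totalCount hW j).aemeasurable,
    Measure.lintegral_bind measurable_enumMeasure.aemeasurable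
      (measurable_lintegral_mark hW (f := fun a => (a j : ℝ≥0∞))).aemeasurable]
  simp_rw [lintegral_totalCount hW]

variable {ρ : Measure (Enumeration d)} [IsProbabilityMeasure ρ]

/-- By Campbell's formula the expected total counts are finite. -/
lemma ae_totalCount_ne_top (hW : Measurable (Function.uncurry W))
    (hfin : ∀ j, ∫⁻ x, ∫⁻ v, (W x v j : ℝ≥0∞) ∂η ∂(ρ.bind enumMeasure) < ∞) :
    ∀ᵐ p ∂ρ.prod (Measure.infinitePi fun _ : ℕ => η), ∀ j, totalCount W p.1 p.2 j ≠ ∞ := by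
  rw [ae_all_iff]
  intro j
  have h := hfin j
  rw [← lintegral_totalCount_prod hW j] at h
  exact (ae_lt_top (measurable_totalCount hW j) h.ne).mono fun _ hp => hp.ne

lemma isProbabilityMeasure_countLaw (hW : Measurable (Function.uncurry W)) :
    IsProbabilityMeasure (countLaw ρ η W) :=
  Measure.isProbabilityMeasure_map (measurable_natCount hW).aemeasurable

lemma lintegral_coord_countLaw (hW : Measurable (Function.uncurry W))
    (hfin : ∀ j, ∫⁻ x, ∫⁻ v, (W x v j : ℝ≥0∞) ∂η ∂(ρ.bind enumMeasure) < ∞) (j : Fin k) :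
    ∫⁻ a, (a j : ℝ≥0∞) ∂countLaw ρ η W =
      ∫⁻ x, ∫⁻ v, (W x v j : ℝ≥0∞) ∂η ∂(ρ.bind enumMeasure) := by
  rw [countLaw, lintegral_map .of_discrete (measurable_natCount hW), ← lintegral_totalCount_prod hW]
  refine lintegral_congr_ae ((ae_totalCount_ne_top hW hfin).mono fun p hp => ?_)
  exact (totalCount_eq_natCount hp j).symm

/-- Independence gives a product over the points. Each factor lies in (0, 1], so it is `expNeg` of
its `negLog`, and the product becomes the exponential of a sum, which in the limit is an integral
against the point measure. -/
lemma lintegral_expWeight_partialCount (hW : Measurable (Function.uncurry W)) (t : Fin k → ℕ)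
    (M : ℕ) (z : Enumeration d) :
    ∫⁻ u, expWeight t (partialCount W M z u) ∂(Measure.infinitePi fun _ : ℕ => η) =
      expNeg (∑ m ∈ Finset.range M, if (m : ℕ∞) < z.1 then
        negLog (∫⁻ v, expWeight t (W (z.2 m) v) ∂η) else 0) := by
  have hmap (M : ℕ) := lintegral_map (μ := Measure.infinitePi fun _ : ℕ => η) (f := expWeight t)
    .of_discrete (measurable_partialCount_right hW M z)
  rw [expNeg_sum]
  induction M with
  | zero => simp [partialCount, expWeight_zero_right]
  | succ M ih =>
    have hmM := measurable_markTerm_right hW z M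
    have : IsProbabilityMeasure (η.map (markTerm W z M)) :=
      Measure.isProbabilityMeasure_map hmM.aemeasurable
    rw [Finset.prod_range_succ, ← ih, ← hmap (M + 1), map_partialCount_succ hW,
      Measure.lintegral_conv .of_discrete]
    simp_rw [expWeight_add_right, lintegral_const_mul _ Measurable.of_discrete]
    rw [lintegral_mul_const _ .of_discrete, hmap M]
    congr 1
    rw [lintegral_map .of_discrete hmM]
    split_ifs with h
    · have e (v : V) : markTerm W z M v = W (z.2 M) v := by simp [markTerm, h]
      simp_rw [e]
      have hWz : Measurable fun v => expWeight t (W (z.2 M) v) :=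
        (measurable_expWeight t).comp (hW.comp (f := fun v => (z.2 M, v)) (by fun_prop))
      rw [expNeg_negLog]
      · rw [lintegral_pos_iff_support hWz,
          Function.support_eq_univ fun v => (expWeight_pos t _).ne',
          measure_univ]
        exact one_pos
      · exact (lintegral_mono fun v => expWeight_le_one t _).trans (by simp)
    · have e (v : V) : markTerm W z M v = 0 := by simp [markTerm, h]
      simp [e, expNeg_zero, expWeight_zero_right]

/-- The Laplace transform of the counts is a functional of the law of the point measure. -/
lemma lintegral_expWeight_countLaw (hW : Measurable (Function.uncurry W))
    (hfin : ∀ j, ∫⁻ x, ∫⁻ v, (W x v j : ℝ≥0∞) ∂η ∂(ρ.bind enumMeasure) < ∞) (t : Fin k → ℕ) :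
    ∫⁻ a, expWeight t a ∂countLaw ρ η W =
      ∫⁻ μ, expNeg (∫⁻ x, negLog (∫⁻ v, expWeight t (W x v) ∂η) ∂μ) ∂(ρ.map enumMeasure) := by
  have hneg : Measurable fun x =>
      negLog (∫⁻ v, expWeight t (W x v) ∂η) :=
    measurable_negLog.comp (measurable_lintegral_mark hW)
  have hpart (M : ℕ) : Measurable fun p : Enumeration d × (ℕ → V) =>
      expWeight t (partialCount W M p.1 p.2) :=
    (measurable_expWeight t).comp (measurable_partialCount hW M)
  have hfun : Measurable fun μ : Measure (EuclideanSpace ℝ (Fin d)) =>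
      expNeg (∫⁻ x, negLog (∫⁻ v, expWeight t (W x v) ∂η) ∂μ) :=
    continuous_expNeg.measurable.comp (Measure.measurable_lintegral hneg)
  rw [countLaw, lintegral_map .of_discrete (measurable_natCount hW),
    lintegral_map hfun measurable_enumMeasure]
  -- The two sides are limits of the same sequence, the transforms for the first M points: once
  -- because partial counts stabilise almost surely, once because, with the seeds integrated out,
  -- the exponent is a partial sum of a series.
  have lim1 : Filter.Tendsto (fun M : ℕ => ∫⁻ p, expWeight t (partialCount W M p.1 p.2)
      ∂(ρ.prod (Measure.infinitePi fun _ : ℕ => η))) Filter.atTop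
      (nhds (∫⁻ p, expWeight t (natCount W p.1 p.2)
        ∂(ρ.prod (Measure.infinitePi fun _ : ℕ => η)))) := by
    refine tendsto_lintegral_of_dominated_convergence (fun _ => 1) hpart
      (fun M => ae_of_all _ fun p => expWeight_le_one t _) (by simp) ?_
    filter_upwards [ae_totalCount_ne_top hW hfin] with p hp
    obtain ⟨M₀, hM₀⟩ := exists_partialCount_eq hp
    refine tendsto_const_nhds.congr' ?_
    filter_upwards [Filter.eventually_ge_atTop M₀] with M hM
    rw [hM₀ M hM]
  refine tendsto_nhds_unique lim1 ?_
  simp_rw [fun M => lintegral_prod _ (hpart M).aemeasurable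
    (μ := ρ) (ν := Measure.infinitePi fun _ : ℕ => η)]
  refine tendsto_lintegral_of_dominated_convergence (fun _ => 1)
    (fun M => (hpart M).lintegral_prod_right') (fun M => ae_of_all _ fun z => ?_) (by simp)
    (ae_of_all _ fun z => ?_)
  · exact (lintegral_mono fun v => expWeight_le_one t _).trans (by simp)
  · simp_rw [lintegral_expWeight_partialCount hW, lintegral_enumMeasure]
    exact (continuous_expNeg.tendsto _).comp (ENNReal.tendsto_nat_tsum _)

lemma bind_enumMeasure_eq_of_map_eq {ρ₁ ρ₂ : Measure (Enumeration d)}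
    (h : ρ₁.map enumMeasure = ρ₂.map enumMeasure) : ρ₁.bind enumMeasure = ρ₂.bind enumMeasure := by
  rw [Measure.bind, Measure.bind, h]

/-- The law of the counts depends only on the law of the point measure. -/
lemma countLaw_eq_of_map_eq {ρ₁ ρ₂ : Measure (Enumeration d)} [IsProbabilityMeasure ρ₁]
    [IsProbabilityMeasure ρ₂] (h : ρ₁.map enumMeasure = ρ₂.map enumMeasure)
    (hW : Measurable (Function.uncurry W))
    (hfin : ∀ j, ∫⁻ x, ∫⁻ v, (W x v j : ℝ≥0∞) ∂η ∂(ρ₁.bind enumMeasure) < ∞) :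
    countLaw ρ₁ η W = countLaw ρ₂ η W := by
  have := isProbabilityMeasure_countLaw (ρ := ρ₁) (η := η) hW
  have := isProbabilityMeasure_countLaw (ρ := ρ₂) (η := η) hW
  refine measure_eq_of_lintegral_expWeight_eq fun t => ?_
  rw [lintegral_expWeight_countLaw hW hfin,
    lintegral_expWeight_countLaw hW (bind_enumMeasure_eq_of_map_eq h ▸ hfin), h]

/-- Monotone convergence reduces the comparison to finitely many points; no bound on g is needed. -/
lemma lintegral_countLaw_eq_iSup (hW : Measurable (Function.uncurry W))
    (hfin : ∀ j, ∫⁻ x, ∫⁻ v, (W x v j : ℝ≥0∞) ∂η ∂(ρ.bind enumMeasure) < ∞)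
    {g : (Fin k → ℕ) → ℝ≥0∞} (hg : Monotone g) :
    ∫⁻ a, g a ∂countLaw ρ η W = ⨆ M, ∫⁻ z, ∫⁻ a, g a
      ∂((Measure.infinitePi fun _ : ℕ => η).map (partialCount W M z)) ∂ρ := by
  have hpart (M : ℕ) : Measurable fun p : Enumeration d × (ℕ → V) =>
      g (partialCount W M p.1 p.2) :=
    Measurable.of_discrete.comp (measurable_partialCount hW M)
  simp_rw [fun M z => lintegral_map (μ := Measure.infinitePi fun _ : ℕ => η) (f := g)
    .of_discrete (measurable_partialCount_right hW M z)]
  simp_rw [fun M => (lintegral_prod _ (hpart M).aemeasurable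
    (μ := ρ) (ν := Measure.infinitePi fun _ : ℕ => η)).symm]
  rw [← lintegral_iSup hpart fun M M' h p => hg (partialCount_mono W p.1 p.2 h), countLaw,
    lintegral_map .of_discrete (measurable_natCount hW)]
  refine lintegral_congr_ae ((ae_totalCount_ne_top hW hfin).mono fun p hp => ?_)
  obtain ⟨M₀, hM₀⟩ := exists_partialCount_eq hp
  refine le_antisymm ?_ (iSup_le fun M => hg ?_)
  · simp only [← hM₀ M₀ le_rfl]
    exact le_iSup (fun M => g (partialCount W M p.1 p.2)) M₀
  · rw [← hM₀ _ (le_max_right M M₀)]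
    exact partialCount_mono W p.1 p.2 (le_max_left M M₀)

/-- A property holding almost everywhere for the mean measure holds, for almost every enumeration,
at all its points. So the contributions are ordered point by point, and finite sums and suprema
preserve the order. -/
lemma countDcxLE_countLaw {W₁ W₂ : EuclideanSpace ℝ (Fin d) → V → Fin k → ℕ}
    (hW₁ : Measurable (Function.uncurry W₁)) (hW₂ : Measurable (Function.uncurry W₂))
    (hfin₁ : ∀ j, ∫⁻ x, ∫⁻ v, (W₁ x v j : ℝ≥0∞) ∂η ∂(ρ.bind enumMeasure) < ∞)
    (hfin₂ : ∀ j, ∫⁻ x, ∫⁻ v, (W₂ x v j : ℝ≥0∞) ∂η ∂(ρ.bind enumMeasure) < ∞)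
    (hle : ∀ᵐ x ∂(ρ.bind enumMeasure), CountDcxLE (η.map (W₁ x)) (η.map (W₂ x))) :
    CountDcxLE (countLaw ρ η W₁) (countLaw ρ η W₂) := by
  intro g hg
  rw [lintegral_countLaw_eq_iSup hW₁ hfin₁ hg.mono, lintegral_countLaw_eq_iSup hW₂ hfin₂ hg.mono]
  refine iSup_mono fun M => lintegral_mono_ae ?_
  filter_upwards [Measure.ae_ae_of_ae_bind measurable_enumMeasure.aemeasurable hle] with z hz
  exact countDcxLE_partialCount hW₁ hW₂ ((ae_enumMeasure_iff z _).1 hz) M g hg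

end Marks

/-! ### Perturbations driven by independent uniform variables -/

/-- `F` samples from the kernel `κ`, given a uniform variable on the unit interval. -/
def IsSampler {α β : Type*} [MeasurableSpace α] [MeasurableSpace β] (κ : Kernel α β)
    (F : α → unitInterval → β) : Prop :=
  Measurable (Function.uncurry F) ∧ ∀ x, volume.map (F x) = κ x

lemma IsSampler.measurable_apply {α β : Type*} [MeasurableSpace α] [MeasurableSpace β]
    {κ : Kernel α β} {F : α → unitInterval → β} (hF : IsSampler κ F) (x : α) : Measurable (F x) :=
  hF.1.comp (f := fun v => (x, v)) (by fun_prop)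

/-- The random seeds attached to a point. -/
abbrev MarkSeed := unitInterval × (ℕ → unitInterval)

/-- The law of the seeds: independent uniform variables. -/
noncomputable def seedMeasure : Measure MarkSeed :=
  volume.prod (Measure.infinitePi fun _ : ℕ => volume)

instance : IsProbabilityMeasure seedMeasure := by
  unfold seedMeasure; infer_instance

/-- The space of marks `(n, y)`. -/
abbrev Marks (d : ℕ) := (ℕ → ℕ) × (ℕ → ℕ → EuclideanSpace ℝ (Fin d))

section

variable {d k : ℕ}

/-- The marks computed from the seeds. -/
def seedMarks (FN : EuclideanSpace ℝ (Fin d) → unitInterval → ℕ)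
    (FX : EuclideanSpace ℝ (Fin d) → unitInterval → EuclideanSpace ℝ (Fin d))
    (p : Enumeration d × (ℕ → MarkSeed)) : Enumeration d × Marks d :=
  (p.1, fun m => FN (p.1.2 m) (p.2 m).1, fun m i => FX (p.1.2 m) ((p.2 m).2 i))

/-- The numbers of replicas in the sets `B j`. -/
noncomputable def replicaCount (FN : EuclideanSpace ℝ (Fin d) → unitInterval → ℕ)
    (FX : EuclideanSpace ℝ (Fin d) → unitInterval → EuclideanSpace ℝ (Fin d))
    (B : Fin k → Set (EuclideanSpace ℝ (Fin d))) (x : EuclideanSpace ℝ (Fin d)) (v : MarkSeed) :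
    Fin k → ℕ :=
  fun j => ∑ i ∈ Finset.range (FN x v.1), (B j).indicator 1 (x + FX x (v.2 i))

/-- The perturbed measure of marked points. -/
noncomputable def markedMeasure (q : Enumeration d × Marks d) :
    Measure (EuclideanSpace ℝ (Fin d)) :=
  perturbedMeasure q.1.1 q.1.2 q.2.1 q.2.2

lemma markedMeasure_apply (q : Enumeration d × Marks d) {s : Set (EuclideanSpace ℝ (Fin d))}
    (hs : MeasurableSet s) :
    markedMeasure q s = ∑' m : ℕ, ((if (m : ℕ∞) < q.1.1 then
      ∑ i ∈ Finset.range (q.2.1 m), s.indicator 1 (q.1.2 m + q.2.2 m i) else 0 : ℕ) : ℝ≥0∞) := by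
  rw [markedMeasure, perturbedMeasure, Measure.sum_apply _ hs]
  congr with m
  split_ifs with h
  · simp only [Measure.finsetSum_apply, Measure.dirac_apply' _ hs, Nat.cast_sum]
    refine Finset.sum_congr rfl fun i _ => ?_
    by_cases hi : q.1.2 m + q.2.2 m i ∈ s <;> simp [hi]
  · simp

lemma exists_markedMeasure_eq_natCast (q : Enumeration d × Marks d)
    {s : Set (EuclideanSpace ℝ (Fin d))} (hs : MeasurableSet s) (h : markedMeasure q s ≠ ∞) :
    ∃ n : ℕ, markedMeasure q s = n := by
  rw [markedMeasure_apply q hs] at h ⊢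
  obtain ⟨M₀, hM₀⟩ := exists_tsum_natCast_eq h
  exact ⟨_, hM₀ M₀ le_rfl⟩

/-- `Measure.real` sends an infinite count to 0, so the identity holds for every configuration, not
only the locally finite ones. -/
lemma markedMeasure_real_eq_floor (q : Enumeration d × Marks d)
    {s : Set (EuclideanSpace ℝ (Fin d))} (hs : MeasurableSet s) :
    (markedMeasure q).real s = (⌊(markedMeasure q).real s⌋₊ : ℝ) := by
  by_cases h : markedMeasure q s = ∞
  · simp [measureReal_def, h]
  · obtain ⟨n, hn⟩ := exists_markedMeasure_eq_natCast q hs h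
    simp [measureReal_def, hn]

lemma measurable_markedMeasure : Measurable (markedMeasure (d := d)) := by
  refine Measure.measurable_of_measurable_coe _ fun s hs => ?_
  simp_rw [markedMeasure_apply _ hs]
  refine Measurable.tsum fun m => Measurable.of_discrete.comp ?_
  refine Measurable.ite (measurable_fst (measurableSet_lt_fst m)) ?_ measurable_const
  have hind : Measurable (s.indicator (1 : EuclideanSpace ℝ (Fin d) → ℕ)) :=
    measurable_one.indicator hs
  -- The number of summands is random: measurability is proved for each fixed number, which suffices
  -- because ℕ is countable.
  have h1 (r : ℕ) : Measurable fun q : Enumeration d × Marks d =>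
      ∑ i ∈ Finset.range r, s.indicator (1 : EuclideanSpace ℝ (Fin d) → ℕ)
        (q.1.2 m + q.2.2 m i) :=
    Finset.measurable_fun_sum _ fun i _ => hind.comp (by fun_prop)
  have h2 : Measurable fun p : (Enumeration d × Marks d) × ℕ =>
      ∑ i ∈ Finset.range p.2, s.indicator (1 : EuclideanSpace ℝ (Fin d) → ℕ)
        (p.1.1.2 m + p.1.2.2 m i) := measurable_from_prod_countable_left h1
  exact h2.comp (f := fun q : Enumeration d × Marks d => (q, q.2.1 m)) (by fun_prop)

lemma markedMeasure_seedMarks (FN : EuclideanSpace ℝ (Fin d) → unitInterval → ℕ)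
    (FX : EuclideanSpace ℝ (Fin d) → unitInterval → EuclideanSpace ℝ (Fin d))
    {B : Fin k → Set (EuclideanSpace ℝ (Fin d))} (hB : ∀ j, MeasurableSet (B j))
    (p : Enumeration d × (ℕ → MarkSeed)) (j : Fin k) :
    markedMeasure (seedMarks FN FX p) (B j) = totalCount (replicaCount FN FX B) p.1 p.2 j := by
  rw [markedMeasure_apply _ (hB j), totalCount]
  congr with m
  by_cases h : (m : ℕ∞) < p.1.1 <;> simp [markTerm, seedMarks, replicaCount, h]

variable {N : Kernel (EuclideanSpace ℝ (Fin d)) ℕ}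
  {X : Kernel (EuclideanSpace ℝ (Fin d)) (EuclideanSpace ℝ (Fin d))}
  {FN : EuclideanSpace ℝ (Fin d) → unitInterval → ℕ}
  {FX : EuclideanSpace ℝ (Fin d) → unitInterval → EuclideanSpace ℝ (Fin d)}

lemma measurable_seedMarks (hFN : Measurable (Function.uncurry FN))
    (hFX : Measurable (Function.uncurry FX)) : Measurable (seedMarks FN FX) := by
  refine measurable_fst.prodMk (Measurable.prodMk ?_ ?_)
  · refine measurable_pi_lambda _ fun m => ?_
    exact hFN.comp (f := fun p : Enumeration d × (ℕ → MarkSeed) => (p.1.2 m, (p.2 m).1))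
      (by fun_prop)
  · refine measurable_pi_lambda _ fun m => measurable_pi_lambda _ fun i => ?_
    exact hFX.comp (f := fun p : Enumeration d × (ℕ → MarkSeed) => (p.1.2 m, (p.2 m).2 i))
      (by fun_prop)

lemma measurable_replicaCount (hFN : Measurable (Function.uncurry FN))
    (hFX : Measurable (Function.uncurry FX)) {B : Fin k → Set (EuclideanSpace ℝ (Fin d))}
    (hB : ∀ j, MeasurableSet (B j)) : Measurable (Function.uncurry (replicaCount FN FX B)) := by
  refine measurable_pi_lambda _ fun j => ?_
  have hind : Measurable ((B j).indicator (1 : EuclideanSpace ℝ (Fin d) → ℕ)) :=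
    measurable_one.indicator (hB j)
  have h1 (r : ℕ) : Measurable fun p : EuclideanSpace ℝ (Fin d) × MarkSeed =>
      ∑ i ∈ Finset.range r, (B j).indicator (1 : EuclideanSpace ℝ (Fin d) → ℕ)
        (p.1 + FX p.1 (p.2.2 i)) := by
    refine Finset.measurable_fun_sum _ fun i _ => hind.comp (measurable_fst.add ?_)
    exact hFX.comp (f := fun p : EuclideanSpace ℝ (Fin d) × MarkSeed => (p.1, p.2.2 i))
      (by fun_prop)
  have h2 : Measurable fun p : (EuclideanSpace ℝ (Fin d) × MarkSeed) × ℕ =>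
      ∑ i ∈ Finset.range p.2, (B j).indicator (1 : EuclideanSpace ℝ (Fin d) → ℕ)
        (p.1.1 + FX p.1.1 (p.1.2.2 i)) := measurable_from_prod_countable_left h1
  exact h2.comp (f := fun p : EuclideanSpace ℝ (Fin d) × MarkSeed => (p, FN p.1 p.2.1))
    (measurable_id.prodMk (hFN.comp
      (f := fun p : EuclideanSpace ℝ (Fin d) × MarkSeed => (p.1, p.2.1)) (by fun_prop)))

/-! ### The joint law of points and marks -/

/-- Boxes in the space of marks. -/
def markBox (r : ℕ) (A : ℕ → Set ℕ) (C : ℕ → ℕ → Set (EuclideanSpace ℝ (Fin d))) :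
    Set (Marks d) :=
  {q | ∀ m < r, q.1 m ∈ A m ∧ ∀ i < r, q.2 m i ∈ C m i}

/-- The collection of measurable boxes in the space of marks. -/
def markBoxes (d : ℕ) : Set (Set (Marks d)) :=
  {s | ∃ r A C, (∀ m i, MeasurableSet (C m i)) ∧ s = markBox r A C}

lemma measurableSet_markBox (r : ℕ) (A : ℕ → Set ℕ)
    {C : ℕ → ℕ → Set (EuclideanSpace ℝ (Fin d))} (hC : ∀ m i, MeasurableSet (C m i)) :
    MeasurableSet (markBox r A C) := by
  have : markBox r A C = ⋂ m, ⋂ (_ : m < r), ((fun q : Marks d => q.1 m) ⁻¹' A m ∩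
      ⋂ i, ⋂ (_ : i < r), (fun q : Marks d => q.2 m i) ⁻¹' C m i) := by
    ext q; simp [markBox]
  rw [this]
  refine .iInter fun m => .iInter fun _ => .inter ?_ (.iInter fun i => .iInter fun _ => ?_)
  · exact measurableSet_preimage (by fun_prop) .of_discrete
  · exact measurableSet_preimage (by fun_prop) (hC m i)

/-- Boxes with different numbers of constrained coordinates are first padded with `univ` to the
larger size. -/
lemma isPiSystem_markBoxes : IsPiSystem (markBoxes d) := by
  rintro _ ⟨r, A, C, hC, rfl⟩ _ ⟨r', A', C', hC', rfl⟩ -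
  refine ⟨max r r', fun m => (if m < r then A m else univ) ∩ (if m < r' then A' m else univ),
    fun m i => (if m < r ∧ i < r then C m i else univ) ∩
      (if m < r' ∧ i < r' then C' m i else univ), fun m i => ?_, ?_⟩
  · refine .inter ?_ ?_ <;> split_ifs <;> simp [*]
  · ext q
    simp only [markBox, mem_inter_iff, mem_ofPred_eq, lt_max_iff]
    constructor
    · rintro ⟨h, h'⟩ m -
      refine ⟨⟨?_, ?_⟩, fun i _ => ⟨?_, ?_⟩⟩ <;> split_ifs with hm
      · exact (h m hm).1
      · trivial
      · exact (h' m hm).1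
      · trivial
      · exact (h m hm.1).2 i hm.2
      · trivial
      · exact (h' m hm.1).2 i hm.2
      · trivial
    · intro h
      refine ⟨fun m hm => ⟨?_, fun i hi => ?_⟩, fun m hm => ⟨?_, fun i hi => ?_⟩⟩
      · simpa [hm] using (h m (.inl hm)).1.1
      · simpa [hm, hi] using ((h m (.inl hm)).2 i (.inl hi)).1
      · simpa [hm] using (h m (.inr hm)).1.2
      · simpa [hm, hi] using ((h m (.inr hm)).2 i (.inr hi)).2

lemma univ_mem_markBoxes : (univ : Set (Marks d)) ∈ markBoxes d :=
  ⟨0, fun _ => univ, fun _ _ => univ, fun _ _ => .univ, by simp [markBox]⟩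

lemma generateFrom_markBoxes :
    MeasurableSpace.generateFrom (markBoxes d) = (inferInstance : MeasurableSpace (Marks d)) := by
  refine le_antisymm (MeasurableSpace.generateFrom_le ?_) ?_
  · rintro _ ⟨r, A, C, hC, rfl⟩
    exact measurableSet_markBox r A hC
  · have h1 (m : ℕ) : @Measurable _ _ (MeasurableSpace.generateFrom (markBoxes d)) _
        (fun q : Marks d => q.1 m) := by
      intro A _
      refine MeasurableSpace.measurableSet_generateFrom
        ⟨m + 1, fun m' => if m' = m then A else univ, fun _ _ => univ, fun _ _ => .univ, ?_⟩
      ext q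
      simp only [mem_preimage, markBox, mem_ofPred_eq, mem_univ, implies_true, and_true]
      constructor
      · intro hq m' _
        split_ifs with h
        · exact h ▸ hq
        · trivial
      · intro hq
        simpa using hq m (Nat.lt_succ_self m)
    have h2 (m i : ℕ) : @Measurable _ _ (MeasurableSpace.generateFrom (markBoxes d)) _
        (fun q : Marks d => q.2 m i) := by
      intro D hD
      refine MeasurableSpace.measurableSet_generateFrom
        -- A single size r bounds both indices of the translations, so it must exceed m and i.
        ⟨max m i + 1, fun _ => univ, fun m' i' => if m' = m ∧ i' = i then D else univ,
          fun m' i' => ?_, ?_⟩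
      · beta_reduce
        split_ifs
        · exact hD
        · exact .univ
      ext q
      simp only [mem_preimage, markBox, mem_ofPred_eq, mem_univ, true_and]
      constructor
      · intro hq m' _ i' _
        split_ifs with h
        · obtain ⟨rfl, rfl⟩ := h; exact hq
        · trivial
      · intro hq
        simpa using hq m (by omega) i (by omega)
    have h3 : @Measurable _ _ (MeasurableSpace.generateFrom (markBoxes d)) _
        (fun q : Marks d => (q.1, q.2)) :=
      Measurable.prodMk
        ((@measurable_pi_iff _ _ _ (MeasurableSpace.generateFrom (markBoxes d)) _ _).2 h1)
        ((@measurable_pi_iff _ _ _ (MeasurableSpace.generateFrom (markBoxes d)) _ _).2 fun m =>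
          (@measurable_pi_iff _ _ _ (MeasurableSpace.generateFrom (markBoxes d)) _ _).2 (h2 m))
    exact fun s hs => h3 hs

/-- Two laws of marked points which agree on boxes are equal. -/
lemma markedLaw_ext {J J' : Measure (Enumeration d × Marks d)} [IsProbabilityMeasure J]
    [IsProbabilityMeasure J']
    (h : ∀ (D : Set (Enumeration d)) (r : ℕ) (A : ℕ → Set ℕ)
      (C : ℕ → ℕ → Set (EuclideanSpace ℝ (Fin d))), MeasurableSet D →
      (∀ m i, MeasurableSet (C m i)) → J (D ×ˢ markBox r A C) = J' (D ×ˢ markBox r A C)) :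
    J = J' := by
  refine ext_of_generate_finite
    (image2 (· ×ˢ ·) {D : Set (Enumeration d) | MeasurableSet D} (markBoxes d)) ?_ ?_ ?_ ?_
  · exact (generateFrom_eq_prod MeasurableSpace.generateFrom_measurableSet generateFrom_markBoxes
      isCountablySpanning_measurableSet
      ⟨fun _ => univ, fun _ => univ_mem_markBoxes, iUnion_const _⟩).symm
  · exact MeasurableSpace.isPiSystem_measurableSet.prod isPiSystem_markBoxes
  · rintro _ ⟨D, hD, _, ⟨r, A, C, hC, rfl⟩, rfl⟩
    exact h D r A C hD hC
  · simp

/-- The conditional probability of a box of marks, given the points. -/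
noncomputable def boxProb (N : Kernel (EuclideanSpace ℝ (Fin d)) ℕ)
    (X : Kernel (EuclideanSpace ℝ (Fin d)) (EuclideanSpace ℝ (Fin d)))
    (r : ℕ) (A : ℕ → Set ℕ) (C : ℕ → ℕ → Set (EuclideanSpace ℝ (Fin d)))
    (z : Enumeration d) : ℝ≥0∞ :=
  ∏ m ∈ Finset.range r, (N (z.2 m) (A m) * ∏ i ∈ Finset.range r, X (z.2 m) (C m i))

lemma measurable_boxProb (N : Kernel (EuclideanSpace ℝ (Fin d)) ℕ)
    (X : Kernel (EuclideanSpace ℝ (Fin d)) (EuclideanSpace ℝ (Fin d)))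
    (r : ℕ) (A : ℕ → Set ℕ) {C : ℕ → ℕ → Set (EuclideanSpace ℝ (Fin d))}
    (hC : ∀ m i, MeasurableSet (C m i)) : Measurable (boxProb N X r A C) := by
  refine Finset.measurable_fun_prod _ fun m _ =>
    .mul ?_ (Finset.measurable_fun_prod _ fun i _ => ?_)
  · exact (N.measurable_coe .of_discrete).comp (by fun_prop)
  · exact (X.measurable_coe (hC m i)).comp (by fun_prop)

lemma boxProb_le_one [IsMarkovKernel N] [IsMarkovKernel X] (r : ℕ) (A : ℕ → Set ℕ)
    (C : ℕ → ℕ → Set (EuclideanSpace ℝ (Fin d))) (z : Enumeration d) : boxProb N X r A C z ≤ 1 :=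
  Finset.prod_le_one' fun _ _ => mul_le_one' prob_le_one
    (Finset.prod_le_one' fun _ _ => prob_le_one)

/-- For a fixed enumeration the event is a cylinder in the first r seeds, itself a product over the
components of each seed; the samplers turn the uniform volumes of the factors into values of N and
X. -/
lemma seedLaw_box (hFN : IsSampler N FN) (hFX : IsSampler X FX) (ρ : Measure (Enumeration d))
    [IsProbabilityMeasure ρ] {D : Set (Enumeration d)} (hD : MeasurableSet D) (r : ℕ)
    (A : ℕ → Set ℕ) {C : ℕ → ℕ → Set (EuclideanSpace ℝ (Fin d))}
    (hC : ∀ m i, MeasurableSet (C m i)) :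
    ((ρ.prod (Measure.infinitePi fun _ : ℕ => seedMeasure)).map (seedMarks FN FX))
      (D ×ˢ markBox r A C) = ∫⁻ z in D, boxProb N X r A C z ∂ρ := by
  have hmeas := hD.prod (measurableSet_markBox r A hC)
  rw [Measure.map_apply (measurable_seedMarks hFN.1 hFX.1) hmeas,
    Measure.prod_apply (measurable_seedMarks hFN.1 hFX.1 hmeas), ← lintegral_indicator hD]
  congr with z
  by_cases hz : z ∈ D
  · rw [indicator_of_mem hz]
    have e : Prod.mk z ⁻¹' (seedMarks FN FX ⁻¹' D ×ˢ markBox r A C) =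
        Set.pi (Finset.range r : Set ℕ) fun m => (FN (z.2 m) ⁻¹' A m) ×ˢ
          Set.pi (Finset.range r : Set ℕ) fun i => FX (z.2 m) ⁻¹' C m i := by
      ext u
      simp [seedMarks, markBox, hz]
    have mN (m : ℕ) : MeasurableSet (FN (z.2 m) ⁻¹' A m) :=
      hFN.measurable_apply _ .of_discrete
    have mX (m i : ℕ) : MeasurableSet (FX (z.2 m) ⁻¹' C m i) :=
      hFX.measurable_apply _ (hC m i)
    rw [e, Measure.infinitePi_pi _ fun m _ => (mN m).prod
      (MeasurableSet.pi (Finset.countable_toSet _) fun i _ => mX m i), boxProb]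
    refine Finset.prod_congr rfl fun m _ => ?_
    rw [seedMeasure, Measure.prod_prod, Measure.infinitePi_pi _ fun i _ => mX m i,
      ← hFN.2, Measure.map_apply (hFN.measurable_apply _) .of_discrete]
    congr 1
    refine Finset.prod_congr rfl fun i _ => ?_
    rw [← hFX.2, Measure.map_apply (hFX.measurable_apply _) (hC m i)]
  · rw [indicator_of_notMem hz]
    have e : Prod.mk z ⁻¹' (seedMarks FN FX ⁻¹' D ×ˢ markBox r A C) = ∅ := by
      ext u
      simp [seedMarks, hz]
    rw [e, measure_empty]

/-- The joint law of points and conditionally independent marks is the law of marks computed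
from independent seeds. -/
lemma markedLaw_eq_seedLaw [IsMarkovKernel N] [IsMarkovKernel X] (hFN : IsSampler N FN)
    (hFX : IsSampler X FX) {Ω' : Type*} [MeasurableSpace Ω'] {P' : Measure Ω'}
    [IsProbabilityMeasure P'] {κ : Ω' → ℕ∞} {x : ℕ → Ω' → EuclideanSpace ℝ (Fin d)}
    {n : ℕ → Ω' → ℕ} {y : ℕ → ℕ → Ω' → EuclideanSpace ℝ (Fin d)}
    (hκ : Measurable κ) (hx : ∀ m, Measurable (x m)) (hn : ∀ m, Measurable (n m))
    (hy : ∀ m i, Measurable (y m i))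
    (hcond : ∀ (r : ℕ) (A : ℕ → Set ℕ) (C : ℕ → ℕ → Set (EuclideanSpace ℝ (Fin d))),
      (∀ m i, MeasurableSet (C m i)) →
      P'⟦{ω | ∀ m < r, n m ω ∈ A m ∧ ∀ i < r, y m i ω ∈ C m i} |
          MeasurableSpace.comap (fun ω => (κ ω, fun m => x m ω)) inferInstance⟧
        =ᵐ[P'] fun ω => ∏ m ∈ Finset.range r,
          ((N (x m ω)).real (A m) * ∏ i ∈ Finset.range r, (X (x m ω)).real (C m i))) :
    P'.map (fun ω => (((κ ω, fun m => x m ω), (fun m => n m ω, fun m i => y m i ω)) :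
        Enumeration d × Marks d)) =
      ((P'.map fun ω => ((κ ω, fun m => x m ω) : Enumeration d)).prod
        (Measure.infinitePi fun _ : ℕ => seedMeasure)).map (seedMarks FN FX) := by
  have hz : Measurable fun ω => ((κ ω, fun m => x m ω) : Enumeration d) := by fun_prop
  have hq : Measurable fun ω => ((fun m => n m ω, fun m i => y m i ω) : Marks d) := by fun_prop
  have : IsProbabilityMeasure (P'.map fun ω => ((κ ω, fun m => x m ω) : Enumeration d)) :=
    Measure.isProbabilityMeasure_map hz.aemeasurable
  have : IsProbabilityMeasure (P'.map (fun ω => (((κ ω, fun m => x m ω),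
      (fun m => n m ω, fun m i => y m i ω)) : Enumeration d × Marks d))) :=
    Measure.isProbabilityMeasure_map (hz.prodMk hq).aemeasurable
  have : IsProbabilityMeasure (((P'.map fun ω => ((κ ω, fun m => x m ω) : Enumeration d)).prod
        (Measure.infinitePi fun _ : ℕ => seedMeasure)).map (seedMarks FN FX)) :=
    Measure.isProbabilityMeasure_map (measurable_seedMarks hFN.1 hFX.1).aemeasurable
  refine markedLaw_ext fun D r A C hD hC => ?_
  rw [seedLaw_box hFN hFX _ hD r A hC, Measure.map_apply (hz.prodMk hq)
    (hD.prod (measurableSet_markBox r A hC)),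
    setLIntegral_map hD (measurable_boxProb N X r A hC) hz]
  set S : Set Ω' := {ω | ∀ m < r, n m ω ∈ A m ∧ ∀ i < r, y m i ω ∈ C m i} with hS
  have hSm : MeasurableSet S := hq (measurableSet_markBox r A hC)
  have hDm : MeasurableSet[MeasurableSpace.comap (fun ω => ((κ ω, fun m => x m ω) :
      Enumeration d)) inferInstance] ((fun ω => ((κ ω, fun m => x m ω) : Enumeration d)) ⁻¹' D) :=
    ⟨D, hD, rfl⟩
  -- Integrating the conditional probability over an event that depends on the points alone gives
  -- the joint probability. What follows passes from real-valued to extended non-negative integrals.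
  have h1 := setIntegral_condExp (μ := P') (f := S.indicator fun _ => (1 : ℝ)) hz.comap_le
    ((integrable_const _).indicator hSm) hDm
  have h2 : ∫ ω in (fun ω => ((κ ω, fun m => x m ω) : Enumeration d)) ⁻¹' D,
      (S.indicator fun _ => (1 : ℝ)) ω ∂P' =
        P'.real (S ∩ (fun ω => ((κ ω, fun m => x m ω) : Enumeration d)) ⁻¹' D) := by
    rw [integral_indicator_const _ hSm]
    simp [measureReal_restrict_apply hSm]
  have h3 : ∫ ω in (fun ω => ((κ ω, fun m => x m ω) : Enumeration d)) ⁻¹' D,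
      (boxProb N X r A C (κ ω, fun m => x m ω)).toReal ∂P' =
        P'.real (S ∩ (fun ω => ((κ ω, fun m => x m ω) : Enumeration d)) ⁻¹' D) := by
    rw [← h2, ← h1]
    refine integral_congr_ae (ae_restrict_of_ae ?_)
    filter_upwards [hcond r A C hC] with ω hω
    rw [hω]
    simp [boxProb, ENNReal.toReal_prod, measureReal_def]
  have hbox : Measurable fun ω => boxProb N X r A C (κ ω, fun m => x m ω) :=
    (measurable_boxProb N X r A hC).comp hz
  rw [integral_toReal hbox.aemeasurable
    (ae_of_all _ fun ω => (boxProb_le_one r A C _).trans_lt ENNReal.one_lt_top)] at h3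
  have h4 : ∫⁻ ω in (fun ω => ((κ ω, fun m => x m ω) : Enumeration d)) ⁻¹' D,
      boxProb N X r A C (κ ω, fun m => x m ω) ∂P' ≠ ∞ := by
    refine ne_top_of_le_ne_top ENNReal.one_ne_top ?_
    calc _ ≤ ∫⁻ ω in (fun ω => ((κ ω, fun m => x m ω) : Enumeration d)) ⁻¹' D, 1 ∂P' :=
          lintegral_mono fun ω => boxProb_le_one r A C _
      _ ≤ 1 := by simpa using prob_le_one
  rw [measureReal_def, ENNReal.toReal_eq_toReal_iff' h4 (measure_ne_top _ _)] at h3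
  rw [h3, inter_comm]
  rfl

/-- The counts of a perturbation are distributed as the counts computed from independent seeds. -/
lemma IsPerturbation.exists_enumeration [IsMarkovKernel N] [IsMarkovKernel X] {Ω Ω' : Type*}
    [MeasurableSpace Ω] [MeasurableSpace Ω'] {P : Measure Ω} {P' : Measure Ω'}
    [IsProbabilityMeasure P'] {Φ : Ω → Measure (EuclideanSpace ℝ (Fin d))}
    {Ψ : Ω' → Measure (EuclideanSpace ℝ (Fin d))} (h : IsPerturbation P Φ N X P' Ψ) :
    ∃ ρ : Measure (Enumeration d), IsProbabilityMeasure ρ ∧ ρ.map enumMeasure = P.map Φ ∧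
      ∀ FN FX, IsSampler N FN → IsSampler X FX →
      ∀ (k : ℕ) (B : Fin k → Set (EuclideanSpace ℝ (Fin d))), (∀ j, MeasurableSet (B j)) →
      ∃ c : Ω' → Fin k → ℕ, Measurable c ∧
        (∀ᵐ ω ∂P', (fun j => (Ψ ω).real (B j)) = realCounts (c ω)) ∧
        P'.map c = countLaw ρ seedMeasure (replicaCount FN FX B) := by
  obtain ⟨κ, x, n, y, hκ, hx, hn, hy, hid, hcond, hΨ⟩ := h
  have hz : Measurable fun ω => ((κ ω, fun m => x m ω) : Enumeration d) := by fun_prop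
  have hq : Measurable fun ω => (((κ ω, fun m => x m ω), (fun m => n m ω, fun m i => y m i ω)) :
      Enumeration d × Marks d) := by fun_prop
  refine ⟨P'.map fun ω => ((κ ω, fun m => x m ω) : Enumeration d),
    Measure.isProbabilityMeasure_map hz.aemeasurable, ?_, fun FN FX hFN hFX k B hB => ?_⟩
  · rw [Measure.map_map measurable_enumMeasure hz, hid.map_eq]
    rfl
  have hfloor : Measurable fun q : Enumeration d × Marks d =>
      fun j => ⌊(markedMeasure q).real (B j)⌋₊ :=
    measurable_pi_lambda _ fun j =>
      ((Measure.measurable_coe (hB j)).comp measurable_markedMeasure).ennreal_toReal.nat_floor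
  refine ⟨_, hfloor.comp hq, ?_, ?_⟩
  · filter_upwards [hΨ] with ω hω
    ext j
    rw [hω]
    exact markedMeasure_real_eq_floor
      ((κ ω, fun m => x m ω), (fun m => n m ω, fun m i => y m i ω)) (hB j)
  · rw [← Measure.map_map hfloor hq, markedLaw_eq_seedLaw hFN hFX hκ hx hn hy hcond,
      Measure.map_map hfloor (measurable_seedMarks hFN.1 hFX.1), countLaw]
    congr with p j
    simp only [Function.comp, natCount, measureReal_def, markedMeasure_seedMarks FN FX hB]

end

section

variable {d k : ℕ} {N N₁ N₂ : Kernel (EuclideanSpace ℝ (Fin d)) ℕ}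
  {X : Kernel (EuclideanSpace ℝ (Fin d)) (EuclideanSpace ℝ (Fin d))}
  {FN FN₁ FN₂ : EuclideanSpace ℝ (Fin d) → unitInterval → ℕ}
  {FX : EuclideanSpace ℝ (Fin d) → unitInterval → EuclideanSpace ℝ (Fin d)}
  {B : Fin k → Set (EuclideanSpace ℝ (Fin d))}

/-! ### The numbers of replicas of a point -/

/-- The vector of indicators of the sets `B j`. -/
noncomputable def hitVector (B : Fin k → Set (EuclideanSpace ℝ (Fin d)))
    (x : EuclideanSpace ℝ (Fin d)) : Fin k → ℕ :=
  fun j => (B j).indicator 1 x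

lemma measurable_hitVector (hB : ∀ j, MeasurableSet (B j)) : Measurable (hitVector B) :=
  measurable_pi_lambda _ fun j => measurable_one.indicator (hB j)

lemma measurable_hitVector_add (hB : ∀ j, MeasurableSet (B j)) (x : EuclideanSpace ℝ (Fin d)) :
    Measurable fun y => hitVector B (x + y) :=
  (measurable_hitVector hB).comp (measurable_const_add x)

/-- The law of the vector of indicators for a translated point. -/
noncomputable def hitLaw (X : Kernel (EuclideanSpace ℝ (Fin d)) (EuclideanSpace ℝ (Fin d)))
    (B : Fin k → Set (EuclideanSpace ℝ (Fin d))) (x : EuclideanSpace ℝ (Fin d)) :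
    Measure (Fin k → ℕ) :=
  (X x).map fun y => hitVector B (x + y)

lemma isProbabilityMeasure_hitLaw [IsMarkovKernel X] (hB : ∀ j, MeasurableSet (B j))
    (x : EuclideanSpace ℝ (Fin d)) : IsProbabilityMeasure (hitLaw X B x) :=
  Measure.isProbabilityMeasure_map (measurable_hitVector_add hB x).aemeasurable

lemma hitVector_le_one (x : EuclideanSpace ℝ (Fin d)) : hitVector B x ≤ 1 := by
  intro j
  by_cases h : x ∈ B j <;> simp [hitVector, h]

lemma ae_hitLaw_le_one (hB : ∀ j, MeasurableSet (B j)) (x : EuclideanSpace ℝ (Fin d)) :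
    ∀ᵐ a ∂hitLaw X B x, a ≤ 1 := by
  rw [hitLaw, ae_map_iff (measurable_hitVector_add hB x).aemeasurable .of_discrete]
  exact ae_of_all _ fun y => hitVector_le_one _

lemma lintegral_coord_hitLaw (hB : ∀ j, MeasurableSet (B j)) (x : EuclideanSpace ℝ (Fin d))
    (j : Fin k) : ∫⁻ a, (a j : ℝ≥0∞) ∂hitLaw X B x = X x {y | x + y ∈ B j} := by
  have hm : MeasurableSet {y | x + y ∈ B j} := measurable_const_add x (hB j)
  rw [hitLaw, lintegral_map .of_discrete (measurable_hitVector_add hB x),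
    ← lintegral_indicator_one hm]
  congr with y
  by_cases h : x + y ∈ B j <;> simp [hitVector, h]

lemma lintegral_coord_convPow {π : Measure (Fin k → ℕ)} [IsProbabilityMeasure π] (n : ℕ)
    (j : Fin k) : ∫⁻ a, (a j : ℝ≥0∞) ∂convPow π n = n * ∫⁻ a, (a j : ℝ≥0∞) ∂π := by
  induction n with
  | zero => simp [convPow]
  | succ n ih =>
    rw [lintegral_convPow_succ]
    simp only [Pi.add_apply, Nat.cast_add, lintegral_add_left Measurable.of_discrete,
      lintegral_const, measure_univ, mul_one, ih]
    ring

/-- The numbers of replicas of a point have a compound distribution. -/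
lemma lintegral_replicaCount [IsMarkovKernel X] (hFN : IsSampler N FN) (hFX : IsSampler X FX)
    (hB : ∀ j, MeasurableSet (B j)) (x : EuclideanSpace ℝ (Fin d)) (G : (Fin k → ℕ) → ℝ≥0∞) :
    ∫⁻ v, G (replicaCount FN FX B x v) ∂seedMeasure =
      ∫⁻ n, ∫⁻ a, G a ∂convPow (hitLaw X B x) n ∂N x := by
  have hv : Measurable fun s => hitVector B (x + FX x s) :=
    (measurable_hitVector_add hB x).comp (hFX.measurable_apply x)
  have hmap : (volume : Measure unitInterval).map (fun s => hitVector B (x + FX x s)) =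
      hitLaw X B x := by
    rw [hitLaw, ← hFX.2, Measure.map_map (measurable_hitVector_add hB x) (hFX.measurable_apply x)]
    rfl
  have hrep : Measurable (replicaCount FN FX B x) :=
    (measurable_replicaCount hFN.1 hFX.1 hB).comp (f := fun v => (x, v)) (by fun_prop)
  have hGrep : Measurable fun v => G (replicaCount FN FX B x v) := Measurable.of_discrete.comp hrep
  rw [seedMeasure, lintegral_prod _ hGrep.aemeasurable, ← hFN.2,
    lintegral_map .of_discrete (hFN.measurable_apply x)]
  -- Fixing the first seed component fixes the number of replicas; the remaining components give
  -- that many independent hit vectors.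
  refine lintegral_congr fun w => ?_
  have hsum : Measurable fun u : ℕ → unitInterval =>
      ∑ i ∈ Finset.range (FN x w), hitVector B (x + FX x (u i)) :=
    Finset.measurable_fun_sum _ fun i _ => hv.comp (measurable_pi_apply i)
  rw [← hmap, ← map_sum_range_eq_convPow hv, lintegral_map .of_discrete hsum]
  refine lintegral_congr fun u => congrArg G ?_
  ext j
  simp [replicaCount, hitVector]

lemma lintegral_coord_replicaCount [IsMarkovKernel X] (hFN : IsSampler N FN)
    (hFX : IsSampler X FX) (hB : ∀ j, MeasurableSet (B j)) (x : EuclideanSpace ℝ (Fin d))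
    (j : Fin k) :
    ∫⁻ v, (replicaCount FN FX B x v j : ℝ≥0∞) ∂seedMeasure =
      (∫⁻ n : ℕ, (n : ℝ≥0∞) ∂N x) * X x {y | x + y ∈ B j} := by
  have := isProbabilityMeasure_hitLaw (X := X) hB x
  rw [lintegral_replicaCount hFN hFX hB x fun a => (a j : ℝ≥0∞)]
  simp_rw [lintegral_coord_convPow, lintegral_coord_hitLaw hB]
  rw [lintegral_mul_const _ .of_discrete]

lemma convPow_dirac_zero (n : ℕ) : convPow (Measure.dirac (0 : Fin k → ℕ)) n = .dirac 0 := by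
  induction n with
  | zero => rfl
  | succ n ih => rw [convPow, ih, Measure.dirac_conv]; simp

/-- Treats the points whose replicas almost surely miss all the sets: there the Radon condition does
not bound the mean of N x, but no replica is counted. -/
lemma hitLaw_eq_dirac_zero [IsMarkovKernel X] {x : EuclideanSpace ℝ (Fin d)}
    (h : X x {y | x + y ∈ ⋃ j, B j} = 0) : hitLaw X B x = .dirac 0 := by
  have h1 : (fun y => hitVector B (x + y)) =ᵐ[X x] fun _ => 0 := by
    filter_upwards [measure_eq_zero_iff_ae_notMem.1 h] with y hy
    ext j
    have : x + y ∉ B j := fun hj => hy (mem_iUnion.2 ⟨j, hj⟩)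
    simp [hitVector, this]
  rw [hitLaw, Measure.map_congr h1, Measure.map_const, measure_univ, one_smul]

/-- The counts are compound sums, so the compound comparison applies. When the union of the sets is
hit with positive probability, the finite products `h₁`, `h₂` force finite mean replication numbers;
otherwise both counts vanish. -/
lemma countDcxLE_replicaCount [IsMarkovKernel X] [IsMarkovKernel N₁] [IsMarkovKernel N₂]
    (hFN₁ : IsSampler N₁ FN₁) (hFN₂ : IsSampler N₂ FN₂) (hFX : IsSampler X FX)
    (hB : ∀ j, MeasurableSet (B j)) {x : EuclideanSpace ℝ (Fin d)}
    (hle : ConvexLE (N₁ x) (N₂ x))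
    (h₁ : (∫⁻ n : ℕ, (n : ℝ≥0∞) ∂N₁ x) * X x {y | x + y ∈ ⋃ j, B j} < ∞)
    (h₂ : (∫⁻ n : ℕ, (n : ℝ≥0∞) ∂N₂ x) * X x {y | x + y ∈ ⋃ j, B j} < ∞) :
    CountDcxLE (seedMeasure.map (replicaCount FN₁ FX B x))
      (seedMeasure.map (replicaCount FN₂ FX B x)) := by
  intro g hg
  have hrep {FN : EuclideanSpace ℝ (Fin d) → unitInterval → ℕ}
      (hFN : Measurable (Function.uncurry FN)) : Measurable (replicaCount FN FX B x) :=
    (measurable_replicaCount hFN hFX.1 hB).comp (f := fun v => (x, v)) (by fun_prop)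
  rw [lintegral_map .of_discrete (hrep hFN₁.1), lintegral_map .of_discrete (hrep hFN₂.1),
    lintegral_replicaCount hFN₁ hFX hB, lintegral_replicaCount hFN₂ hFX hB]
  by_cases h : X x {y | x + y ∈ ⋃ j, B j} = 0
  · simp [hitLaw_eq_dirac_zero h, convPow_dirac_zero]
  · have := isProbabilityMeasure_hitLaw (X := X) hB x
    exact hg.lintegral_compound_le (ae_hitLaw_le_one hB x) hle
      (ENNReal.lt_top_of_mul_ne_top_left h₁.ne h) (ENNReal.lt_top_of_mul_ne_top_left h₂.ne h)

/-! ### Comparison of perturbations -/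

lemma lintegral_replicaCount_lt_top [IsMarkovKernel X] {α : Measure (EuclideanSpace ℝ (Fin d))}
    (hFN : IsSampler N FN) (hFX : IsSampler X FX) (hB : ∀ j, MeasurableSet (B j))
    (hb : ∀ j, Bornology.IsBounded (B j)) (hR : PerturbationRadon α N X) (j : Fin k) :
    ∫⁻ x, ∫⁻ v, (replicaCount FN FX B x v j : ℝ≥0∞) ∂seedMeasure ∂α < ∞ := by
  simp_rw [lintegral_coord_replicaCount hFN hFX hB]
  exact hR _ (hB j) (hb j)

lemma ae_mul_lt_top [IsMarkovKernel N] [IsMarkovKernel X]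
    {α : Measure (EuclideanSpace ℝ (Fin d))} (hR : PerturbationRadon α N X)
    {s : Set (EuclideanSpace ℝ (Fin d))} (hs : MeasurableSet s) (hb : Bornology.IsBounded s) :
    ∀ᵐ x ∂α, (∫⁻ n : ℕ, (n : ℝ≥0∞) ∂N x) * X x {y | x + y ∈ s} < ∞ := by
  refine ae_lt_top (.mul (Measurable.lintegral_kernel .of_discrete) ?_) (hR s hs hb).ne
  exact Kernel.measurable_kernel_prodMk_left (κ := X)
    (t := {p : EuclideanSpace ℝ (Fin d) × EuclideanSpace ℝ (Fin d) | p.1 + p.2 ∈ s})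
    (measurableSet_preimage measurable_add hs)

/-- Collects what the passage to general dcx functions requires: the increasing dcx order of the
counts, and equal finite coordinate means. -/
lemma countLaw_comparison [IsMarkovKernel X] [IsMarkovKernel N₁] [IsMarkovKernel N₂]
    (hFN₁ : IsSampler N₁ FN₁) (hFN₂ : IsSampler N₂ FN₂) (hFX : IsSampler X FX)
    {ρ₁ ρ₂ : Measure (Enumeration d)} [IsProbabilityMeasure ρ₁] [IsProbabilityMeasure ρ₂]
    (hρ : ρ₁.map enumMeasure = ρ₂.map enumMeasure)
    (h₁ : PerturbationRadon (ρ₁.bind enumMeasure) N₁ X)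
    (h₂ : PerturbationRadon (ρ₁.bind enumMeasure) N₂ X)
    (hle : ∀ᵐ x ∂ρ₁.bind enumMeasure, ConvexLE (N₁ x) (N₂ x))
    (hB : ∀ j, MeasurableSet (B j)) (hb : ∀ j, Bornology.IsBounded (B j)) :
    CountDcxLE (countLaw ρ₁ seedMeasure (replicaCount FN₁ FX B))
      (countLaw ρ₂ seedMeasure (replicaCount FN₂ FX B)) ∧
    (∀ j, ∫⁻ a, (a j : ℝ≥0∞) ∂countLaw ρ₁ seedMeasure (replicaCount FN₁ FX B) < ∞) ∧
    ∀ j, ∫⁻ a, (a j : ℝ≥0∞) ∂countLaw ρ₁ seedMeasure (replicaCount FN₁ FX B) =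
      ∫⁻ a, (a j : ℝ≥0∞) ∂countLaw ρ₂ seedMeasure (replicaCount FN₂ FX B) := by
  have hW₁ := measurable_replicaCount hFN₁.1 hFX.1 hB
  have hW₂ := measurable_replicaCount hFN₂.1 hFX.1 hB
  have hfin₁ := lintegral_replicaCount_lt_top hFN₁ hFX hB hb h₁
  have hfin₂ := lintegral_replicaCount_lt_top hFN₂ hFX hB hb h₂
  have hU := MeasurableSet.iUnion hB
  have hbU := (Bornology.isBounded_iUnion (s := B)).2 hb
  -- The second perturbation is moved to the enumeration of the first, so that the comparison can be
  -- made conditionally on the points.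
  rw [← countLaw_eq_of_map_eq hρ hW₂ hfin₂]
  refine ⟨countDcxLE_countLaw hW₁ hW₂ hfin₁ hfin₂ ?_, fun j => ?_, fun j => ?_⟩
  · filter_upwards [hle, ae_mul_lt_top h₁ hU hbU, ae_mul_lt_top h₂ hU hbU] with x hx hx₁ hx₂
    exact countDcxLE_replicaCount hFN₁ hFN₂ hFX hB hx hx₁ hx₂
  · rw [lintegral_coord_countLaw hW₁ hfin₁]
    exact hfin₁ j
  · rw [lintegral_coord_countLaw hW₁ hfin₁, lintegral_coord_countLaw hW₂ hfin₂]
    refine lintegral_congr_ae ?_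
    filter_upwards [hle, ae_mul_lt_top h₁ (hB j) (hb j), ae_mul_lt_top h₂ (hB j) (hb j)]
      with x hx hx₁ hx₂
    rw [lintegral_coord_replicaCount hFN₁ hFX hB, lintegral_coord_replicaCount hFN₂ hFX hB]
    -- If the set is never hit, the means of `N₁ x` and `N₂ x` may be infinite, but they are
    -- multiplied by 0.
    by_cases h : X x {y | x + y ∈ B j} = 0
    · rw [h, mul_zero, mul_zero]
    · rw [hx.lintegral_id_eq (ENNReal.lt_top_of_mul_ne_top_left hx₁.ne h)
        (ENNReal.lt_top_of_mul_ne_top_left hx₂.ne h)]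

/-- The comparison is moved to the laws on ℕ^k, a discrete space on which every function is
measurable. -/
lemma dcxLE_of_counts {Ω₁ Ω₂ : Type*} [MeasurableSpace Ω₁] [MeasurableSpace Ω₂]
    {P₁ : Measure Ω₁} [IsProbabilityMeasure P₁] {P₂ : Measure Ω₂} [IsProbabilityMeasure P₂]
    {Y₁ : Ω₁ → Fin k → ℝ} {Y₂ : Ω₂ → Fin k → ℝ} {c₁ : Ω₁ → Fin k → ℕ} {c₂ : Ω₂ → Fin k → ℕ}
    (hc₁ : Measurable c₁) (hc₂ : Measurable c₂) (hY₁ : ∀ᵐ ω ∂P₁, Y₁ ω = realCounts (c₁ ω))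
    (hY₂ : ∀ᵐ ω ∂P₂, Y₂ ω = realCounts (c₂ ω)) (hle : CountDcxLE (P₁.map c₁) (P₂.map c₂))
    (hfin : ∀ j, ∫⁻ a, (a j : ℝ≥0∞) ∂P₁.map c₁ < ∞)
    (heq : ∀ j, ∫⁻ a, (a j : ℝ≥0∞) ∂P₁.map c₁ = ∫⁻ a, (a j : ℝ≥0∞) ∂P₂.map c₂) :
    DcxLE P₁ Y₁ P₂ Y₂ := by
  intro f hf hi₁ hi₂
  have e₁ : (fun ω => f (Y₁ ω)) =ᵐ[P₁] fun ω => f (realCounts (c₁ ω)) :=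
    hY₁.mono fun ω h => by simp only [h]
  have e₂ : (fun ω => f (Y₂ ω)) =ᵐ[P₂] fun ω => f (realCounts (c₂ ω)) :=
    hY₂.mono fun ω h => by simp only [h]
  have := Measure.isProbabilityMeasure_map hc₁.aemeasurable (μ := P₁)
  have := Measure.isProbabilityMeasure_map hc₂.aemeasurable (μ := P₂)
  have hm (m : Measure (Fin k → ℕ)) : AEStronglyMeasurable (fun a => f (realCounts a)) m :=
    Measurable.of_discrete.aestronglyMeasurable
  have h := hle.integral_le hfin heq hf
    ((integrable_map_measure (hm _) hc₁.aemeasurable).2 (hi₁.congr e₁))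
    ((integrable_map_measure (hm _) hc₂.aemeasurable).2 (hi₂.congr e₂))
  rwa [integral_map hc₁.aemeasurable (hm _), integral_map hc₂.aemeasurable (hm _),
    ← integral_congr_ae e₁, ← integral_congr_ae e₂] at h

lemma exists_sampler {β : Type*} [MeasurableSpace β] [StandardBorelSpace β] [Nonempty β]
    (κ : Kernel (EuclideanSpace ℝ (Fin d)) β) [IsMarkovKernel κ] : ∃ F, IsSampler κ F :=
  κ.exists_measurable_map_eq_unitInterval

/-- Perturbations are `dcx` monotone with respect to the replication kernel. -/
theorem IsPerturbation.processDcxLE [IsMarkovKernel X] [IsMarkovKernel N₁] [IsMarkovKernel N₂]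
    {Ω Ω₁ Ω₂ : Type*} [MeasurableSpace Ω] [MeasurableSpace Ω₁] [MeasurableSpace Ω₂]
    {P : Measure Ω} {P₁ : Measure Ω₁} [IsProbabilityMeasure P₁]
    {P₂ : Measure Ω₂} [IsProbabilityMeasure P₂]
    {Φ : Ω → Measure (EuclideanSpace ℝ (Fin d))} {Ψ₁ : Ω₁ → Measure (EuclideanSpace ℝ (Fin d))}
    {Ψ₂ : Ω₂ → Measure (EuclideanSpace ℝ (Fin d))}
    (h₁ : PerturbationRadon (meanMeasure P Φ) N₁ X) (h₂ : PerturbationRadon (meanMeasure P Φ) N₂ X)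
    (hΨ₁ : IsPerturbation P Φ N₁ X P₁ Ψ₁) (hΨ₂ : IsPerturbation P Φ N₂ X P₂ Ψ₂)
    (hle : ∀ᵐ x ∂meanMeasure P Φ, ConvexLE (N₁ x) (N₂ x)) : ProcessDcxLE P₁ Ψ₁ P₂ Ψ₂ := by
  intro k B hB hb
  obtain ⟨FN₁, hFN₁⟩ := exists_sampler N₁
  obtain ⟨FN₂, hFN₂⟩ := exists_sampler N₂
  obtain ⟨FX, hFX⟩ := exists_sampler X
  obtain ⟨ρ₁, _, hρ₁, H₁⟩ := hΨ₁.exists_enumeration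
  obtain ⟨ρ₂, _, hρ₂, H₂⟩ := hΨ₂.exists_enumeration
  obtain ⟨c₁, hc₁, hY₁, hl₁⟩ := H₁ FN₁ FX hFN₁ hFX k B hB
  obtain ⟨c₂, hc₂, hY₂, hl₂⟩ := H₂ FN₂ FX hFN₂ hFX k B hB
  have hα : meanMeasure P Φ = ρ₁.bind enumMeasure := by
    rw [meanMeasure, Measure.bind, Measure.bind, hρ₁]
  rw [hα] at h₁ h₂ hle
  obtain ⟨h, h', h''⟩ :=
    countLaw_comparison hFN₁ hFN₂ hFX (hρ₁.trans hρ₂.symm) h₁ h₂ hle hB hb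
  rw [← hl₁] at h h' h''
  rw [← hl₂] at h h''
  exact dcxLE_of_counts hc₁ hc₂ hY₁ hY₂ h h' h''

end

/-! ### Tiling of the space by unit cubes -/

lemma volume_unitCube (d : ℕ) :
    volume {y : EuclideanSpace ℝ (Fin d) | ∀ i, 0 ≤ y i ∧ y i < 1} = 1 := by
  have h : {y : EuclideanSpace ℝ (Fin d) | ∀ i, 0 ≤ y i ∧ y i < 1} =
      WithLp.ofLp ⁻¹' (Set.univ.pi fun _ : Fin d => Ico (0 : ℝ) 1) := by
    ext y; simp
  rw [h, (PiLp.volume_preserving_ofLp (Fin d)).measure_preimage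
    (MeasurableSet.univ_pi fun _ => measurableSet_Ico).nullMeasurableSet, Real.volume_pi_Ico]
  simp

instance (d : ℕ) : IsMarkovKernel (cubeKernel d) :=
  ⟨fun _ => ⟨by rw [cubeKernel, Kernel.const_apply, Measure.restrict_apply_univ,
    volume_unitCube]⟩⟩

lemma lintegral_latticeMeasure {d : ℕ} (φ : EuclideanSpace ℝ (Fin d) → ℝ≥0∞) :
    ∫⁻ x, φ x ∂latticeMeasure d = ∑' z : Fin d → ℤ, φ (latticePoint z) := by
  rw [latticeMeasure, lintegral_sum_measure]
  simp

lemma ae_latticeMeasure_iff {d : ℕ} (p : EuclideanSpace ℝ (Fin d) → Prop) :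
    (∀ᵐ x ∂latticeMeasure d, p x) ↔ ∀ z : Fin d → ℤ, p (latticePoint z) := by
  rw [latticeMeasure, Measure.ae_sum_iff]
  simp [ae_dirac_eq]

/-- The translated unit cubes centered at the lattice tile the space. -/
lemma lintegral_cubeKernel_latticeMeasure {d : ℕ} {B : Set (EuclideanSpace ℝ (Fin d))}
    (hB : MeasurableSet B) :
    ∫⁻ x, cubeKernel d x {y | x + y ∈ B} ∂latticeMeasure d = volume B := by
  -- Coordinatewise floors cut the space into the half-open cells z + [0, 1)^d. By translation
  -- invariance the term of z is the volume of the part of B in its cell.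
  set φ : EuclideanSpace ℝ (Fin d) → Fin d → ℤ := fun y i => ⌊y i⌋ with hφdef
  have hφ : Measurable φ := measurable_pi_lambda _ fun i => Int.measurable_floor.comp (by fun_prop)
  have hφz (z : Fin d → ℤ) : MeasurableSet (φ ⁻¹' {z}) := hφ (measurableSet_singleton z)
  have hcover : B = ⋃ z, B ∩ φ ⁻¹' {z} := by
    ext y; simp
  have hdisj : Pairwise (Function.onFun Disjoint fun z => B ∩ φ ⁻¹' {z}) := by
    intro z z' hzz'
    refine Set.disjoint_left.2 ?_
    rintro y ⟨-, hy⟩ ⟨-, hy'⟩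
    exact hzz' ((mem_singleton_iff.1 hy).symm.trans (mem_singleton_iff.1 hy'))
  rw [lintegral_latticeMeasure]
  conv_rhs => rw [hcover, measure_iUnion hdisj fun z => hB.inter (hφz z)]
  congr with z
  have hm : MeasurableSet {y | latticePoint z + y ∈ B} := measurable_const_add (latticePoint z) hB
  rw [cubeKernel, Kernel.const_apply, Measure.restrict_apply hm,
    ← measure_preimage_add volume (latticePoint z) (B ∩ φ ⁻¹' {z})]
  congr 1
  ext y
  simp only [mem_inter_iff, mem_ofPred_eq, mem_preimage, mem_singleton_iff, hφdef, funext_iff,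
    Int.floor_eq_iff]
  refine and_congr_right fun _ => forall_congr' fun i => ?_
  simp [latticePoint]

/-! ### Laplace transforms of Poisson variables -/

lemma lintegral_pow_poissonMeasure (r : ℝ≥0) {q : ℝ≥0∞} (hq : q ≤ 1) :
    ∫⁻ n, q ^ n ∂poissonMeasure r = expNeg (r * (1 - q)) := by
  obtain ⟨s, rfl⟩ : ∃ s : ℝ≥0, (s : ℝ≥0∞) = q :=
    ⟨q.toNNReal, ENNReal.coe_toNNReal (ne_top_of_le_ne_top ENNReal.one_ne_top hq)⟩
  have hs : (s : ℝ) ≤ 1 := by exact_mod_cast hq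
  have h1 : HasSum (fun n : ℕ => Real.exp (-r) * r ^ n / n.factorial * (s : ℝ) ^ n)
      (Real.exp (-(r * (1 - s)))) := by
    have := (NormedSpace.expSeries_div_hasSum_exp ((r : ℝ) * s)).mul_left (Real.exp (-r))
    rw [← Real.exp_eq_exp_ℝ, ← Real.exp_add] at this
    convert! this using 1
    · ext n
      rw [mul_pow]
      ring
    · congr 1
      ring
  have e : (r : ℝ≥0∞) * (1 - (s : ℝ≥0∞)) = ENNReal.ofReal (r * (1 - s)) := by
    rw [ENNReal.ofReal_mul r.coe_nonneg, ENNReal.ofReal_sub _ s.coe_nonneg]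
    simp
  rw [e, expNeg_ofReal (mul_nonneg r.coe_nonneg (by linarith)), ← h1.tsum_eq,
    ENNReal.ofReal_tsum_of_nonneg (fun n => by positivity) h1.summable, poissonMeasure,
    lintegral_sum_measure]
  congr with n
  rw [lintegral_smul_measure, lintegral_dirac, smul_eq_mul, ENNReal.ofReal_mul (by positivity),
    ENNReal.ofReal_pow s.coe_nonneg]
  simp

lemma lintegral_natCast_poissonMeasure (r : ℝ≥0) :
    ∫⁻ n : ℕ, (n : ℝ≥0∞) ∂poissonMeasure r = r := by
  have h1 : HasSum (fun n : ℕ => Real.exp (-r) * r ^ n / n.factorial * (n : ℝ)) r := by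
    -- The term n = 0 vanishes, and the shifted series is r times the total mass.
    rw [← hasSum_nat_add_iff' 1]
    have := (hasSum_one_poissonMeasure r).mul_left (r : ℝ)
    convert! this using 1
    · ext n
      rw [Nat.factorial_succ]
      push_cast
      field_simp
      ring
    · simp
  rw [poissonMeasure, lintegral_sum_measure]
  have h2 := ENNReal.ofReal_tsum_of_nonneg (fun n => by positivity) h1.summable
  rw [h1.tsum_eq, ENNReal.ofReal_coe_nnreal] at h2
  rw [h2]
  congr with n
  rw [lintegral_smul_measure, lintegral_dirac, smul_eq_mul, ENNReal.ofReal_mul (by positivity)]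
  simp

/-- The Laplace exponent `1 - exp (-n)` of a unit mass. -/
noncomputable def unitExponent (n : ℕ) : ℝ≥0∞ := 1 - ENNReal.ofReal (Real.exp (-n))

lemma lintegral_expWeight_pi_poissonMeasure {k : ℕ} (r : Fin k → ℝ≥0) (t : Fin k → ℕ) :
    ∫⁻ a, expWeight t a ∂Measure.pi (fun j => poissonMeasure (r j)) =
      expNeg (∑ j, unitExponent (t j) * r j) := by
  have h (a : Fin k → ℕ) : expWeight t a =
      ∏ j, (fun n : ℕ => ENNReal.ofReal (Real.exp (-(t j))) ^ n) (a j) := by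
    rw [expWeight, ← Finset.sum_neg_distrib, Real.exp_sum,
      ENNReal.ofReal_prod_of_nonneg fun _ _ => Real.exp_nonneg _]
    refine Finset.prod_congr rfl fun j _ => ?_
    beta_reduce
    rw [← ENNReal.ofReal_pow (Real.exp_nonneg _), ← Real.exp_nat_mul]
    congr 2
    ring
  have hind : iIndepFun (fun (j : Fin k) (a : Fin k → ℕ) =>
      (fun n : ℕ => ENNReal.ofReal (Real.exp (-(t j))) ^ n) (a j))
      (Measure.pi fun j => poissonMeasure (r j)) :=
    iIndepFun_pi (X := fun j (n : ℕ) => ENNReal.ofReal (Real.exp (-(t j : ℝ))) ^ n)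
      fun j => Measurable.of_discrete.aemeasurable
  simp_rw [h]
  rw [lintegral_prod_eq_prod_lintegral_of_indepFun _ _ hind fun j => .of_discrete,
    expNeg_sum]
  refine Finset.prod_congr rfl fun j _ => ?_
  have h1 := lintegral_map (μ := Measure.pi fun j => poissonMeasure (r j))
    (f := fun n : ℕ => ENNReal.ofReal (Real.exp (-(t j : ℝ))) ^ n) .of_discrete
    (measurable_pi_apply j)
  rw [← h1, (measurePreserving_eval (fun j => poissonMeasure (r j)) j).map_eq,
    lintegral_pow_poissonMeasure, unitExponent, mul_comm]
  rw [ENNReal.ofReal_le_one, Real.exp_le_one_iff, neg_nonpos]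
  positivity

lemma lintegral_expWeight_convPow {k : ℕ} {π : Measure (Fin k → ℕ)} [IsProbabilityMeasure π]
    (t : Fin k → ℕ) (n : ℕ) :
    ∫⁻ a, expWeight t a ∂convPow π n = (∫⁻ a, expWeight t a ∂π) ^ n := by
  induction n with
  | zero => simp [convPow, expWeight_zero_right]
  | succ n ih =>
    rw [lintegral_convPow_succ]
    simp_rw [expWeight_add_right, lintegral_const_mul _ Measurable.of_discrete]
    rw [lintegral_mul_const _ .of_discrete, ih, pow_succ]

/-! ### Poisson replication of the lattice. -/

section Poisson

variable {d k : ℕ} {X : Kernel (EuclideanSpace ℝ (Fin d)) (EuclideanSpace ℝ (Fin d))}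
  {B : Fin k → Set (EuclideanSpace ℝ (Fin d))}

/-- At most one of the disjoint sets contains w, so the exponential is an affine function of the
indicators. Stating this as a sum equal to 1 avoids truncated subtraction. -/
lemma expWeight_hitVector (hd : Pairwise fun i j => Disjoint (B i) (B j)) (t : Fin k → ℕ)
    (w : EuclideanSpace ℝ (Fin d)) :
    expWeight t (hitVector B w) + ∑ j, unitExponent (t j) * (hitVector B w j : ℝ≥0∞) = 1 := by
  by_cases h : ∃ i, w ∈ B i
  · obtain ⟨i, hi⟩ := h
    have h0 (j : Fin k) (hj : j ≠ i) : hitVector B w j = 0 := by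
      have : w ∉ B j := fun hj' => Set.disjoint_left.1 (hd hj) hj' hi
      simp [hitVector, this]
    have h1 : hitVector B w i = 1 := by simp [hitVector, hi]
    rw [expWeight, Finset.sum_eq_single i (fun j _ hj => by simp [h0 j hj]) (by simp),
      Finset.sum_eq_single i (fun j _ hj => by simp [h0 j hj]) (by simp), h1, unitExponent]
    simp only [Nat.cast_one, mul_one]
    refine add_tsub_cancel_of_le ?_
    rw [ENNReal.ofReal_le_one, Real.exp_le_one_iff, neg_nonpos]
    positivity
  · push Not at h
    simp [expWeight, hitVector, h]

lemma lintegral_expWeight_hitLaw [IsMarkovKernel X] (hB : ∀ j, MeasurableSet (B j))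
    (hd : Pairwise fun i j => Disjoint (B i) (B j)) (t : Fin k → ℕ)
    (x : EuclideanSpace ℝ (Fin d)) :
    ∫⁻ a, expWeight t a ∂hitLaw X B x +
      ∑ j, unitExponent (t j) * X x {y | x + y ∈ B j} = 1 := by
  have hm := measurable_hitVector_add hB x
  have h1 (j : Fin k) : X x {y | x + y ∈ B j} = ∫⁻ y, (hitVector B (x + y) j : ℝ≥0∞) ∂X x := by
    rw [← lintegral_coord_hitLaw hB x j, hitLaw, lintegral_map .of_discrete hm]
  have hm1 (j : Fin k) : Measurable fun y => (hitVector B (x + y) j : ℝ≥0∞) :=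
    Measurable.of_discrete.comp ((measurable_pi_apply j).comp hm)
  have hm2 : Measurable fun y => expWeight t (hitVector B (x + y)) :=
    (measurable_expWeight t).comp hm
  simp_rw [h1, fun j => (lintegral_const_mul (unitExponent (t j)) (hm1 j) (μ := X x)).symm]
  rw [hitLaw, lintegral_map .of_discrete hm,
    ← lintegral_finsetSum _ fun j _ => (hm1 j).const_mul _, ← lintegral_add_left hm2]
  simp_rw [expWeight_hitVector hd]
  simp

/-- The generating function exp(-λ(1 - q)) of the Poisson law is evaluated at the transform q of one
hit vector, and 1 - q is linear in the hitting probabilities. This linearity makes counts in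
disjoint sets independent. -/
lemma lintegral_expWeight_poisson_replicaCount [IsMarkovKernel X] {lam : ℝ≥0}
    {FN : EuclideanSpace ℝ (Fin d) → unitInterval → ℕ}
    {FX : EuclideanSpace ℝ (Fin d) → unitInterval → EuclideanSpace ℝ (Fin d)}
    (hFN : IsSampler (Kernel.const _ (poissonMeasure lam)) FN) (hFX : IsSampler X FX)
    (hB : ∀ j, MeasurableSet (B j)) (hd : Pairwise fun i j => Disjoint (B i) (B j))
    (t : Fin k → ℕ) (x : EuclideanSpace ℝ (Fin d)) :
    ∫⁻ v, expWeight t (replicaCount FN FX B x v) ∂seedMeasure =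
      expNeg (lam * ∑ j, unitExponent (t j) * X x {y | x + y ∈ B j}) := by
  have := isProbabilityMeasure_hitLaw (X := X) hB x
  have h := lintegral_expWeight_hitLaw (X := X) hB hd t x
  have hle : ∫⁻ a, expWeight t a ∂hitLaw X B x ≤ 1 := h ▸ le_self_add
  rw [lintegral_replicaCount hFN hFX hB x (expWeight t), Kernel.const_apply]
  simp_rw [lintegral_expWeight_convPow]
  rw [lintegral_pow_poissonMeasure _ hle, ← h,
    ENNReal.add_sub_cancel_left (ne_top_of_le_ne_top ENNReal.one_ne_top hle)]

lemma negLog_expNeg {a : ℝ≥0∞} (h : a ≠ ∞) : negLog (expNeg a) = a := by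
  lift a to ℝ≥0 using h
  rw [negLog, ← ENNReal.ofReal_coe_nnreal, expNeg_ofReal a.coe_nonneg,
    ENNReal.toReal_ofReal (Real.exp_nonneg _), Real.log_exp, neg_neg]

lemma unitExponent_ne_top (n : ℕ) : unitExponent n ≠ ∞ :=
  ne_top_of_le_ne_top ENNReal.one_ne_top tsub_le_self

/-- Since the cubes tile the space, the mean measure is λ times Lebesgue measure. -/
lemma perturbationRadon_poisson (lam : ℝ≥0) :
    PerturbationRadon (latticeMeasure d) (Kernel.const _ (poissonMeasure lam)) (cubeKernel d) := by
  intro B hB hb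
  have hm : Measurable fun x => cubeKernel d x {y | x + y ∈ B} :=
    Kernel.measurable_kernel_prodMk_left (κ := cubeKernel d)
      (t := {p : EuclideanSpace ℝ (Fin d) × EuclideanSpace ℝ (Fin d) | p.1 + p.2 ∈ B})
      (measurableSet_preimage measurable_add hB)
  simp_rw [Kernel.const_apply, lintegral_natCast_poissonMeasure]
  rw [lintegral_const_mul _ hm, lintegral_cubeKernel_latticeMeasure hB]
  exact ENNReal.mul_lt_top ENNReal.coe_lt_top hb.measure_lt_top

lemma bind_enumMeasure_of_map_eq_dirac {ρ : Measure (Enumeration d)}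
    {μ : Measure (EuclideanSpace ℝ (Fin d))} (h : ρ.map enumMeasure = .dirac μ) :
    ρ.bind enumMeasure = μ := by
  rw [Measure.bind, h, Measure.join_dirac]

/-- Poisson replication of the lattice gives independent Poisson counts in disjoint sets. -/
lemma countLaw_poisson {lam : ℝ≥0} {FN : EuclideanSpace ℝ (Fin d) → unitInterval → ℕ}
    {FX : EuclideanSpace ℝ (Fin d) → unitInterval → EuclideanSpace ℝ (Fin d)}
    (hFN : IsSampler (Kernel.const _ (poissonMeasure lam)) FN)
    (hFX : IsSampler (cubeKernel d) FX) {ρ : Measure (Enumeration d)} [IsProbabilityMeasure ρ]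
    (hρ : ρ.map enumMeasure = .dirac (latticeMeasure d)) (hB : ∀ j, MeasurableSet (B j))
    (hb : ∀ j, Bornology.IsBounded (B j)) (hd : Pairwise fun i j => Disjoint (B i) (B j)) :
    countLaw ρ seedMeasure (replicaCount FN FX B) =
      Measure.pi fun j => poissonMeasure ((lam • volume : Measure _) (B j)).toNNReal := by
  have hW := measurable_replicaCount hFN.1 hFX.1 hB
  have := isProbabilityMeasure_countLaw (ρ := ρ) (η := seedMeasure) hW
  refine measure_eq_of_lintegral_expWeight_eq fun t => ?_
  have hfin := lintegral_replicaCount_lt_top hFN hFX hB hb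
    (bind_enumMeasure_of_map_eq_dirac hρ ▸ perturbationRadon_poisson lam)
  have hm (s : Set (EuclideanSpace ℝ (Fin d))) (hs : MeasurableSet s) :
      Measurable fun x => cubeKernel d x {y | x + y ∈ s} :=
    Kernel.measurable_kernel_prodMk_left (κ := cubeKernel d)
      (t := {p : EuclideanSpace ℝ (Fin d) × EuclideanSpace ℝ (Fin d) | p.1 + p.2 ∈ s})
      (measurableSet_preimage measurable_add hs)
  have hneg : Measurable fun x =>
      negLog (∫⁻ v, expWeight t (replicaCount FN FX B x v) ∂seedMeasure) :=
    measurable_negLog.comp (measurable_lintegral_mark hW)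
  have hfun : Measurable fun μ : Measure (EuclideanSpace ℝ (Fin d)) => expNeg
      (∫⁻ x, negLog (∫⁻ v, expWeight t (replicaCount FN FX B x v) ∂seedMeasure) ∂μ) :=
    continuous_expNeg.measurable.comp (Measure.measurable_lintegral hneg)
  rw [lintegral_expWeight_countLaw hW hfin, hρ, lintegral_dirac' _ hfun,
    lintegral_expWeight_pi_poissonMeasure]
  congr 1
  -- The exponent is linear in the hitting probabilities, whose sums over the lattice are the
  -- volumes of the sets.
  have hnl (x : EuclideanSpace ℝ (Fin d)) :
      negLog (∫⁻ v, expWeight t (replicaCount FN FX B x v) ∂seedMeasure) =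
        lam * ∑ j, unitExponent (t j) * cubeKernel d x {y | x + y ∈ B j} := by
    rw [lintegral_expWeight_poisson_replicaCount hFN hFX hB hd, negLog_expNeg]
    exact ENNReal.mul_ne_top ENNReal.coe_ne_top (ENNReal.sum_ne_top.2 fun j _ =>
      ENNReal.mul_ne_top (unitExponent_ne_top _) (measure_ne_top _ _))
  simp_rw [hnl]
  rw [lintegral_const_mul _ (Finset.measurable_fun_sum _ fun j _ => (hm _ (hB j)).const_mul _),
    lintegral_finsetSum _ fun j _ => (hm _ (hB j)).const_mul _, Finset.mul_sum]
  refine Finset.sum_congr rfl fun j _ => ?_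
  rw [lintegral_const_mul _ (hm _ (hB j)), lintegral_cubeKernel_latticeMeasure (hB j),
    ENNReal.coe_toNNReal]
  · simp only [Measure.smul_apply, ENNReal.smul_def, smul_eq_mul]
    ring
  · simp only [Measure.smul_apply, ENNReal.smul_def, smul_eq_mul]
    exact ENNReal.mul_ne_top ENNReal.coe_ne_top (hb j).measure_lt_top.ne

/-! ### Construction of the Poisson process -/

/-- A measure with integer values on the elements of a generating algebra, inside a set of finite
measure, has integer values on all measurable subsets of this set. -/
lemma exists_natCast_of_generating {E : Type*} [m : MeasurableSpace E] {C : Set (Set E)}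
    (hC : IsPiSystem C) (hgen : m = MeasurableSpace.generateFrom C) {μ : Measure E} {S : Set E}
    (hSm : MeasurableSet S) (hS : ∃ n : ℕ, μ S = n) (h : ∀ s ∈ C, ∃ n : ℕ, μ (s ∩ S) = n)
    {B : Set E} (hB : MeasurableSet B) : ∃ n : ℕ, μ (B ∩ S) = n := by
  obtain ⟨N, hN⟩ := hS
  have hfin (s : Set E) : μ (s ∩ S) ≠ ∞ :=
    ne_top_of_le_ne_top (hN ▸ ENNReal.natCast_ne_top N) (measure_mono inter_subset_right)
  induction B, hB using MeasurableSpace.induction_on_inter hgen hC with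
  | empty => exact ⟨0, by simp⟩
  | basic s hs => exact h s hs
  | compl s hs ih =>
    obtain ⟨n, hn⟩ := ih
    refine ⟨N - n, ?_⟩
    have h1 := measure_inter_add_sdiff (μ := μ) S hs
    rw [inter_comm, hn, hN, sdiff_eq, inter_comm] at h1
    rw [ENNReal.natCast_sub, ← h1, ENNReal.add_sub_cancel_left (ENNReal.natCast_ne_top n)]
  | iUnion f hd hm ih =>
    choose a ha using ih
    have e : μ ((⋃ i, f i) ∩ S) = ∑' i, (a i : ℝ≥0∞) := by
      rw [iUnion_inter, measure_iUnion (fun i j hij => (hd hij).mono inter_subset_left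
        inter_subset_left) fun i => (hm i).inter hSm]
      simp_rw [ha]
    have h1 := hfin (⋃ i, f i)
    rw [e] at h1 ⊢
    obtain ⟨M₀, hM₀⟩ := exists_tsum_natCast_eq h1
    exact ⟨_, hM₀ M₀ le_rfl⟩

/-- The law of a point process is a point process on the space of measures. -/
lemma IsPointProcess.map_id {Ω : Type*} [MeasurableSpace Ω] {P : Measure Ω}
    {Φ : Ω → Measure (EuclideanSpace ℝ (Fin d))} (h : IsPointProcess P Φ) :
    IsPointProcess (P.map Φ) id := by
  refine ⟨measurable_id, ?_⟩
  -- Being integer valued on all bounded Borel sets is an uncountable family of conditions. It is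
  -- transferred to the image law through a countable generating algebra cut by balls of integer
  -- radius, and then extended to all sets.
  set 𝒜 := generateSetAlgebra
    (MeasurableSpace.countableGeneratingSet (EuclideanSpace ℝ (Fin d))) with h𝒜
  have hcount : 𝒜.Countable :=
    countable_generateSetAlgebra MeasurableSpace.countable_countableGeneratingSet
  have hgen : (inferInstance : MeasurableSpace (EuclideanSpace ℝ (Fin d))) =
      MeasurableSpace.generateFrom 𝒜 := by
    rw [h𝒜, generateFrom_generateSetAlgebra_eq, MeasurableSpace.generateFrom_countableGeneratingSet]
  have hpi : IsPiSystem 𝒜 := fun s hs t ht _ =>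
    isSetAlgebra_generateSetAlgebra.inter_mem hs ht
  have hmeas (s : Set (EuclideanSpace ℝ (Fin d))) (hs : s ∈ 𝒜) : MeasurableSet s := by
    have h1 := MeasurableSpace.measurableSet_generateFrom hs
    rwa [← hgen] at h1
  have hae : ∀ᵐ μ ∂P.map Φ, ∀ (r : ℕ), ∀ s ∈ 𝒜, ∃ n : ℕ, μ (s ∩ Metric.ball 0 r) = (n : ℝ≥0∞) := by
    rw [ae_all_iff]
    intro r
    rw [ae_ball_iff hcount]
    intro s hs
    have hsr := (hmeas s hs).inter (Metric.isOpen_ball (x := 0) (ε := (r : ℝ))).measurableSet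
    have hset : MeasurableSet {μ : Measure (EuclideanSpace ℝ (Fin d)) |
        ∃ n : ℕ, μ (s ∩ Metric.ball 0 r) = (n : ℝ≥0∞)} := by
      have : {μ : Measure (EuclideanSpace ℝ (Fin d)) |
          ∃ n : ℕ, μ (s ∩ Metric.ball 0 r) = (n : ℝ≥0∞)} =
          (fun μ => μ (s ∩ Metric.ball 0 r)) ⁻¹' range ((↑) : ℕ → ℝ≥0∞) := by
        ext μ
        simp [eq_comm]
      rw [this]
      exact Measure.measurable_coe hsr (countable_range _).measurableSet
    rw [ae_map_iff h.1.aemeasurable hset]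
    filter_upwards [h.2] with ω hω
    exact hω _ hsr (Metric.isBounded_ball.subset inter_subset_right)
  filter_upwards [hae] with μ hμ B hB hb
  obtain ⟨r, hr⟩ := hb.subset_ball (0 : EuclideanSpace ℝ (Fin d))
  obtain ⟨m, hm⟩ := exists_nat_ge r
  have hBm : B ∩ Metric.ball 0 m = B :=
    inter_eq_left.2 (hr.trans (Metric.ball_subset_ball hm))
  have huniv := hμ m univ isSetAlgebra_generateSetAlgebra.univ_mem
  rw [univ_inter] at huniv
  have := exists_natCast_of_generating hpi hgen Metric.isOpen_ball.measurableSet huniv (hμ m) hB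
  rwa [hBm] at this

/-- The law of the perturbed measure computed from independent seeds. -/
noncomputable def replicaLaw (ρ : Measure (Enumeration d))
    (FN : EuclideanSpace ℝ (Fin d) → unitInterval → ℕ)
    (FX : EuclideanSpace ℝ (Fin d) → unitInterval → EuclideanSpace ℝ (Fin d)) :
    Measure (Measure (EuclideanSpace ℝ (Fin d))) :=
  (ρ.prod (Measure.infinitePi fun _ : ℕ => seedMeasure)).map
    fun p => markedMeasure (seedMarks FN FX p)

section ReplicaLaw

variable {N : Kernel (EuclideanSpace ℝ (Fin d)) ℕ}
  {FN : EuclideanSpace ℝ (Fin d) → unitInterval → ℕ}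
  {FX : EuclideanSpace ℝ (Fin d) → unitInterval → EuclideanSpace ℝ (Fin d)}
  {ρ : Measure (Enumeration d)}

lemma measurable_markedMeasure_seedMarks (hFN : Measurable (Function.uncurry FN))
    (hFX : Measurable (Function.uncurry FX)) :
    Measurable fun p => markedMeasure (seedMarks FN FX p) :=
  measurable_markedMeasure.comp (measurable_seedMarks hFN hFX)

lemma isProbabilityMeasure_replicaLaw [IsProbabilityMeasure ρ]
    (hFN : Measurable (Function.uncurry FN)) (hFX : Measurable (Function.uncurry FX)) :
    IsProbabilityMeasure (replicaLaw ρ FN FX) :=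
  Measure.isProbabilityMeasure_map (measurable_markedMeasure_seedMarks hFN hFX).aemeasurable

lemma measurable_floor_counts (hB : ∀ j, MeasurableSet (B j)) :
    Measurable fun (μ : Measure (EuclideanSpace ℝ (Fin d))) (j : Fin k) => ⌊μ.real (B j)⌋₊ :=
  measurable_pi_lambda _ fun j => (Measure.measurable_coe (hB j)).ennreal_toReal.nat_floor

lemma map_floor_replicaLaw (hFN : Measurable (Function.uncurry FN))
    (hFX : Measurable (Function.uncurry FX)) (hB : ∀ j, MeasurableSet (B j)) :
    (replicaLaw ρ FN FX).map (fun μ j => ⌊μ.real (B j)⌋₊) =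
      countLaw ρ seedMeasure (replicaCount FN FX B) := by
  rw [replicaLaw, Measure.map_map (measurable_floor_counts hB)
    (measurable_markedMeasure_seedMarks hFN hFX), countLaw]
  congr with p j
  simp only [Function.comp, natCount, measureReal_def, markedMeasure_seedMarks FN FX hB]

/-- Finite means give almost surely finite counts on all balls of integer radius, and a finite sum
of natural numbers is natural. -/
lemma isPointProcess_replicaLaw [IsProbabilityMeasure ρ] [IsMarkovKernel X]
    (hFN : IsSampler N FN) (hFX : IsSampler X FX)
    (hR : PerturbationRadon (ρ.bind enumMeasure) N X) :
    IsPointProcess (replicaLaw ρ FN FX) id := by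
  refine IsPointProcess.map_id ⟨measurable_markedMeasure_seedMarks hFN.1 hFX.1, ?_⟩
  have hballs : ∀ᵐ p ∂ρ.prod (Measure.infinitePi fun _ : ℕ => seedMeasure), ∀ r : ℕ,
      markedMeasure (seedMarks FN FX p) (Metric.ball 0 r) ≠ ∞ := by
    rw [ae_all_iff]
    intro r
    have hB : ∀ j : Fin 1, MeasurableSet
        ((fun _ => Metric.ball 0 r : Fin 1 → Set (EuclideanSpace ℝ (Fin d))) j) :=
      fun _ => Metric.isOpen_ball.measurableSet
    filter_upwards [ae_totalCount_ne_top (measurable_replicaCount hFN.1 hFX.1 hB)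
      (lintegral_replicaCount_lt_top hFN hFX hB (fun _ => Metric.isBounded_ball) hR)] with p hp
    have := markedMeasure_seedMarks FN FX hB p 0
    rw [this]
    exact hp 0
  filter_upwards [hballs] with p hp B hB hb
  refine exists_markedMeasure_eq_natCast _ hB ?_
  obtain ⟨r, hr⟩ := hb.subset_ball (0 : EuclideanSpace ℝ (Fin d))
  obtain ⟨m, hm⟩ := exists_nat_ge r
  exact ne_top_of_le_ne_top (hp m)
    (measure_mono (hr.trans (Metric.ball_subset_ball hm)))

lemma IsPointProcess.ae_eq_floor {Q : Measure (Measure (EuclideanSpace ℝ (Fin d)))}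
    (hQ : IsPointProcess Q id) (hB : ∀ j, MeasurableSet (B j))
    (hb : ∀ j, Bornology.IsBounded (B j)) :
    ∀ᵐ μ ∂Q, ∀ j, μ (B j) = (⌊μ.real (B j)⌋₊ : ℝ≥0∞) := by
  filter_upwards [hQ.2] with μ hμ j
  obtain ⟨n, hn⟩ := hμ (B j) (hB j) (hb j)
  simp only [id] at hn
  simp [measureReal_def, hn]

lemma IsPointProcess.map_counts {Q : Measure (Measure (EuclideanSpace ℝ (Fin d)))}
    (hQ : IsPointProcess Q id) (hB : ∀ j, MeasurableSet (B j))
    (hb : ∀ j, Bornology.IsBounded (B j)) :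
    Q.map (fun μ j => μ (B j)) =
      (Q.map fun μ j => ⌊μ.real (B j)⌋₊).map fun a j => (a j : ℝ≥0∞) := by
  rw [Measure.map_map .of_discrete (measurable_floor_counts hB)]
  refine Measure.map_congr ?_
  filter_upwards [hQ.ae_eq_floor hB hb] with μ hμ
  ext j
  exact hμ j

/-- Poisson replication of the lattice, with uniform translations in the unit cube, yields a
homogeneous Poisson process. -/
lemma isPoissonProcess_replicaLaw [IsProbabilityMeasure ρ] {lam : ℝ≥0}
    (hFN : IsSampler (Kernel.const _ (poissonMeasure lam)) FN)
    (hFX : IsSampler (cubeKernel d) FX)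
    (hρ : ρ.map enumMeasure = .dirac (latticeMeasure d)) :
    IsPoissonProcess (replicaLaw ρ FN FX) id (lam • volume) := by
  have hQ : IsPointProcess (replicaLaw ρ FN FX) id := isPointProcess_replicaLaw hFN hFX
    (bind_enumMeasure_of_map_eq_dirac hρ ▸ perturbationRadon_poisson lam)
  have := isProbabilityMeasure_replicaLaw (ρ := ρ) hFN.1 hFX.1
  have joint {k : ℕ} {B : Fin k → Set (EuclideanSpace ℝ (Fin d))}
      (hB : ∀ j, MeasurableSet (B j)) (hb : ∀ j, Bornology.IsBounded (B j))
      (hd : Pairwise fun i j => Disjoint (B i) (B j)) :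
      (replicaLaw ρ FN FX).map (fun μ j => μ (B j)) = Measure.pi fun j =>
        (poissonMeasure ((lam • volume : Measure _) (B j)).toNNReal).map
          fun n : ℕ => (n : ℝ≥0∞) := by
    rw [hQ.map_counts hB hb, map_floor_replicaLaw hFN.1 hFX.1 hB,
      countLaw_poisson hFN hFX hρ hB hb hd]
    have hsf (j : Fin k) : SigmaFinite ((poissonMeasure
        ((lam • volume : Measure _) (B j)).toNNReal).map fun n : ℕ => (n : ℝ≥0∞)) := by
      have := Measure.isProbabilityMeasure_map (μ := poissonMeasure
        ((lam • volume : Measure _) (B j)).toNNReal) (f := fun n : ℕ => (n : ℝ≥0∞))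
        Measurable.of_discrete.aemeasurable
      infer_instance
    exact Measure.pi_map_pi fun j => Measurable.of_discrete.aemeasurable
  -- A family of one set is vacuously disjoint, so the one-dimensional laws are a case of `joint`;
  -- comparing the two gives independence.
  have marginal (B : Set (EuclideanSpace ℝ (Fin d))) (hB : MeasurableSet B)
      (hb : Bornology.IsBounded B) : (replicaLaw ρ FN FX).map (fun μ => μ B) =
        (poissonMeasure ((lam • volume : Measure _) B).toNNReal).map fun n : ℕ => (n : ℝ≥0∞) := by
    have h1 := joint (B := fun _ : Fin 1 => B) (fun _ => hB) (fun _ => hb)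
      (fun i j hij => (hij (Subsingleton.elim i j)).elim)
    have hm : Measurable fun (μ : Measure (EuclideanSpace ℝ (Fin d))) (_ : Fin 1) => μ B :=
      measurable_pi_lambda _ fun _ => Measure.measurable_coe hB
    have h2 := congrArg (Measure.map fun a : Fin 1 → ℝ≥0∞ => a 0) h1
    have hp := Measure.isProbabilityMeasure_map (μ := poissonMeasure
      ((lam • volume : Measure _) B).toNNReal) (f := fun n : ℕ => (n : ℝ≥0∞))
      Measurable.of_discrete.aemeasurable
    rw [Measure.map_map (measurable_pi_apply 0) hm] at h2
    exact h2.trans (measurePreserving_eval (fun _ : Fin 1 => (poissonMeasure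
      ((lam • volume : Measure _) B).toNNReal).map fun n : ℕ => (n : ℝ≥0∞)) 0).map_eq
  refine ⟨hQ, fun B _ hb => ?_, marginal, fun k B hB hb hd => ?_⟩
  · simp only [Measure.smul_apply, ENNReal.smul_def, smul_eq_mul]
    exact ENNReal.mul_lt_top ENNReal.coe_lt_top hb.measure_lt_top
  · change iIndepFun (fun j (μ : Measure (EuclideanSpace ℝ (Fin d))) => μ (B j)) _
    rw [iIndepFun_iff_map_fun_eq_pi_map fun j => (Measure.measurable_coe (hB j)).aemeasurable]
    refine (joint hB hb hd).trans ?_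
    congr with j : 1
    exact (marginal (B j) (hB j) (hb j)).symm

end ReplicaLaw

/-! ### Comparison of perturbed lattices with the Poisson process -/

/-- The Poisson process is built on the enumeration of the given perturbed lattice, with Poisson
replication. A single Q then serves both directions of the comparison. -/
lemma IsPerturbedLattice.exists_poisson {Ω : Type*} [MeasurableSpace Ω] {P : Measure Ω}
    [IsProbabilityMeasure P] {Ψ : Ω → Measure (EuclideanSpace ℝ (Fin d))}
    {N : Kernel (EuclideanSpace ℝ (Fin d)) ℕ} [IsMarkovKernel N] (h : IsPerturbedLattice N P Ψ)
    (lam : ℝ≥0) :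
    ∃ Q : Measure (Measure (EuclideanSpace ℝ (Fin d))), IsProbabilityMeasure Q ∧
      IsPoissonProcess Q id (lam • volume) ∧
      ((∀ z : Fin d → ℤ, ConvexLE (N (latticePoint z)) (poissonMeasure lam)) →
        ProcessDcxLE P Ψ Q id) ∧
      ((∀ z : Fin d → ℤ, ConvexLE (poissonMeasure lam) (N (latticePoint z))) →
        ProcessDcxLE Q id P Ψ) := by
  obtain ⟨hR, hΨ⟩ := h
  obtain ⟨ρ, _, hρ, H⟩ := hΨ.exists_enumeration
  rw [Measure.map_const, measure_univ, one_smul] at hρ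
  obtain ⟨FN, hFN⟩ := exists_sampler N
  obtain ⟨FN₀, hFN₀⟩ := exists_sampler (d := d) (Kernel.const _ (poissonMeasure lam))
  obtain ⟨FX, hFX⟩ := exists_sampler (cubeKernel d)
  have hQ := isPoissonProcess_replicaLaw hFN₀ hFX hρ
  have hprob := isProbabilityMeasure_replicaLaw (ρ := ρ) hFN₀.1 hFX.1
  have hα := bind_enumMeasure_of_map_eq_dirac hρ
  have hR₀ := perturbationRadon_poisson (d := d) lam
  rw [← hα] at hR hR₀
  have hQY {k : ℕ} {B : Fin k → Set (EuclideanSpace ℝ (Fin d))} (hB : ∀ j, MeasurableSet (B j))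
      (hb : ∀ j, Bornology.IsBounded (B j)) : ∀ᵐ μ ∂replicaLaw ρ FN₀ FX,
        (fun j => (id μ : Measure _).real (B j)) = realCounts fun j => ⌊μ.real (B j)⌋₊ := by
    filter_upwards [hQ.1.ae_eq_floor hB hb] with μ hμ
    ext j
    rw [id, measureReal_def, hμ j]
    simp [realCounts]
  refine ⟨replicaLaw ρ FN₀ FX, hprob, hQ, fun hle k B hB hb => ?_, fun hle k B hB hb => ?_⟩
  · obtain ⟨c, hc, hY, hl⟩ := H FN FX hFN hFX k B hB
    have hle' : ∀ᵐ x ∂ρ.bind enumMeasure,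
        ConvexLE (N x) (Kernel.const (EuclideanSpace ℝ (Fin d)) (poissonMeasure lam) x) := by
      rw [hα, ae_latticeMeasure_iff]
      exact hle
    obtain ⟨h, h', h''⟩ := countLaw_comparison hFN hFN₀ hFX rfl hR hR₀ hle' hB hb
    rw [← hl] at h h' h''
    rw [← map_floor_replicaLaw hFN₀.1 hFX.1 hB] at h h''
    exact dcxLE_of_counts hc (measurable_floor_counts hB) hY (hQY hB hb) h h' h''
  · obtain ⟨c, hc, hY, hl⟩ := H FN FX hFN hFX k B hB
    have hle' : ∀ᵐ x ∂ρ.bind enumMeasure,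
        ConvexLE (Kernel.const (EuclideanSpace ℝ (Fin d)) (poissonMeasure lam) x) (N x) := by
      rw [hα, ae_latticeMeasure_iff]
      exact hle
    obtain ⟨h, h', h''⟩ := countLaw_comparison hFN₀ hFN hFX rfl hR₀ hR hle' hB hb
    rw [← hl] at h h''
    rw [← map_floor_replicaLaw hFN₀.1 hFX.1 hB] at h h' h''
    exact dcxLE_of_counts (measurable_floor_counts hB) hc (hQY hB hb) hY h h' h''

end Poisson

/-! ### Binomial, Poisson and geometric distributions in convex order -/

/-- The chord inequality cleared of denominators, used both to interpolate inside an interval and to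
extrapolate beyond either end. -/
lemma ConvexOn.three_point {f : ℝ → ℝ} (hf : ConvexOn ℝ univ f) {x y z : ℝ} (hxy : x ≤ y)
    (hyz : y ≤ z) (hxz : x < z) : (z - x) * f y ≤ (z - y) * f x + (y - x) * f z := by
  have hne : z - x ≠ 0 := sub_ne_zero.2 hxz.ne'
  have ha : 0 ≤ (z - y) / (z - x) := div_nonneg (by linarith) (by linarith)
  have hb : 0 ≤ (y - x) / (z - x) := div_nonneg (by linarith) (by linarith)
  have hab : (z - y) / (z - x) + (y - x) / (z - x) = 1 := by
    rw [← add_div, div_eq_one_iff_eq hne]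
    ring
  have h := hf.2 (mem_univ x) (mem_univ z) ha hb hab
  have hy : (z - y) / (z - x) * x + (y - x) / (z - x) * z = y := by
    field_simp
    ring
  simp only [smul_eq_mul] at h
  rw [hy] at h
  have h2 := mul_le_mul_of_nonneg_left h (show 0 ≤ z - x by linarith)
  refine h2.trans (le_of_eq ?_)
  field_simp

/-- A convex function lies below an affine function on an interval of integers, and above it on
all other integers. -/
lemma ConvexOn.exists_affine {f : ℝ → ℝ} (hf : ConvexOn ℝ univ f) {a b : ℕ} (hab : a ≤ b) :
    ∃ s c : ℝ, (∀ n : ℕ, a ≤ n → n ≤ b → f n ≤ s * n + c) ∧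
      ∀ n : ℕ, (n < a ∨ b < n) → s * n + c ≤ f n := by
  -- If a = b there is no chord over [a, b]; the one over [a, a + 1] serves, as no integer lies
  -- strictly between b and b'.
  obtain ⟨b', hb', hab', hout⟩ : ∃ b' : ℕ, b ≤ b' ∧ a < b' ∧ ∀ n : ℕ, b < n → b' ≤ n := by
    refine ⟨max b (a + 1), by simp, by simp, fun n hn => ?_⟩
    omega
  have hab'' : (a : ℝ) < b' := by exact_mod_cast hab'
  have hD : (0 : ℝ) < b' - a := by linarith
  set s := (f b' - f a) / (b' - a) with hs
  have hsD : s * (b' - a) = f b' - f a := div_mul_cancel₀ _ hD.ne'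
  have key (t : ℝ) : (b' - a) * (s * t + (f a - s * a)) = (b' - t) * f a + (t - a) * f b' := by
    linear_combination (t - a) * hsD
  refine ⟨s, f a - s * a, fun n han hnb => ?_, fun n hn => ?_⟩
  · refine le_of_mul_le_mul_left ?_ hD
    rw [key]
    exact hf.three_point (by exact_mod_cast han) (by exact_mod_cast hnb.trans hb') hab''
  · refine le_of_mul_le_mul_left ?_ hD
    rw [key]
    rcases hn with hn | hn
    · have hn' : (n : ℝ) < a := by exact_mod_cast hn
      have := hf.three_point hn'.le hab''.le (hn'.trans hab'')
      linarith
    · have hn' : (b' : ℝ) ≤ n := by exact_mod_cast hout n hn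
      have := hf.three_point hab''.le hn' (hab''.trans_le hn')
      linarith

lemma measure_le_of_singleton_le {μ ν : Measure ℕ} {s : Set ℕ} (h : ∀ n ∈ s, μ {n} ≤ ν {n}) :
    μ s ≤ ν s := by
  rw [← Measure.tsum_indicator_apply_singleton μ s .of_discrete,
    ← Measure.tsum_indicator_apply_singleton ν s .of_discrete]
  refine ENNReal.tsum_le_tsum fun n => ?_
  by_cases hn : n ∈ s <;> simp [hn, h]

lemma restrict_le_restrict_of_singleton_le {μ ν : Measure ℕ} {s : Set ℕ}
    (h : ∀ n ∈ s, μ {n} ≤ ν {n}) : μ.restrict s ≤ ν.restrict s := by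
  refine Measure.le_iff.2 fun t ht => ?_
  rw [Measure.restrict_apply ht, Measure.restrict_apply ht]
  exact measure_le_of_singleton_le fun n hn => h n hn.2

/-- Two distributions with the same mean are in convex order if the first one has the larger
weights exactly on an interval. -/
lemma convexLE_of_interval {μ ν : Measure ℕ} [IsProbabilityMeasure μ] [IsProbabilityMeasure ν]
    (hμ : Integrable (fun n : ℕ => (n : ℝ)) μ) (hν : Integrable (fun n : ℕ => (n : ℝ)) ν)
    (hmean : ∫ n : ℕ, (n : ℝ) ∂μ = ∫ n : ℕ, (n : ℝ) ∂ν) {a b : ℕ} (hab : a ≤ b)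
    (hin : ∀ n, a ≤ n → n ≤ b → ν {n} ≤ μ {n}) (hout : ∀ n, (n < a ∨ b < n) → μ {n} ≤ ν {n}) :
    ConvexLE μ ν := by
  intro f hf hfμ hfν
  obtain ⟨s, c, hle, hge⟩ := hf.exists_affine hab
  -- Equal masses and means let the affine part be subtracted. Now h ≤ 0 on [a, b], where μ is
  -- heavier, and h ≥ 0 elsewhere, where ν is heavier.
  set h : ℕ → ℝ := fun n => f n - (s * n + c) with hh
  have aff {m : Measure ℕ} [IsProbabilityMeasure m] (hm : Integrable (fun n : ℕ => (n : ℝ)) m)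
      (hfm : Integrable (fun n : ℕ => f n) m) :
      Integrable h m ∧ ∫ n, h n ∂m = ∫ n : ℕ, f n ∂m - (s * ∫ n : ℕ, (n : ℝ) ∂m + c) := by
    have hi : Integrable (fun n : ℕ => s * (n : ℝ) + c) m :=
      (hm.const_mul s).add (integrable_const c)
    refine ⟨hfm.sub hi, ?_⟩
    rw [hh, integral_sub hfm hi, integral_add (hm.const_mul s) (integrable_const c),
      integral_const_mul]
    simp
  obtain ⟨iμ, eμ⟩ := aff hμ hfμ
  obtain ⟨iν, eν⟩ := aff hν hfν
  suffices H : ∫ n, h n ∂μ ≤ ∫ n, h n ∂ν by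
    rw [eμ, eν, hmean] at H
    linarith
  have hK : MeasurableSet (Icc a b) := .of_discrete
  rw [← integral_add_compl hK iμ, ← integral_add_compl hK iν]
  refine add_le_add ?_ ?_
  · have h1 : ∫ n in Icc a b, -h n ∂ν ≤ ∫ n in Icc a b, -h n ∂μ := by
      refine integral_mono_measure
        (restrict_le_restrict_of_singleton_le fun n hn => hin n hn.1 hn.2) ?_ iμ.integrableOn.neg
      refine (ae_restrict_mem hK).mono fun n hn => ?_
      have := hle n hn.1 hn.2
      simp only [Pi.zero_apply, hh]
      linarith
    rw [integral_neg, integral_neg] at h1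
    linarith
  · have hcompl (n : ℕ) (hn : n ∈ (Icc a b)ᶜ) : n < a ∨ b < n := by
      rw [mem_compl_iff, mem_Icc] at hn
      omega
    refine integral_mono_measure
      (restrict_le_restrict_of_singleton_le fun n hn => hout n (hcompl n hn)) ?_ iν.integrableOn
    refine (ae_restrict_mem hK.compl).mono fun n hn => ?_
    have := hge n (hcompl n hn)
    simp only [Pi.zero_apply, hh]
    linarith

/-- Two distributions with the same mean are in convex order if the ratio of their weights is
unimodal and eventually smaller than one. -/
lemma convexLE_of_unimodal_ratio {μ ν : Measure ℕ} [IsProbabilityMeasure μ]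
    [IsProbabilityMeasure ν] (hμ : Integrable (fun n : ℕ => (n : ℝ)) μ)
    (hν : Integrable (fun n : ℕ => (n : ℝ)) ν)
    (hmean : ∫ n : ℕ, (n : ℝ) ∂μ = ∫ n : ℕ, (n : ℝ) ∂ν) (hpos : ∀ n, 0 < ν.real {n}) {lam : ℝ}
    (hup : ∀ n : ℕ, (n : ℝ) < lam → μ.real {n} * ν.real {n + 1} ≤ μ.real {n + 1} * ν.real {n})
    (hdown : ∀ n : ℕ, lam ≤ n → μ.real {n + 1} * ν.real {n} ≤ μ.real {n} * ν.real {n + 1})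
    (hlarge : ∃ M : ℕ, ∀ n, M < n → μ.real {n} < ν.real {n}) : ConvexLE μ ν := by
  obtain ⟨M, hM⟩ := hlarge
  -- The ratio rises up to `lam` and falls afterwards, so the set where it is at least 1 is an
  -- interval; it is bounded by M and, as the total masses agree, not empty.
  set c : ℕ → ℝ := fun n => μ.real {n} / ν.real {n} with hc
  have cup (n : ℕ) (h : (n : ℝ) < lam) : c n ≤ c (n + 1) := by
    rw [hc, div_le_div_iff₀ (hpos _) (hpos _)]
    exact hup n h
  have cdown (n : ℕ) (h : lam ≤ n) : c (n + 1) ≤ c n := by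
    rw [hc, div_le_div_iff₀ (hpos _) (hpos _)]
    exact hdown n h
  have cone (n : ℕ) : 1 ≤ c n ↔ ν.real {n} ≤ μ.real {n} := one_le_div (hpos n)
  have hne : ∃ n, ν.real {n} ≤ μ.real {n} := by
    by_contra! hlt
    have h1 : μ.real {0}ᶜ ≤ ν.real {0}ᶜ := by
      refine ENNReal.toReal_mono (measure_ne_top _ _) (measure_le_of_singleton_le fun n _ => ?_)
      exact (ENNReal.toReal_le_toReal (measure_ne_top _ _) (measure_ne_top _ _)).1 (hlt n).le
    have h2 := probReal_add_probReal_compl (μ := μ) (MeasurableSet.singleton (0 : ℕ))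
    have h3 := probReal_add_probReal_compl (μ := ν) (MeasurableSet.singleton (0 : ℕ))
    linarith [hlt 0]
  classical
  have hbd : ∀ n, ν.real {n} ≤ μ.real {n} → n ≤ M := fun n hn => by
    by_contra! h
    exact absurd (hM n h) (not_lt.2 hn)
  set a := Nat.find hne with ha
  set b := Nat.findGreatest (fun n => ν.real {n} ≤ μ.real {n}) M with hb
  have haS : ν.real {a} ≤ μ.real {a} := Nat.find_spec hne
  have hbS : ν.real {b} ≤ μ.real {b} :=
    Nat.findGreatest_spec (P := fun n => ν.real {n} ≤ μ.real {n}) (hbd a haS) haS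
  have hab : a ≤ b := Nat.le_findGreatest (hbd a haS) haS
  have toENN {m m' : Measure ℕ} [IsProbabilityMeasure m] [IsProbabilityMeasure m'] {n : ℕ}
      (h : m.real {n} ≤ m'.real {n}) : m {n} ≤ m' {n} :=
    (ENNReal.toReal_le_toReal (measure_ne_top _ _) (measure_ne_top _ _)).1 h
  refine convexLE_of_interval hμ hν hmean hab (fun n han hnb => toENN ?_) fun n hn => toENN ?_
  · rw [← cone]
    -- Left of `lam` the ratio has been rising since a; right of it the ratio keeps falling until b.
    by_cases hn : (n : ℝ) ≤ lam
    · refine ((cone a).2 haS).trans ?_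
      have : ∀ i, a ≤ i → i ≤ n → c a ≤ c i := fun i hai => by
        induction i, hai using Nat.le_induction with
        | base => exact fun _ => le_rfl
        | succ i hai ih =>
          intro hi
          refine (ih (by omega)).trans (cup i ?_)
          have : ((i + 1 : ℕ) : ℝ) ≤ n := by exact_mod_cast hi
          push_cast at this
          linarith
      exact this n han le_rfl
    · refine ((cone b).2 hbS).trans ?_
      have : ∀ i, n ≤ i → c i ≤ c n := fun i hai => by
        induction i, hai using Nat.le_induction with
        | base => exact le_rfl
        | succ i hai ih =>
          refine (cdown i ?_).trans ih
          have : (n : ℝ) ≤ i := by exact_mod_cast hai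
          linarith
      exact this b hnb
  · refine le_of_lt (not_le.1 fun h => ?_)
    rcases hn with hn | hn
    · exact Nat.find_min hne hn h
    · exact absurd (Nat.le_findGreatest (hbd n h) h) (not_le.2 hn)

/-! ### Means of the three distributions and the two comparisons. -/

lemma integrable_natCast_poissonMeasure (r : ℝ≥0) :
    Integrable (fun n : ℕ => (n : ℝ)) (poissonMeasure r) :=
  integrable_natCast_of_lintegral_lt_top (φ := id) (fun _ => le_rfl)
    (by rw [lintegral_natCast_poissonMeasure]; exact ENNReal.coe_lt_top)

lemma integral_natCast_poissonMeasure (r : ℝ≥0) : ∫ n : ℕ, (n : ℝ) ∂poissonMeasure r = r := by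
  rw [integral_eq_lintegral_of_nonneg_ae (ae_of_all _ fun n => Nat.cast_nonneg n)
    Measurable.of_discrete.aestronglyMeasurable]
  simp [lintegral_natCast_poissonMeasure]

lemma integral_natCast_binomial (r : ℕ) (p : unitInterval) :
    ∫ n : ℕ, (n : ℝ) ∂binomial r p = r * p := by
  rw [integral_binomial]
  -- The mean is the identity for the sum of k times the k-th Bernstein polynomial, evaluated at p.
  have h := congrArg (Polynomial.eval (p : ℝ)) (bernsteinPolynomial.sum_smul ℝ r)
  simp only [Polynomial.eval_finsetSum, bernsteinPolynomial,
    Polynomial.eval_mul, Polynomial.eval_pow, Polynomial.eval_sub, Polynomial.eval_one,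
    Polynomial.eval_X, Polynomial.eval_natCast, nsmul_eq_mul] at h
  rw [← h, ← Nat.range_succ_eq_Iic]
  refine Finset.sum_congr rfl fun k _ => ?_
  simp [mul_comm]

lemma convexLE_refl (μ : Measure ℕ) : ConvexLE μ μ := fun _ _ _ _ => le_rfl

lemma poissonMeasure_zero : poissonMeasure 0 = Measure.dirac 0 := by
  refine Measure.ext_of_measureReal_singleton fun n => ?_
  rw [poissonMeasure_real_singleton]
  rcases n with _ | n <;> simp [measureReal_def]

/-- Binomial distributions are smaller than Poisson distributions in convex order. -/
lemma convexLE_binomial_poissonMeasure {r : ℕ} {p : unitInterval} {lam : ℝ≥0}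
    (h : (r : ℝ) * p = lam) : ConvexLE (binomial r p) (poissonMeasure lam) := by
  rcases eq_or_ne lam 0 with rfl | hlam
  · have : binomial r p = poissonMeasure 0 := by
      rw [poissonMeasure_zero]
      rcases mul_eq_zero.1 h with hr | hp
      · rw [Nat.cast_eq_zero.1 hr, binomial_zero]
      · refine Measure.ext_of_measureReal_singleton fun n => ?_
        rw [binomial_real_singleton, hp]
        rcases n with _ | n <;> simp [measureReal_def]
    rw [this]
    exact convexLE_refl _
  have hlam' : (0 : ℝ) < lam := by exact_mod_cast pos_iff_ne_zero.2 hlam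
  have hp0 : (0 : ℝ) ≤ p := p.2.1
  have hq0 : (0 : ℝ) ≤ 1 - p := sub_nonneg.2 p.2.2
  -- Without the common factor K the ratios are decided by (1 - p)λ against (r - n)p. As λ = rp, the
  -- difference is (r - n)p - (1 - p)λ = p(λ - n), so the turning point is λ.
  have step (n : ℕ) (hn : n < r) : ∃ K : ℝ, 0 ≤ K ∧
      (binomial r p).real {n} * (poissonMeasure lam).real {n + 1} = K * ((1 - p) * lam) ∧
      (binomial r p).real {n + 1} * (poissonMeasure lam).real {n} = K * ((r - n) * p) := by
    refine ⟨(r.choose n) * (p : ℝ) ^ n * (1 - p) ^ (r - n - 1) *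
      (Real.exp (-lam) * lam ^ n / (n + 1).factorial), by positivity, ?_, ?_⟩
    · rw [binomial_real_singleton, poissonMeasure_real_singleton]
      conv_lhs => rw [show r - n = (r - n - 1) + 1 by omega, pow_succ, pow_succ]
      ring
    · rw [binomial_real_singleton, poissonMeasure_real_singleton, Nat.factorial_succ,
        show r - (n + 1) = r - n - 1 by omega]
      have hch : (r.choose (n + 1) : ℝ) * (n + 1) = r.choose n * (r - n) := by
        have := Nat.choose_succ_right_eq r n
        rw [← Nat.cast_sub hn.le]
        exact_mod_cast this
      have hf : (n.factorial : ℝ) ≠ 0 := by positivity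
      push_cast
      field_simp
      linear_combination (p * p ^ n * (1 - p) ^ (r - n - 1) : ℝ) * hch
  have hzero (n : ℕ) (hn : r < n) : (binomial r p).real {n} = 0 := by
    rw [binomial_real_singleton, Nat.choose_eq_zero_of_lt hn]
    simp
  have hpos (n : ℕ) := poissonMeasure_real_singleton_pos n (pos_iff_ne_zero.2 hlam)
  refine convexLE_of_unimodal_ratio (integrable_binomial _) (integrable_natCast_poissonMeasure lam)
    ?_ hpos (lam := lam) (fun n hn => ?_) (fun n hn => ?_) ⟨r, fun n hn => ?_⟩
  · rw [integral_natCast_binomial, integral_natCast_poissonMeasure, h]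
  · have hnr : n < r := by
      have : (n : ℝ) < r := by nlinarith [p.2.2, (Nat.cast_nonneg r : (0 : ℝ) ≤ r)]
      exact_mod_cast this
    obtain ⟨K, hK, e₁, e₂⟩ := step n hnr
    rw [e₁, e₂]
    refine mul_le_mul_of_nonneg_left ?_ hK
    nlinarith
  · rcases lt_or_ge n r with hnr | hnr
    · obtain ⟨K, hK, e₁, e₂⟩ := step n hnr
      rw [e₁, e₂]
      refine mul_le_mul_of_nonneg_left ?_ hK
      nlinarith
    · rw [hzero (n + 1) (by omega), zero_mul]
      positivity
  · rw [hzero n hn]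
    exact hpos n

/-- Poisson distributions are smaller than geometric distributions in convex order. -/
lemma convexLE_poissonMeasure_geometricMeasure {p : unitInterval} {lam : ℝ≥0}
    (h : (p : ℝ) * (1 + lam) = 1) : ConvexLE (poissonMeasure lam) (geometricMeasure p) := by
  have hp : p ≠ 0 := by
    rintro rfl
    simp at h
  rcases eq_or_ne lam 0 with rfl | hlam
  · have : geometricMeasure p = poissonMeasure 0 := by
      have hp1 : (p : ℝ) = 1 := by simpa using h
      rw [poissonMeasure_zero]
      refine Measure.ext_of_measureReal_singleton fun n => ?_
      rw [geometricMeasure_real_singleton hp, hp1]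
      rcases n with _ | n <;> simp [measureReal_def]
    rw [this]
    exact convexLE_refl _
  have hlam' : (0 : ℝ) < lam := by exact_mod_cast pos_iff_ne_zero.2 hlam
  have hp0 : (0 : ℝ) < p := lt_of_le_of_ne p.2.1 fun h0 => hp (Subtype.ext h0.symm)
  have hp1 : p ≠ 1 := by
    rintro rfl
    exact hlam (by simpa using h)
  have hq0 : (0 : ℝ) < 1 - p := sub_pos.2 (lt_of_le_of_ne p.2.2 fun h1 => hp1 (Subtype.ext h1))
  have hq : (1 - p : ℝ) * (1 + lam) = lam := by linarith
  have hgeo : HasSum (fun n : ℕ => (n : ℝ) * (1 - p : ℝ) ^ n * p) lam := by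
    have h1 := (hasSum_coe_mul_geometric_of_norm_lt_one (r := (1 - p : ℝ))
      (by rw [Real.norm_of_nonneg hq0.le]; linarith)).mul_right (p : ℝ)
    convert! h1 using 1
    rw [sub_sub_cancel]
    field_simp
    linarith
  have hint : Integrable (fun n : ℕ => (n : ℝ)) (geometricMeasure p) := by
    rw [integrable_geometricMeasure_iff hp]
    refine hgeo.summable.congr fun n => ?_
    rw [Real.norm_of_nonneg (Nat.cast_nonneg n)]
    ring
  refine convexLE_of_unimodal_ratio (integrable_natCast_poissonMeasure lam) hint ?_
    (fun n => geometricMeasure_real_singleton_pos hp hp1 n) (lam := lam) ?_ ?_ ?_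
  · rw [integral_natCast_poissonMeasure, integral_geometricMeasure hp, ← hgeo.tsum_eq]
    refine tsum_congr fun n => ?_
    rw [smul_eq_mul]
    ring
  all_goals simp_rw [geometricMeasure_real_singleton hp, poissonMeasure_real_singleton]
  · intro n hn
    have hK : (0 : ℝ) ≤ Real.exp (-lam) * lam ^ n / (n + 1).factorial * (1 - p : ℝ) ^ n * p := by
      positivity
    -- Successive weights have ratio λ/(n + 1) for the Poisson law and 1 - p for the geometric one.
    -- Since (1 - p)(1 + λ) = λ, the inequality amounts to n ≤ λ.
    have h1 : (n + 1) * (1 - p : ℝ) ≤ lam := by nlinarith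
    have h2 := mul_le_mul_of_nonneg_left h1 hK
    have e : ((n + 1).factorial : ℝ) = (n + 1) * n.factorial := by
      rw [Nat.factorial_succ]; push_cast; ring
    refine le_of_eq_of_le ?_ (h2.trans (le_of_eq ?_))
    · rw [e, pow_succ]
      field_simp
    · rw [pow_succ]
      field_simp
  · intro n hn
    have hK : (0 : ℝ) ≤ Real.exp (-lam) * lam ^ n / (n + 1).factorial * (1 - p : ℝ) ^ n * p := by
      positivity
    have h1 : lam ≤ (n + 1) * (1 - p : ℝ) := by nlinarith
    have h2 := mul_le_mul_of_nonneg_left h1 hK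
    have e : ((n + 1).factorial : ℝ) = (n + 1) * n.factorial := by
      rw [Nat.factorial_succ]; push_cast; ring
    refine le_of_eq_of_le ?_ (h2.trans (le_of_eq ?_))
    · rw [pow_succ]
      field_simp
    · rw [e, pow_succ]
      field_simp
  -- As λ^n = (1 - p)^n (1 + λ)^n, the Poisson weight is smaller as soon as (1 + λ)^n / n! < p
  -- exp(λ).
  · have hlim := (FloorSemiring.tendsto_pow_div_factorial_atTop (1 + lam : ℝ)).eventually_lt_const
      (show (0 : ℝ) < p / Real.exp (-lam) by positivity)
    obtain ⟨M, hM⟩ := Filter.eventually_atTop.1 hlim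
    refine ⟨M, fun n hn => ?_⟩
    have h1 := hM n hn.le
    rw [lt_div_iff₀ (Real.exp_pos _)] at h1
    have h2 := mul_lt_mul_of_pos_left h1 (pow_pos hq0 n)
    refine lt_of_eq_of_lt ?_ h2
    have e : (lam : ℝ) ^ n = (1 - p : ℝ) ^ n * (1 + lam) ^ n := by rw [← mul_pow, hq]
    rw [e]
    ring

/-! ### The proposition. -/

theorem propositionp (d : ℕ) :
    -- dcx monotonicity of the perturbation with respect to the replication kernel
    (∀ {Ω Ω₁ Ω₂ : Type*} [MeasurableSpace Ω] [MeasurableSpace Ω₁] [MeasurableSpace Ω₂]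
      (P : Measure Ω) [IsProbabilityMeasure P]
      (P₁ : Measure Ω₁) [IsProbabilityMeasure P₁] (P₂ : Measure Ω₂) [IsProbabilityMeasure P₂]
      (Φ : Ω → Measure (EuclideanSpace ℝ (Fin d)))
      (Ψ₁ : Ω₁ → Measure (EuclideanSpace ℝ (Fin d)))
      (Ψ₂ : Ω₂ → Measure (EuclideanSpace ℝ (Fin d)))
      (N₁ N₂ : Kernel (EuclideanSpace ℝ (Fin d)) ℕ) [IsMarkovKernel N₁] [IsMarkovKernel N₂]
      (X : Kernel (EuclideanSpace ℝ (Fin d)) (EuclideanSpace ℝ (Fin d))) [IsMarkovKernel X],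
      IsPointProcess P Φ → IsRadon (meanMeasure P Φ) →
      PerturbationRadon (meanMeasure P Φ) N₁ X → PerturbationRadon (meanMeasure P Φ) N₂ X →
      IsPerturbation P Φ N₁ X P₁ Ψ₁ → IsPerturbation P Φ N₂ X P₂ Ψ₂ →
      (∀ᵐ x ∂(meanMeasure P Φ), ConvexLE (N₁ x) (N₂ x)) →
        ProcessDcxLE P₁ Ψ₁ P₂ Ψ₂) ∧
    -- perturbed lattices: comparison with the Poisson process of intensity `lam`
    (∀ {Ω : Type*} [MeasurableSpace Ω] (P : Measure Ω) [IsProbabilityMeasure P]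
      (Ψ : Ω → Measure (EuclideanSpace ℝ (Fin d)))
      (N : Kernel (EuclideanSpace ℝ (Fin d)) ℕ) [IsMarkovKernel N] (lam : ℝ≥0),
      IsPerturbedLattice N P Ψ →
        ((∀ z : Fin d → ℤ, ConvexLE (N (latticePoint z)) (poissonMeasure lam)) →
          IsSubPoisson P Ψ (lam • volume)) ∧
        ((∀ z : Fin d → ℤ, ConvexLE (poissonMeasure lam) (N (latticePoint z))) →
          IsSuperPoisson P Ψ (lam • volume))) ∧
    -- in particular, binomial and geometric numbers of replicas
    (∀ {Ω : Type*} [MeasurableSpace Ω] (P : Measure Ω) [IsProbabilityMeasure P]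
      (Ψ : Ω → Measure (EuclideanSpace ℝ (Fin d))) (lam : ℝ≥0) (p : unitInterval),
      (∀ r : ℕ, (r : ℝ) * p = lam →
        IsPerturbedLattice (Kernel.const _ (binomial r p)) P Ψ →
          IsSubPoisson P Ψ (lam • volume)) ∧
      ((p : ℝ) * (1 + lam) = 1 →
        IsPerturbedLattice (Kernel.const _ (geometricMeasure p)) P Ψ →
          IsSuperPoisson P Ψ (lam • volume)))
    := by
  refine ⟨?_, ?_, ?_⟩
  · intro Ω Ω₁ Ω₂ _ _ _ P _ P₁ _ P₂ _ Φ Ψ₁ Ψ₂ N₁ N₂ _ _ X _ _ _ h₁ h₂ hΨ₁ hΨ₂ hle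
    exact IsPerturbation.processDcxLE h₁ h₂ hΨ₁ hΨ₂ hle
  · intro Ω _ P _ Ψ N _ lam h
    obtain ⟨Q, hQ, hpoi, hsub, hsup⟩ := h.exists_poisson lam
    exact ⟨fun hle => ⟨Q, hQ, hpoi, hsub hle⟩, fun hle => ⟨Q, hQ, hpoi, hsup hle⟩⟩
  · intro Ω _ P _ Ψ lam p
    refine ⟨fun r hr h => ?_, fun hp h => ?_⟩
    · obtain ⟨Q, hQ, hpoi, hsub, -⟩ := h.exists_poisson lam
      exact ⟨Q, hQ, hpoi, hsub fun z => convexLE_binomial_poissonMeasure hr⟩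
    · obtain ⟨Q, hQ, hpoi, -, hsup⟩ := h.exists_poisson lam
      exact ⟨Q, hQ, hpoi, hsup fun z => convexLE_poissonMeasure_geometricMeasure hp⟩
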